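/- All manifolds are finite-dimensional, Hausdorff and second countable, and all objects are smooth ($C^\infty$). An almost-symplectic manifold $(M,\sigma)$ is a manifold with a non-degenerate 2-form $\sigma$, not necessarily closed. For $f\in C^\infty(M)$, let $X_f^\sigma$ be the vector field defined by $i_{X_f^\sigma}\sigma=-df$. A vector field $X$ is called fully-Hamiltonian if $i_X\sigma$ is exact and $L_X\sigma=0$, and $f$ is called fully-Hamiltonian, $f\in\mathcal H_F^\sigma(M)$, if $X^\sigma_f$ is. Let a Lie group $G$ with Lie algebra $\mathfrak g$ act on $(M,\sigma)$. Assume that the action is almost-symplectic (every $g\in G$ preserves $\sigma$) and fully-Hamiltonian (the infinitesimal generators $Y_\xi$, $\xi\in\mathfrak g$, are all fully-Hamiltonian). Let $J:M\to\mathfrak g^*$ be a momentum map, that is, $d\langle J,\xi\rangle=-i_{Y_\xi}\sigma$ for all $\xi\in\mathfrak g$, and assume that $J$ is equivariant with respect to the coadjoint action. Let $c\in\mathfrak g^*$ be a regular value of $J$, let $G_c$ be the isotropy subgroup of $c$ for the coadjoint action, and assume that $G_c$ acts freely and properly on $J^{-1}(c)$. Let $\iota_c:J^{-1}(c)\hookrightarrow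 M$ be the inclusion and $p_c:J^{-1}(c)\to M_c:=J^{-1}(c)/G_c$ the projection. For a $G$-invariant $f\in C^\infty(M)$, let $f_c:M_c\to\mathbb R$ be the function with $f_c\circ p_c=f\circ\iota_c$. Then $J^{-1}(c)$ has a smooth structure for which $\iota_c$ is a smooth embedding, the quotient space $M_c$ is Hausdorff and second countable and has a smooth structure for which $p_c$ is a smooth submersion, and for all such smooth structures: (i) There exists an almost-symplectic form $\sigma_c$ on $M_c$ such that $p_c^*\sigma_c=\iota_c^*\sigma$. (ii) If $f\in C^\infty(M)$ is $G$-invariant, then $f_c\in C^\infty(M_c)$, $X_f^\sigma$ is tangent to $J^{-1}(c)$, and $X_{f_c}^{\sigma_c}$ is $p_c$-related to the restriction of $X_f^\sigma$ to $J^{-1}(c)$, that is, $T_mp_c\cdot X_f^\sigma(m)=X_{f_c}^{\sigma_c}(p_c(m))$ for all $m\in J^{-1}(c)$. (iii) If $f\in\mathcal H_F^\sigma(M)$ is $G$-invariant, then $f_c\in\mathcal H_F^{\sigma_c}(M_c)$. -/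

import Mathlib

open scoped Manifold ContDiff

namespace AlmostSymplectic

section Forms

variable {E : Type*} [NormedAddCommGroup E] [NormedSpace ℝ E]
  {H : Type*} [TopologicalSpace H] (I : ModelWithCorners ℝ E H)
  {M : Type*} [TopologicalSpace M] [ChartedSpace H M]

/-- A field of (continuous) bilinear forms on the tangent spaces of `M`. -/
abbrev BilinField (M : Type*) [TopologicalSpace M] [ChartedSpace H M] : Type _ :=
  ∀ x : M, TangentSpace I x →L[ℝ] TangentSpace I x →L[ℝ] ℝ

/-- A (not necessarily continuous) vector field on `M`. -/
abbrev VectField (M : Type*) [TopologicalSpace M] [ChartedSpace H M] : Type _ :=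
  ∀ x : M, TangentSpace I x

/-- `σ` is an almost-symplectic form: a smooth, non-degenerate 2-form, not necessarily closed.
Non-degeneracy forces every tangent space to be even-dimensional. -/
structure IsAlmostSymplectic [IsManifold I ∞ M] (σ : BilinField I M) : Prop where
  alternating : ∀ (x : M) (v : TangentSpace I x), σ x v v = 0
  nondegenerate : ∀ (x : M) (v : TangentSpace I x), (∀ w, σ x v w = 0) → v = 0
  smooth : ContMDiff I (I.prod 𝓘(ℝ, E →L[ℝ] E →L[ℝ] ℝ)) ∞
    (fun x ↦ Bundle.TotalSpace.mk' (E →L[ℝ] E →L[ℝ] ℝ)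
      (E := fun x : M ↦ TangentSpace I x →L[ℝ] TangentSpace I x →L[ℝ] ℝ) x (σ x))

/-- The value at `x` of `(L_X σ)(Y, Z) = X(σ(Y, Z)) - σ([X, Y], Z) - σ(Y, [X, Z])`. -/
noncomputable def lieDeriv (σ : BilinField I M) (X Y Z : VectField I M) (x : M) : ℝ :=
  mvfderiv I (fun y ↦ σ y (Y y) (Z y)) x (X x)
    - σ x (VectorField.mlieBracket I X Y x) (Z x)
    - σ x (Y x) (VectorField.mlieBracket I X Z x)

/-- `L_X σ = 0`: the Lie derivative vanishes at every point `x`, on all vector fields `Y`, `Z` that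
are smooth at `x`. -/
def IsSymmetry [IsManifold I ∞ M] (σ : BilinField I M) (X : VectField I M) : Prop :=
  ∀ (x : M) (Y Z : VectField I M),
    ContMDiffAt I I.tangent ∞ (fun y ↦ (⟨y, Y y⟩ : TangentBundle I M)) x →
    ContMDiffAt I I.tangent ∞ (fun y ↦ (⟨y, Z y⟩ : TangentBundle I M)) x →
    lieDeriv I σ X Y Z x = 0

/-- `i_X σ = -df`. -/
def HasHamiltonian (σ : BilinField I M) (X : VectField I M) (f : M → ℝ) : Prop :=
  ∀ (x : M) (v : TangentSpace I x), σ x (X x) v = -mvfderiv I f x v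

/-- `X` is partially-Hamiltonian: `i_X σ` is exact. -/
def IsPartiallyHamiltonian (σ : BilinField I M) (X : VectField I M) : Prop :=
  ∃ f : M → ℝ, ContMDiff I 𝓘(ℝ, ℝ) ∞ f ∧ HasHamiltonian I σ X f

/-- `X` is fully-Hamiltonian: it is partially-Hamiltonian and `L_X σ = 0`. -/
def IsFullyHamiltonian [IsManifold I ∞ M] (σ : BilinField I M) (X : VectField I M) : Prop :=
  IsPartiallyHamiltonian I σ X ∧ IsSymmetry I σ X

/-- The vector field `X_f^σ`: the solution `X` of `i_X σ = -df`, obtained by inverting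
`v ↦ σ(v, ·)`. See `hasHamiltonian_hamVectField`. -/
noncomputable def hamVectField (σ : BilinField I M) (f : M → ℝ) : VectField I M :=
  fun x ↦ (σ x).inverse (-mvfderiv I f x)

theorem hasHamiltonian_hamVectField [FiniteDimensional ℝ E] [IsManifold I ∞ M]
    {σ : BilinField I M} (hσ : IsAlmostSymplectic I σ) (f : M → ℝ) :
    HasHamiltonian I σ (hamVectField I σ f) f := by
  intro x v
  have key : ∀ B : E →L[ℝ] E →L[ℝ] ℝ, (∀ u, (∀ w, B u w = 0) → u = 0) → ∀ ℓ : E →L[ℝ] ℝ,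
      B (B.inverse ℓ) = ℓ := by
    intro B hB ℓ
    have hinj : Function.Injective (B : E →ₗ[ℝ] (E →L[ℝ] ℝ)) := by
      rw [injective_iff_map_eq_zero]
      intro u hu
      apply hB u
      intro w
      have hu' : B u = 0 := hu
      simp [hu']
    have hdim : Module.finrank ℝ E = Module.finrank ℝ (E →L[ℝ] ℝ) := by
      rw [← (LinearMap.toContinuousLinearMap (𝕜 := ℝ) (E := E) (F' := ℝ)).finrank_eq]
      exact (Subspace.dual_finrank_eq (K := ℝ) (V := E)).symm
    let e : E ≃L[ℝ] (E →L[ℝ] ℝ) :=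
      (LinearEquiv.ofInjectiveOfFinrankEq (B : E →ₗ[ℝ] (E →L[ℝ] ℝ)) hinj
        hdim).toContinuousLinearEquiv
    have he : B = (e : E →L[ℝ] (E →L[ℝ] ℝ)) := by ext u w; rfl
    rw [he, ContinuousLinearMap.inverse_equiv]
    exact e.apply_symm_apply ℓ
  have h := key (σ x) (hσ.nondegenerate x) (-mvfderiv I f x)
  exact congrArg (fun B : E →L[ℝ] ℝ ↦ B v) h

/-- `f` belongs to the set of fully-Hamiltonian functions of `(M, σ)`. -/
def IsFullyHamiltonianFun [IsManifold I ∞ M] (σ : BilinField I M) (f : M → ℝ) : Prop :=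
  ContMDiff I 𝓘(ℝ, ℝ) ∞ f ∧ IsFullyHamiltonian I σ (hamVectField I σ f)

end Forms

section Coadjoint

/- The Lie algebra of a Lie group `G` modelled on `F` is the tangent space at the identity, which is
by definition the vector space `F`. -/

variable {F : Type*} [NormedAddCommGroup F] [NormedSpace ℝ F]
  {G : Type*} [TopologicalSpace G] [ChartedSpace F G] [Group G]

/-- The Lie algebra of `G` as a normed space: the tangent space `T_1 G`, which is `F`. -/
abbrev LieAlg (F : Type*) : Type _ := F

/-- `𝔤* = (T_1 G)*`. -/
abbrev DualLieAlg (F : Type*) [NormedAddCommGroup F] [NormedSpace ℝ F] : Type _ :=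
  LieAlg F →L[ℝ] ℝ

variable (F) in
/-- `Ad_g`: the derivative at the identity of the conjugation by `g`. -/
noncomputable def Ad (g : G) : LieAlg F →L[ℝ] LieAlg F :=
  mfderiv 𝓘(ℝ, F) 𝓘(ℝ, F) (fun h : G ↦ g * h * g⁻¹) 1

/-- The coadjoint action `c ↦ c ∘ Ad_{g⁻¹}` of `G` on the dual of its Lie algebra. -/
noncomputable def coAd (g : G) (c : DualLieAlg F) : DualLieAlg F :=
  c.comp (Ad F g⁻¹)

theorem Ad_one : Ad F (1 : G) = ContinuousLinearMap.id ℝ F := by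
  have : (fun h : G ↦ (1 : G) * h * (1 : G)⁻¹) = id := by ext h; simp
  unfold Ad
  rw [this]
  exact mfderiv_id

theorem Ad_mul [LieGroup 𝓘(ℝ, F) ∞ G] (g h : G) :
    Ad F (g * h) = (Ad F g).comp (Ad F h) := by
  have hd : ∀ (a k : G),
      MDifferentiableAt 𝓘(ℝ, F) 𝓘(ℝ, F) (fun h : G ↦ a * h * a⁻¹) k := fun a k ↦ by
    have : ContMDiff 𝓘(ℝ, F) 𝓘(ℝ, F) ∞ (fun h : G ↦ a * h * a⁻¹) :=
      (contMDiff_const.mul contMDiff_id).mul contMDiff_const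
    exact (this k).mdifferentiableAt (by simp)
  have hfun : (fun k : G ↦ g * h * k * (g * h)⁻¹)
      = (fun k : G ↦ g * k * g⁻¹) ∘ (fun k : G ↦ h * k * h⁻¹) := by
    ext k; simp [mul_assoc]
  have h1 : h * 1 * h⁻¹ = (1 : G) := by simp
  have hc := mfderiv_comp (I := 𝓘(ℝ, F)) (I' := 𝓘(ℝ, F)) (I'' := 𝓘(ℝ, F)) (1 : G)
    (g := fun k : G ↦ g * k * g⁻¹) (f := fun k : G ↦ h * k * h⁻¹) (hd g _) (hd h 1)
  have key : ∀ y : G, y = 1 →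
      (mfderiv 𝓘(ℝ, F) 𝓘(ℝ, F) (fun k : G ↦ g * k * g⁻¹) y : F →L[ℝ] F) = Ad F g := by
    rintro y rfl; rfl
  unfold Ad at *
  rw [hfun]
  refine hc.trans ?_
  exact congrArg (fun A : F →L[ℝ] F ↦
    A.comp (mfderiv 𝓘(ℝ, F) 𝓘(ℝ, F) (fun k : G ↦ h * k * h⁻¹) 1 : F →L[ℝ] F)) (key _ h1)

theorem coAd_one (c : DualLieAlg F) : coAd (1 : G) c = c := by
  simp [coAd, Ad_one]

theorem coAd_mul [LieGroup 𝓘(ℝ, F) ∞ G] (g h : G) (c : DualLieAlg F) :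
    coAd (g * h) c = coAd g (coAd h c) := by
  simp [coAd, Ad_mul, ContinuousLinearMap.comp_assoc]

variable (G) in
/-- `G_c`, the isotropy subgroup of `c` relative to the coadjoint action. -/
def isotropy [LieGroup 𝓘(ℝ, F) ∞ G] (c : DualLieAlg F) : Subgroup G where
  carrier := {g | coAd g c = c}
  mul_mem' := by
    intro a b ha hb
    simp only [Set.mem_ofPred_eq] at ha hb ⊢
    rw [coAd_mul, hb, ha]
  one_mem' := coAd_one c
  inv_mem' := by
    intro a ha
    simp only [Set.mem_ofPred_eq] at ha ⊢
    conv_lhs => rw [← ha]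
    rw [← coAd_mul, inv_mul_cancel, coAd_one]

end Coadjoint

section Actions

variable {F : Type*} [NormedAddCommGroup F] [NormedSpace ℝ F]
  {G : Type*} [TopologicalSpace G] [ChartedSpace F G] [Group G]
  {E : Type*} [NormedAddCommGroup E] [NormedSpace ℝ E]
  {M : Type*} [TopologicalSpace M] [ChartedSpace E M] [MulAction G M]

variable (G E M) in
/-- The infinitesimal generator `Y_ξ` of the action: `Y_ξ(x)` is the derivative at the identity, in
the direction `ξ`, of the orbit map `g ↦ g • x`. -/
noncomputable def infGen (ξ : LieAlg F) : VectField 𝓘(ℝ, E) M :=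
  fun x ↦ mfderiv 𝓘(ℝ, F) 𝓘(ℝ, E) (fun g : G ↦ g • x) 1 ξ

variable (G) in
/-- The action is almost-symplectic: every `g` preserves `σ`. -/
def IsAlmostSymplecticAction (σ : BilinField 𝓘(ℝ, E) M) : Prop :=
  ∀ (g : G) (x : M) (v w : TangentSpace 𝓘(ℝ, E) x),
    σ (g • x) (mfderiv 𝓘(ℝ, E) 𝓘(ℝ, E) (fun y : M ↦ g • y) x v)
      (mfderiv 𝓘(ℝ, E) 𝓘(ℝ, E) (fun y : M ↦ g • y) x w) = σ x v w

variable (F G) in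
/-- The action is fully-Hamiltonian: all its infinitesimal generators are. -/
def IsFullyHamiltonianAction [IsManifold 𝓘(ℝ, E) ∞ M] (σ : BilinField 𝓘(ℝ, E) M) : Prop :=
  ∀ ξ : LieAlg F, IsFullyHamiltonian 𝓘(ℝ, E) σ (infGen G E M ξ)

variable (G) in
/-- `J : M → 𝔤*` is a (smooth) momentum map: `dJ_ξ = -i_{Y_ξ} σ` where `J_ξ = ⟨J, ξ⟩`. -/
structure IsMomentumMap (σ : BilinField 𝓘(ℝ, E) M) (J : M → DualLieAlg F) : Prop where
  smooth : ContMDiff 𝓘(ℝ, E) 𝓘(ℝ, DualLieAlg F) ∞ J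
  hamiltonian : ∀ ξ : LieAlg F, HasHamiltonian 𝓘(ℝ, E) σ (infGen G E M ξ) (fun x ↦ J x ξ)

variable (G) in
/-- `J` intertwines the action on `M` and the coadjoint action. -/
def IsEquivariant (J : M → DualLieAlg F) : Prop :=
  ∀ (g : G) (x : M), J (g • x) = coAd g (J x)

variable (E) in
/-- `c` is a regular value of `J`. -/
def IsRegularValue (J : M → DualLieAlg F) (c : DualLieAlg F) : Prop :=
  ∀ x : M, J x = c → Function.Surjective (mvfderiv 𝓘(ℝ, E) J x)

/-- `J⁻¹(c)`, with the subspace topology. -/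
abbrev LevelSet (J : M → DualLieAlg F) (c : DualLieAlg F) : Type _ := {x : M // J x = c}

/-- The action of `G_c` on `J⁻¹(c)`. -/
@[reducible] def levelAction [LieGroup 𝓘(ℝ, F) ∞ G] {J : M → DualLieAlg F}
    (hJ : IsEquivariant G J) (c : DualLieAlg F) : MulAction (isotropy G c) (LevelSet J c) where
  smul g x := ⟨(g : G) • (x : M), by rw [hJ, x.2]; exact g.2⟩
  one_smul x := Subtype.ext (one_smul G (x : M))
  mul_smul g h x := Subtype.ext (mul_smul (g : G) (h : G) (x : M))

/-- `G_c` acts freely on `J⁻¹(c)`. -/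
def ActsFreely [LieGroup 𝓘(ℝ, F) ∞ G] {J : M → DualLieAlg F}
    (hJ : IsEquivariant G J) (c : DualLieAlg F) : Prop :=
  letI := levelAction hJ c
  ∀ (g : isotropy G c) (x : LevelSet J c), g • x = x → g = 1

/-- `G_c` acts properly on `J⁻¹(c)`. -/
def ActsProperly [LieGroup 𝓘(ℝ, F) ∞ G] {J : M → DualLieAlg F}
    (hJ : IsEquivariant G J) (c : DualLieAlg F) : Prop :=
  letI := levelAction hJ c
  ProperSMul (isotropy G c) (LevelSet J c)

/-- The reduced space `M_c = J⁻¹(c) / G_c`, with the quotient topology. -/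
abbrev ReducedSpace [LieGroup 𝓘(ℝ, F) ∞ G] {J : M → DualLieAlg F}
    (hJ : IsEquivariant G J) (c : DualLieAlg F) : Type _ :=
  Quotient (@MulAction.orbitRel (isotropy G c) (LevelSet J c) _ (levelAction hJ c))

/-- The inclusion `J⁻¹(c) → M`. -/
def levelIncl (J : M → DualLieAlg F) (c : DualLieAlg F) : LevelSet J c → M := Subtype.val

/-- The projection `p_c : J⁻¹(c) → M_c`. -/
def redProj [LieGroup 𝓘(ℝ, F) ∞ G] {J : M → DualLieAlg F}
    (hJ : IsEquivariant G J) (c : DualLieAlg F) : LevelSet J c → ReducedSpace hJ c :=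
  Quotient.mk _

variable (G) in
/-- `f` is `G`-invariant. -/
def IsInvariantFun (f : M → ℝ) : Prop := ∀ (g : G) (x : M), f (g • x) = f x

/-- The function `f_c` on `M_c` induced by a `G`-invariant function `f`, that is,
`f_c ∘ p_c` is the restriction of `f` to `J⁻¹(c)`. -/
def redFun [LieGroup 𝓘(ℝ, F) ∞ G] {J : M → DualLieAlg F}
    (hJ : IsEquivariant G J) (c : DualLieAlg F) {f : M → ℝ} (hf : IsInvariantFun G f) :
    ReducedSpace hJ c → ℝ :=
  Quotient.lift (fun x : LevelSet J c ↦ f x) (by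
    rintro x y ⟨g, hg⟩
    have hg' : (g : G) • (y : M) = x := congrArg Subtype.val hg
    change f x = f y
    rw [← hg', hf])

end Actions

end AlmostSymplectic

open AlmostSymplectic

/-! This is Marsden–Weinstein reduction with closedness of `σ` playing no role. Pointwise linear
algebra carries (i) and (ii). The momentum identity says that `σ(Y_ξ, ·)` is `-dJ_ξ`, so along the
level set the `σ`-orthogonal of `ker dJ` consists of the vectors `Y_ξ`, and its part inside `ker dJ`
comes from the isotropy algebra of `c`. That part is also the kernel of `dp_c`. Hence `ι_c^*σ` is
`G_c`-invariant with radical exactly `ker dp_c`, and descends to a non-degenerate form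
(`form_levelIncl_eq_of_redProj_eq`, `exists_reduced_form`, `isAlmostSymplectic_of_pullForm_eq`). For
invariant `f`, the pairing `σ(X_f, Y_ξ) = -df(Y_ξ)` vanishes, so `X_f` is tangent to the level set,
and non-degeneracy downstairs identifies its projection (`exists_tderiv_eq_hamVectField`).

For (iii), the Lie derivative is natural under related fields. The restriction `w` of `X_f` to the
level set is `ι_c`-related to `X_f` and `p_c`-related to `X_{f_c}`, so `L_w` of the common pull-back
computes both Lie derivatives (`lieForm_bilinearComp`, `IsSymmetry.of_related`).

The manifold structures need the regular value theorem and a slice theorem. `G_c` is a fibre of the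
constant-rank map `g ↦ coAd g c`, which gives a local parametrization of `G_c` near `1`. Multiplying
it with a transversal to the orbit gives local coordinates on the level set, and freeness with
properness ensures that two nearby points share an orbit only if their transversal coordinates agree
(`exists_slice`). These slices are charts of the quotient. Statements about arbitrary admissible
smooth structures use only that the inclusion is an embedding and the projection a submersion.

The auxiliary `tderiv`, `form` and `vect` regard tangent spaces as the fixed model space, so that
base points can be rewritten freely. -/

namespace AlmostSymplectic

open Set Filter Topology

set_option linter.unusedSectionVars false

/-! ### Differential calculus on manifolds without boundary: inverse functions and submersions. -/

section Calculus

variable {E : Type*} [NormedAddCommGroup E] [NormedSpace ℝ E]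
  {X : Type*} [TopologicalSpace X] [ChartedSpace E X]
  {E₁ : Type*} [NormedAddCommGroup E₁] [NormedSpace ℝ E₁]
  {Y : Type*} [TopologicalSpace Y] [ChartedSpace E₁ Y]
  {E₂ : Type*} [NormedAddCommGroup E₂] [NormedSpace ℝ E₂]
  {Z : Type*} [TopologicalSpace Z] [ChartedSpace E₂ Z]

variable (E E₁) in
/-- The derivative of a map between manifolds without boundary, as a map of model spaces. -/
noncomputable def tderiv (f : X → Y) (x : X) : E →L[ℝ] E₁ :=
  mfderiv 𝓘(ℝ, E) 𝓘(ℝ, E₁) f x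

variable (E E₁) in
/-- Smoothness at a point, for manifolds without boundary. -/
def SmoothAt (f : X → Y) (x : X) : Prop := ContMDiffAt 𝓘(ℝ, E) 𝓘(ℝ, E₁) ∞ f x

theorem SmoothAt.mdifferentiableAt {f : X → Y} {x : X} (hf : SmoothAt E E₁ f x) :
    MDifferentiableAt 𝓘(ℝ, E) 𝓘(ℝ, E₁) f x :=
  ContMDiffAt.mdifferentiableAt hf (by simp)

theorem SmoothAt.continuousAt {f : X → Y} {x : X} (hf : SmoothAt E E₁ f x) :
    ContinuousAt f x := ContMDiffAt.continuousAt hf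

theorem SmoothAt.comp {g : Y → Z} {f : X → Y} {x : X} (hg : SmoothAt E₁ E₂ g (f x))
    (hf : SmoothAt E E₁ f x) : SmoothAt E E₂ (fun y ↦ g (f y)) x :=
  ContMDiffAt.comp x hg hf

theorem SmoothAt.comp_of_eq {g : Y → Z} {f : X → Y} {x : X} {y : Y}
    (hg : SmoothAt E₁ E₂ g y) (hf : SmoothAt E E₁ f x) (hy : f x = y) :
    SmoothAt E E₂ (fun y ↦ g (f y)) x := by
  subst hy; exact hg.comp hf

theorem SmoothAt.congr {f g : X → Y} {x : X} (hf : SmoothAt E E₁ f x) (h : g =ᶠ[𝓝 x] f) :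
    SmoothAt E E₁ g x :=
  ContMDiffAt.congr_of_eventuallyEq hf h

theorem smoothAt_iff_contDiffAt {f : E → E₁} {x : E} :
    SmoothAt E E₁ f x ↔ ContDiffAt ℝ ∞ f x := contMDiffAt_iff_contDiffAt

theorem smoothAt_const {c : Y} {x : X} : SmoothAt E E₁ (fun _ : X ↦ c) x := contMDiffAt_const

theorem smoothAt_id {x : X} : SmoothAt E E (fun y : X ↦ y) x := contMDiffAt_id

theorem tderiv_comp {g : Y → Z} {f : X → Y} {x : X} (hg : SmoothAt E₁ E₂ g (f x))
    (hf : SmoothAt E E₁ f x) :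
    tderiv E E₂ (fun y ↦ g (f y)) x = (tderiv E₁ E₂ g (f x)).comp (tderiv E E₁ f x) :=
  mfderiv_comp x hg.mdifferentiableAt hf.mdifferentiableAt

theorem tderiv_comp_of_eq {g : Y → Z} {f : X → Y} {x : X} {y : Y} (hg : SmoothAt E₁ E₂ g y)
    (hf : SmoothAt E E₁ f x) (hy : f x = y) :
    tderiv E E₂ (fun y ↦ g (f y)) x = (tderiv E₁ E₂ g y).comp (tderiv E E₁ f x) := by
  subst hy; exact tderiv_comp hg hf

theorem tderiv_congr {f g : X → Y} {x : X} (h : f =ᶠ[𝓝 x] g) :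
    tderiv E E₁ f x = tderiv E E₁ g x := Filter.EventuallyEq.mfderiv_eq h

theorem tderiv_eq_fderiv {f : E → E₁} {x : E} : tderiv E E₁ f x = fderiv ℝ f x :=
  mfderiv_eq_fderiv

theorem tderiv_const {c : Y} {x : X} : tderiv E E₁ (fun _ : X ↦ c) x = 0 := mfderiv_const

theorem tderiv_id {x : X} : tderiv E E (fun y : X ↦ y) x = ContinuousLinearMap.id ℝ E :=
  mfderiv_id

theorem SmoothAt.prodMk {f : X → E₁} {g : X → E₂} {x : X} (hf : SmoothAt E E₁ f x)
    (hg : SmoothAt E E₂ g x) : SmoothAt E (E₁ × E₂) (fun y ↦ (f y, g y)) x :=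
  ContMDiffAt.prodMk_space hf hg

theorem tderiv_prodMk {f : X → E₁} {g : X → E₂} {x : X} (hf : SmoothAt E E₁ f x)
    (hg : SmoothAt E E₂ g x) :
    tderiv E (E₁ × E₂) (fun y ↦ (f y, g y)) x = (tderiv E E₁ f x).prod (tderiv E E₂ g x) := by
  have h1 := tderiv_comp (g := Prod.fst) (f := fun y ↦ (f y, g y))
    (smoothAt_iff_contDiffAt.2 (contDiffAt_fst (p := (f x, g x)))) (hf.prodMk hg)
  have h2 := tderiv_comp (g := Prod.snd) (f := fun y ↦ (f y, g y))
    (smoothAt_iff_contDiffAt.2 (contDiffAt_snd (p := (f x, g x)))) (hf.prodMk hg)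
  rw [tderiv_eq_fderiv, fderiv_fst] at h1
  rw [tderiv_eq_fderiv, fderiv_snd] at h2
  refine ContinuousLinearMap.ext fun v ↦ Prod.ext ?_ ?_
  · exact (DFunLike.congr_fun h1 v).symm
  · exact (DFunLike.congr_fun h2 v).symm

theorem hasFDerivAt_chart {f : X → Y} {x : X} (hf : SmoothAt E E₁ f x) :
    HasFDerivAt (fun z ↦ chartAt E₁ (f x) (f ((chartAt E x).symm z))) (tderiv E E₁ f x)
      (chartAt E x x) := by
  have h := hf.mdifferentiableAt.hasMFDerivAt.2
  simp only [mfld_simps] at h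
  exact hasFDerivWithinAt_univ.1 h

/-- The inverse function theorem at `a` yields smoothness of the inverse only at the image of `a`.
Shrinking to the open set `V` where `fderiv` is invertible lets the same argument run at every point
of the target. -/
theorem exists_openPartialHomeomorph_of_hasFDerivAt [CompleteSpace E] {f : E → E₁} {U : Set E}
    (hU : IsOpen U) (hf : ContDiffOn ℝ ∞ f U) {a : E} (ha : a ∈ U) (f' : E ≃L[ℝ] E₁)
    (h' : HasFDerivAt f (f' : E →L[ℝ] E₁) a) :
    ∃ e : OpenPartialHomeomorph E E₁, a ∈ e.source ∧ e.source ⊆ U ∧ (∀ x, e x = f x) ∧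
      ContDiffOn ℝ ∞ e.symm e.target := by
  have hfa : ContDiffAt ℝ ∞ f a := hf.contDiffAt (hU.mem_nhds ha)
  let e₀ := hfa.toOpenPartialHomeomorph f h' (by simp)
  let V : Set E := U ∩ fderiv ℝ f ⁻¹' range ((↑) : (E ≃L[ℝ] E₁) → E →L[ℝ] E₁)
  have hV : IsOpen V :=
    (hf.continuousOn_fderiv_of_isOpen hU (by simp)).isOpen_inter_preimage hU
      ContinuousLinearEquiv.isOpen
  have haV : a ∈ V := ⟨ha, f', h'.fderiv.symm⟩
  have hsource : (e₀.restrOpen V hV).source = e₀.source ∩ V := rfl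
  refine ⟨e₀.restrOpen V hV, ⟨?_, haV⟩, fun x hx ↦ hx.2.1, fun x ↦ rfl, ?_⟩
  · exact hfa.mem_toOpenPartialHomeomorph_source h' (by simp)
  · intro y hy
    have hx := (e₀.restrOpen V hV).map_target hy
    obtain ⟨hxU, e', he'⟩ := hx.2
    have hfx : ContDiffAt ℝ ∞ f ((e₀.restrOpen V hV).symm y) := hf.contDiffAt (hU.mem_nhds hxU)
    refine ((e₀.restrOpen V hV).contDiffAt_symm hy (f₀' := e') ?_ hfx).contDiffWithinAt
    rw [he']
    exact (hfx.differentiableAt (by simp)).hasFDerivAt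

/-- The inverse function theorem for manifolds without boundary. -/
theorem isLocalDiffeomorphAt_of_bijective [CompleteSpace E] [CompleteSpace E₁]
    [IsManifold 𝓘(ℝ, E) ∞ X] [IsManifold 𝓘(ℝ, E₁) ∞ Y] {f : X → Y} {x : X}
    (hf : ∀ᶠ y in 𝓝 x, SmoothAt E E₁ f y) (hb : Function.Bijective (tderiv E E₁ f x)) :
    IsLocalDiffeomorphAt 𝓘(ℝ, E) 𝓘(ℝ, E₁) ∞ f x := by
  have hfx := hf.self_of_nhds
  let φ := chartAt E x
  let ψ := chartAt E₁ (f x)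
  have hφ : φ ∈ IsManifold.maximalAtlas 𝓘(ℝ, E) ∞ X := IsManifold.chart_mem_maximalAtlas x
  have hψ : ψ ∈ IsManifold.maximalAtlas 𝓘(ℝ, E₁) ∞ Y := IsManifold.chart_mem_maximalAtlas (f x)
  -- On `V` the map is smooth and stays in the domain of `ψ`, so its chart expression `g` is smooth
  -- on the open set `U`. The required diffeomorphism is `φ`, then the local inverse-function
  -- homeomorphism of `g`, then `ψ.symm`.
  obtain ⟨V, hVsub, hVo, hxV⟩ := mem_nhds_iff.1 (hf.and
    (hfx.continuousAt (ψ.open_source.mem_nhds (mem_chart_source E₁ (f x)))))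
  let U : Set E := φ.target ∩ φ.symm ⁻¹' V
  have hU : IsOpen U := φ.symm.isOpen_inter_preimage hVo
  let g : E → E₁ := fun z ↦ ψ (f (φ.symm z))
  have hg : ContDiffOn ℝ ∞ g U := by
    intro z hz
    refine ContDiffAt.contDiffWithinAt (smoothAt_iff_contDiffAt.1 ?_)
    have h1 : SmoothAt E E φ.symm z := contMDiffAt_symm_of_mem_maximalAtlas hφ hz.1
    have h2 : SmoothAt E E₁ f (φ.symm z) := (hVsub hz.2).1
    have h3 : SmoothAt E₁ E₁ ψ (f (φ.symm z)) :=
      contMDiffAt_of_mem_maximalAtlas hψ (hVsub hz.2).2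
    exact h3.comp (f := fun z ↦ f (φ.symm z)) (h2.comp h1)
  let f' : E ≃L[ℝ] E₁ := ContinuousLinearEquiv.ofBijective (tderiv E E₁ f x)
    (LinearMap.ker_eq_bot.2 hb.1) (LinearMap.range_eq_top.2 hb.2)
  have hxU : φ x ∈ U := ⟨φ.map_source (mem_chart_source E x), by
    simpa [φ.left_inv (mem_chart_source E x)] using hxV⟩
  obtain ⟨e, hae, heU, heg, hes⟩ := exists_openPartialHomeomorph_of_hasFDerivAt hU hg hxU f'
    (hasFDerivAt_chart hfx)
  let Φ₁ : PartialDiffeomorph 𝓘(ℝ, E) 𝓘(ℝ, E) X E ∞ :=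
    { φ with
      contMDiffOn_toFun := contMDiffOn_of_mem_maximalAtlas hφ
      contMDiffOn_invFun := contMDiffOn_symm_of_mem_maximalAtlas hφ }
  let Φ₂ : PartialDiffeomorph 𝓘(ℝ, E) 𝓘(ℝ, E₁) E E₁ ∞ :=
    { e with
      contMDiffOn_toFun := ((hg.mono heU).congr fun z _ ↦ heg z).contMDiffOn
      contMDiffOn_invFun := hes.contMDiffOn }
  let Φ₃ : PartialDiffeomorph 𝓘(ℝ, E₁) 𝓘(ℝ, E₁) E₁ Y ∞ :=
    { ψ.symm with
      contMDiffOn_toFun := contMDiffOn_symm_of_mem_maximalAtlas hψ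
      contMDiffOn_invFun := contMDiffOn_of_mem_maximalAtlas hψ }
  refine ⟨(Φ₁.trans Φ₂).trans Φ₃, ⟨⟨mem_chart_source E x, hae⟩, ?_⟩, ?_⟩
  · change e (φ x) ∈ ψ.target
    rw [heg]
    refine ψ.map_source ?_
    rw [φ.left_inv (mem_chart_source E x)]
    exact mem_chart_source E₁ (f x)
  · rintro y ⟨⟨hy1, hy2⟩, hy3⟩
    change f y = ψ.symm (e (φ y))
    have hyV : φ.symm (φ y) ∈ V := (heU hy2).2
    rw [φ.left_inv hy1] at hyV
    replace hyV := hVsub hyV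
    rw [heg]
    change f y = ψ.symm (ψ (f (φ.symm (φ y))))
    rw [φ.left_inv hy1, ψ.left_inv hyV.2]

theorem smoothAt_of_mem_source {Φ : PartialDiffeomorph 𝓘(ℝ, E) 𝓘(ℝ, E₁) X Y ∞} {x : X}
    (hx : x ∈ Φ.source) : SmoothAt E E₁ Φ x :=
  Φ.contMDiffOn_toFun.contMDiffAt (Φ.open_source.mem_nhds hx)

theorem smoothAt_symm_of_mem_target {Φ : PartialDiffeomorph 𝓘(ℝ, E) 𝓘(ℝ, E₁) X Y ∞} {y : Y}
    (hy : y ∈ Φ.target) : SmoothAt E₁ E Φ.symm y :=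
  Φ.contMDiffOn_invFun.contMDiffAt (Φ.open_target.mem_nhds hy)

theorem tderiv_symm_comp {Φ : PartialDiffeomorph 𝓘(ℝ, E) 𝓘(ℝ, E₁) X Y ∞} {x : X}
    (hx : x ∈ Φ.source) :
    (tderiv E₁ E Φ.symm (Φ x)).comp (tderiv E E₁ Φ x) = ContinuousLinearMap.id ℝ E := by
  rw [← tderiv_comp (smoothAt_symm_of_mem_target (Φ.map_source hx)) (smoothAt_of_mem_source hx),
    ← tderiv_id (X := X) (x := x)]
  refine tderiv_congr ?_
  filter_upwards [Φ.open_source.mem_nhds hx] with y hy using Φ.left_inv hy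

theorem tderiv_comp_symm {Φ : PartialDiffeomorph 𝓘(ℝ, E) 𝓘(ℝ, E₁) X Y ∞} {y : Y}
    (hy : y ∈ Φ.target) :
    (tderiv E E₁ Φ (Φ.symm y)).comp (tderiv E₁ E Φ.symm y) = ContinuousLinearMap.id ℝ E₁ := by
  refine (tderiv_comp (smoothAt_of_mem_source (Φ.map_target hy))
    (smoothAt_symm_of_mem_target hy)).symm.trans ?_
  rw [← tderiv_id (X := Y) (x := y)]
  refine tderiv_congr ?_
  filter_upwards [Φ.open_target.mem_nhds hy] with y hy using Φ.right_inv hy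

theorem smoothAt_chartAt [IsManifold 𝓘(ℝ, E) ∞ X] {x y : X} (hy : y ∈ (chartAt E x).source) :
    SmoothAt E E (chartAt E x) y :=
  contMDiffAt_of_mem_maximalAtlas (IsManifold.chart_mem_maximalAtlas x) hy

theorem smoothAt_chartAt_symm [IsManifold 𝓘(ℝ, E) ∞ X] {x : X} {z : E}
    (hz : z ∈ (chartAt E x).target) : SmoothAt E E (chartAt E x).symm z :=
  contMDiffAt_symm_of_mem_maximalAtlas (IsManifold.chart_mem_maximalAtlas x) hz

/-- The tangent space at `x` is identified with the model space through the preferred chart at `x`.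
In that identification the derivative of the chart is the derivative of `chart ∘ chart.symm`, which
is locally the identity. -/
theorem tderiv_chartAt_self [IsManifold 𝓘(ℝ, E) ∞ X] (x : X) :
    tderiv E E (chartAt E x) x = ContinuousLinearMap.id ℝ E := by
  have h : HasFDerivAt (fun z ↦ chartAt E x ((chartAt E x).symm z)) _ _ :=
    hasFDerivAt_chart (smoothAt_chartAt (mem_chart_source E x))
  rw [← h.fderiv]
  have h2 : (fun z ↦ chartAt E x ((chartAt E x).symm z)) =ᶠ[𝓝 (chartAt E x x)] fun z ↦ z := by
    filter_upwards [(chartAt E x).open_target.mem_nhds (mem_chart_target E x)] with z hz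
    exact (chartAt E x).right_inv hz
  rw [h2.fderiv_eq]
  exact fderiv_id

theorem tderiv_chartAt_symm_self [IsManifold 𝓘(ℝ, E) ∞ X] (x : X) :
    tderiv E E (chartAt E x).symm (chartAt E x x) = ContinuousLinearMap.id ℝ E := by
  have h := tderiv_comp_of_eq (smoothAt_chartAt (mem_chart_source E x))
    (smoothAt_chartAt_symm (mem_chart_target E x)) ((chartAt E x).left_inv (mem_chart_source E x))
  rw [tderiv_chartAt_self, ContinuousLinearMap.id_comp] at h
  rw [← h, ← tderiv_id (X := E) (x := chartAt E x x)]
  refine tderiv_congr ?_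
  filter_upwards [(chartAt E x).open_target.mem_nhds (mem_chart_target E x)] with z hz
  exact (chartAt E x).right_inv hz

/-- Normal form of a submersion with values in a vector space. -/
theorem exists_partialDiffeomorph_of_surjective [FiniteDimensional ℝ E]
    [CompleteSpace E₁] [CompleteSpace E₂]
    [IsManifold 𝓘(ℝ, E) ∞ X] {f : X → E₁} {x : X}
    (hf : ∀ᶠ y in 𝓝 x, SmoothAt E E₁ f y) (P : E →L[ℝ] E₂)
    (hP : Function.Bijective ((tderiv E E₁ f x).prod P)) :
    ∃ Φ : PartialDiffeomorph 𝓘(ℝ, E) 𝓘(ℝ, E₁ × E₂) X (E₁ × E₂) ∞, x ∈ Φ.source ∧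
      (∀ y ∈ Φ.source, (Φ y).1 = f y) ∧ (Φ x).2 = 0 ∧
      tderiv E (E₁ × E₂) Φ x = (tderiv E E₁ f x).prod P := by
  -- `P` read in the chart at `x` supplies the coordinates missing from `f`; since the chart has
  -- identity derivative at `x`, the pair `(f, g)` has derivative `(df, P)` there.
  let g : X → E₂ := fun y ↦ P (chartAt E x y - chartAt E x x)
  have hPs : ∀ z, SmoothAt E E₂ (fun z ↦ P (z - chartAt E x x)) z := fun z ↦ by
    rw [smoothAt_iff_contDiffAt]; fun_prop
  have hgs : ∀ y ∈ (chartAt E x).source, SmoothAt E E₂ g y := fun y hy ↦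
    (hPs _).comp (smoothAt_chartAt hy)
  have hgd : tderiv E E₂ g x = P := by
    rw [tderiv_comp (hPs _) (smoothAt_chartAt (mem_chart_source E x)), tderiv_chartAt_self,
      tderiv_eq_fderiv]
    ext v
    simp [fderiv_sub_const]
  have hsm : ∀ᶠ y in 𝓝 x, SmoothAt E (E₁ × E₂) (fun y ↦ (f y, g y)) y := by
    filter_upwards [hf, (chartAt E x).open_source.mem_nhds (mem_chart_source E x)] with y h1 h2
    exact h1.prodMk (hgs y h2)
  have hd : tderiv E (E₁ × E₂) (fun y ↦ (f y, g y)) x = (tderiv E E₁ f x).prod P := by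
    rw [tderiv_prodMk hf.self_of_nhds (hgs x (mem_chart_source E x)), hgd]
  obtain ⟨Φ, hx, hΦ⟩ := isLocalDiffeomorphAt_of_bijective hsm (by rw [hd]; exact hP)
  refine ⟨Φ, hx, fun y hy ↦ by rw [← hΦ hy], by rw [← hΦ hx]; simp [g], ?_⟩
  rw [← hd]
  refine tderiv_congr ?_
  filter_upwards [Φ.open_source.mem_nhds hx] with y hy using (hΦ hy).symm

end Calculus

/-! ### Immersions and embeddings. -/

section Embedding

variable {E : Type*} [NormedAddCommGroup E] [NormedSpace ℝ E]
  {X : Type*} [TopologicalSpace X] [ChartedSpace E X]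
  {E₁ : Type*} [NormedAddCommGroup E₁] [NormedSpace ℝ E₁]
  {Y : Type*} [TopologicalSpace Y] [ChartedSpace E₁ Y]
  {K : Type*} [NormedAddCommGroup K] [NormedSpace ℝ K]
  {N : Type*} [TopologicalSpace N] [ChartedSpace K N]

theorem mem_maximalAtlas_of_partialDiffeomorph [IsManifold 𝓘(ℝ, E) ∞ X]
    (Φ : PartialDiffeomorph 𝓘(ℝ, E) 𝓘(ℝ, E) X E ∞) :
    Φ.toOpenPartialHomeomorph ∈ IsManifold.maximalAtlas 𝓘(ℝ, E) ∞ X :=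
  OpenPartialHomeomorph.mem_maximalAtlas_of_contMDiffOn _ Φ.contMDiffOn_toFun Φ.contMDiffOn_invFun

/-- A chart of the maximal atlas, as a partial diffeomorphism. -/
noncomputable def chartDiffeo [IsManifold 𝓘(ℝ, E) ∞ X] (e : OpenPartialHomeomorph X E)
    (he : e ∈ IsManifold.maximalAtlas 𝓘(ℝ, E) ∞ X) :
    PartialDiffeomorph 𝓘(ℝ, E) 𝓘(ℝ, E) X E ∞ :=
  { e with
    contMDiffOn_toFun := contMDiffOn_of_mem_maximalAtlas he
    contMDiffOn_invFun := contMDiffOn_symm_of_mem_maximalAtlas he }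

/-- In the charts of the immersion the map reads `z ↦ equiv (z, 0)`, whose derivative is injective.
-/
theorem tderiv_injective_of_isImmersionAt [IsManifold 𝓘(ℝ, E) ∞ X] [IsManifold 𝓘(ℝ, K) ∞ N]
    {i : N → X} {x : N} (hi : Manifold.IsImmersionAt 𝓘(ℝ, K) 𝓘(ℝ, E) ∞ i x) :
    Function.Injective (tderiv K E i x) := by
  let d := chartDiffeo hi.domChart hi.domChart_mem_maximalAtlas
  let e := chartDiffeo hi.codChart hi.codChart_mem_maximalAtlas
  have hxd : x ∈ d.source := hi.mem_domChart_source
  have hxe : i x ∈ e.source := hi.mem_codChart_source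
  have his : SmoothAt K E i x := hi.contMDiffAt
  have hds := smoothAt_symm_of_mem_target (d.map_source hxd)
  have hi2 : SmoothAt K E i (d.symm (d x)) := by rw [show d.symm (d x) = x from d.left_inv hxd]; exact his
  have hloc : (fun z ↦ e (i (d.symm z))) =ᶠ[𝓝 (d x)] fun z ↦ hi.equiv (z, 0) := by
    filter_upwards [d.open_target.mem_nhds (d.map_source hxd)] with z hz
    have hz' : z ∈ (hi.domChart.extend 𝓘(ℝ, K)).target := by simpa [mfld_simps] using! hz
    simpa [mfld_simps] using! hi.writtenInCharts hz'
  have h1 : tderiv K E (fun z ↦ e (i (d.symm z))) (d x)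
      = (tderiv E E e (i x)).comp ((tderiv K E i x).comp (tderiv K K d.symm (d x))) := by
    rw [tderiv_comp_of_eq (g := e) (f := fun z ↦ i (d.symm z)) (smoothAt_of_mem_source hxe)
      (hi2.comp hds) (by rw [show d.symm (d x) = x from d.left_inv hxd]),
      tderiv_comp_of_eq his hds (d.left_inv hxd)]
  rw [tderiv_congr hloc, tderiv_eq_fderiv] at h1
  have h2 : fderiv ℝ (fun z ↦ hi.equiv (z, (0 : hi.complement))) (d x)
      = (hi.equiv : K × hi.complement →L[ℝ] E).comp (ContinuousLinearMap.inl ℝ K hi.complement) :=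
    ((hi.equiv : K × hi.complement →L[ℝ] E).comp
      (ContinuousLinearMap.inl ℝ K hi.complement)).hasFDerivAt.fderiv
  rw [h2] at h1
  rw [injective_iff_map_eq_zero]
  intro v hv
  have h3 := DFunLike.congr_fun h1 (tderiv K K d x v)
  have h4 : tderiv K K d.symm (d x) (tderiv K K d x v) = v :=
    DFunLike.congr_fun (tderiv_symm_comp hxd) v
  simp only [ContinuousLinearMap.comp_apply, h4, hv, map_zero] at h3
  have h5 : tderiv K K d x v = 0 := by
    have : hi.equiv (tderiv K K d x v, 0) = 0 := h3
    rw [ContinuousLinearEquiv.map_eq_zero_iff] at this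
    exact congrArg Prod.fst this
  rw [← h4, h5, map_zero]

/-- The embedding topology supplies the continuity of `h` that the immersion criterion asks for.
Every map into the level set is shown to be smooth in this way, for any admissible smooth structure.
-/
theorem smoothAt_of_comp_embedding [IsManifold 𝓘(ℝ, E) ∞ X] [IsManifold 𝓘(ℝ, K) ∞ N]
    {i : N → X} (hi : Manifold.IsSmoothEmbedding 𝓘(ℝ, K) 𝓘(ℝ, E) ∞ i) {h : Y → N} {y : Y}
    (hs : SmoothAt E₁ E (fun y ↦ i (h y)) y) : SmoothAt E₁ K h y :=
  (ContMDiffAt.iff_comp_isImmersionAt (hi.isImmersion.isImmersionAt (h y))).2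
    ⟨hi.isEmbedding.isInducing.continuousAt_iff.2 hs.continuousAt, hs⟩

end Embedding

/-! ### Level sets of submersions: the regular value theorem and tangent spaces. -/

section LevelSets

variable {E : Type*} [NormedAddCommGroup E] [NormedSpace ℝ E]
  {M : Type*} [TopologicalSpace M] [ChartedSpace E M]
  {W : Type*} [NormedAddCommGroup W] [NormedSpace ℝ W]
  {K : Type*} [NormedAddCommGroup K] [NormedSpace ℝ K]
  {f : M → W} {c : W}

/-- `P` is the projection onto `ker A` along a complement. A vector killed by `A` is fixed by `P`,
so the pair is injective, and rank–nullity makes it bijective. -/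
theorem exists_bijective_prod_ker [FiniteDimensional ℝ E] [FiniteDimensional ℝ W]
    (A : E →L[ℝ] W) (hA : Function.Surjective A) :
    ∃ P : E →L[ℝ] LinearMap.ker (A : E →ₗ[ℝ] W),
      (∀ v : LinearMap.ker (A : E →ₗ[ℝ] W), P v = v) ∧ Function.Bijective (A.prod P) := by
  obtain ⟨C, hC⟩ := Submodule.exists_isCompl (LinearMap.ker (A : E →ₗ[ℝ] W))
  have hrank := LinearMap.finrank_range_add_finrank_ker (A : E →ₗ[ℝ] W)
  rw [LinearMap.range_eq_top.2 hA, finrank_top] at hrank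
  let P : E →ₗ[ℝ] LinearMap.ker (A : E →ₗ[ℝ] W) := Submodule.projectionOnto _ C hC
  refine ⟨LinearMap.toContinuousLinearMap P, Submodule.projectionOnto_apply_left hC, ?_⟩
  have hinj : Function.Injective (A.prod (LinearMap.toContinuousLinearMap P) :
      E →ₗ[ℝ] W × LinearMap.ker (A : E →ₗ[ℝ] W)) := by
    rw [injective_iff_map_eq_zero]
    intro v hv
    have h1 : A v = 0 := congrArg Prod.fst hv
    have h2 : P v = 0 := congrArg Prod.snd hv
    exact congrArg Subtype.val ((Submodule.projectionOnto_apply_left hC ⟨v, h1⟩).symm.trans h2)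
  exact ⟨hinj, (LinearMap.injective_iff_surjective_of_finrank_eq_finrank
    (by rw [← hrank, Module.finrank_prod])).1 hinj⟩

theorem exists_bijective_prod [FiniteDimensional ℝ E] [FiniteDimensional ℝ W]
    [FiniteDimensional ℝ K] (A : E →L[ℝ] W) (hA : Function.Surjective A)
    (hd : Module.finrank ℝ E = Module.finrank ℝ W + Module.finrank ℝ K) :
    ∃ P : E →L[ℝ] K, Function.Bijective (A.prod P) := by
  obtain ⟨P, -, hP⟩ := exists_bijective_prod_ker A hA
  have hrank := LinearMap.finrank_range_add_finrank_ker (A : E →ₗ[ℝ] W)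
  rw [LinearMap.range_eq_top.2 hA, finrank_top, hd] at hrank
  let e : LinearMap.ker (A : E →ₗ[ℝ] W) ≃L[ℝ] K :=
    (LinearEquiv.ofFinrankEq _ _ (by omega)).toContinuousLinearEquiv
  exact ⟨(e : LinearMap.ker (A : E →ₗ[ℝ] W) →L[ℝ] K).comp P,
    ((ContinuousLinearEquiv.refl ℝ W).prodCongr e).bijective.comp hP⟩

/-- The chart of a level set of `f` induced by a diffeomorphism with first component `f`. -/
noncomputable def levelChart (Φ : PartialDiffeomorph 𝓘(ℝ, E) 𝓘(ℝ, W × K) M (W × K) ∞)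
    (hΦ : ∀ y ∈ Φ.source, (Φ y).1 = f y) (x : {y : M // f y = c}) :
    OpenPartialHomeomorph {y : M // f y = c} K := by
  classical
  have hmem : ∀ z, (c, z) ∈ Φ.target → f (Φ.symm (c, z)) = c := fun z hz ↦ by
    refine (hΦ _ (Φ.map_target hz)).symm.trans ?_
    exact congrArg Prod.fst (Φ.right_inv hz)
  have hpair : ∀ y : {y : M // f y = c}, (y : M) ∈ Φ.source → (c, (Φ (y : M)).2) = Φ (y : M) :=
    fun y hy ↦ Prod.ext (by rw [hΦ _ hy, y.2]) rfl
  -- The value `x` is a filler outside the target, where the inverse is never consulted.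
  let inv : K → {y : M // f y = c} := fun z ↦
    if h : (c, z) ∈ Φ.target then ⟨Φ.symm (c, z), hmem z h⟩ else x
  have hinv : ∀ z, (c, z) ∈ Φ.target → ((inv z : {y : M // f y = c}) : M) = Φ.symm (c, z) :=
    fun z hz ↦ by simp [inv, hz]
  exact
  { toFun := fun y ↦ (Φ (y : M)).2
    invFun := inv
    source := Subtype.val ⁻¹' Φ.source
    target := (fun z ↦ (c, z)) ⁻¹' Φ.target
    map_source' := fun y hy ↦ by
      change (c, (Φ (y : M)).2) ∈ Φ.target
      rw [hpair y hy]
      exact Φ.map_source hy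
    map_target' := fun z hz ↦ by
      change ((inv z : {y : M // f y = c}) : M) ∈ Φ.source
      rw [hinv z hz]
      exact Φ.map_target hz
    left_inv' := fun y hy ↦ by
      refine Subtype.ext ?_
      rw [hinv _ (by rw [hpair y hy]; exact Φ.map_source hy), hpair y hy]
      exact Φ.left_inv hy
    right_inv' := fun z hz ↦ by
      rw [hinv z hz]
      exact congrArg Prod.snd (Φ.right_inv hz)
    open_source := Φ.open_source.preimage continuous_subtype_val
    open_target := Φ.open_target.preimage (by fun_prop)
    continuousOn_toFun := continuous_snd.comp_continuousOn
      (Φ.contMDiffOn_toFun.continuousOn.comp continuous_subtype_val.continuousOn fun y hy ↦ hy)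
    continuousOn_invFun := by
      refine (IsInducing.continuousOn_iff (g := Subtype.val) ⟨rfl⟩).2 ?_
      refine ContinuousOn.congr (f := fun z ↦ Φ.symm (c, z)) ?_ fun z hz ↦ hinv z hz
      exact Φ.contMDiffOn_invFun.continuousOn.comp (by fun_prop) fun z hz ↦ hz }

variable {Φ : PartialDiffeomorph 𝓘(ℝ, E) 𝓘(ℝ, W × K) M (W × K) ∞}
  {hΦ : ∀ y ∈ Φ.source, (Φ y).1 = f y} {x : {y : M // f y = c}}

theorem coe_levelChart_symm {z : K} (hz : (c, z) ∈ Φ.target) :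
    (((levelChart Φ hΦ x).symm z : {y : M // f y = c}) : M) = Φ.symm (c, z) := by
  classical
  change ((if h : (c, z) ∈ Φ.target then ⟨Φ.symm (c, z), _⟩ else x : {y : M // f y = c}) : M) = _
  rw [dif_pos hz]

theorem mem_levelChart_source {y : {y : M // f y = c}} :
    y ∈ (levelChart Φ hΦ x).source ↔ (y : M) ∈ Φ.source := Iff.rfl

theorem mem_levelChart_target {z : K} :
    z ∈ (levelChart Φ hΦ x).target ↔ (c, z) ∈ Φ.target := Iff.rfl

theorem smoothAt_coe_levelChart_symm {z : K} (hz : (c, z) ∈ Φ.target) :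
    SmoothAt K E (fun z ↦ (((levelChart Φ hΦ x).symm z : {y : M // f y = c}) : M)) z := by
  have h1 : SmoothAt K (W × K) (fun z : K ↦ (c, z)) z :=
    smoothAt_iff_contDiffAt.2 (by fun_prop)
  refine SmoothAt.congr ((smoothAt_symm_of_mem_target hz).comp h1) ?_
  filter_upwards [(levelChart Φ hΦ x).open_target.mem_nhds (mem_levelChart_target.2 hz)] with w hw
  exact coe_levelChart_symm hw

/-- The regular value theorem. -/
theorem exists_isSmoothEmbedding_levelSet [FiniteDimensional ℝ E] [FiniteDimensional ℝ W]
    [FiniteDimensional ℝ K] [IsManifold 𝓘(ℝ, E) ∞ M] (hf : ∀ y, SmoothAt E W f y)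
    (hreg : ∀ y, f y = c → Function.Surjective (tderiv E W f y))
    (hd : ∀ y, f y = c → Module.finrank ℝ E = Module.finrank ℝ W + Module.finrank ℝ K) :
    ∃ (_ : ChartedSpace K {y : M // f y = c}) (_ : IsManifold 𝓘(ℝ, K) ∞ {y : M // f y = c}),
      Manifold.IsSmoothEmbedding 𝓘(ℝ, K) 𝓘(ℝ, E) ∞ (Subtype.val : {y : M // f y = c} → M) := by
  have key : ∀ x : {y : M // f y = c},
      ∃ Φ : PartialDiffeomorph 𝓘(ℝ, E) 𝓘(ℝ, W × K) M (W × K) ∞, (x : M) ∈ Φ.source ∧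
        ∀ y ∈ Φ.source, (Φ y).1 = f y := by
    intro x
    obtain ⟨P, hP⟩ := exists_bijective_prod (K := K) _ (hreg x x.2) (hd x x.2)
    obtain ⟨Φ, h1, h2, -⟩ := exists_partialDiffeomorph_of_surjective
      (Eventually.of_forall hf) P hP
    exact ⟨Φ, h1, h2⟩
  choose Φ hxΦ hΦ using key
  let ch : ∀ x : {y : M // f y = c}, OpenPartialHomeomorph {y : M // f y = c} K :=
    fun x ↦ levelChart (Φ x) (hΦ x) x
  let cs : ChartedSpace K {y : M // f y = c} :=
    { atlas := range ch
      chartAt := ch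
      mem_chart_source := fun x ↦ mem_levelChart_source.2 (hxΦ x)
      chart_mem_atlas := fun x ↦ ⟨x, rfl⟩ }
  have hman : IsManifold 𝓘(ℝ, K) ∞ {y : M // f y = c} := by
    refine isManifold_of_contDiffOn _ _ _ ?_
    rintro _ _ ⟨x, rfl⟩ ⟨x', rfl⟩ z ⟨hz, -⟩
    have hz1 : (c, z) ∈ (Φ x).target := hz.1
    have hz2 : (((ch x).symm z : {y : M // f y = c}) : M) ∈ (Φ x').source := hz.2
    have h1 : SmoothAt E K (fun y ↦ ((Φ x') y).2) ((ch x).symm z : {y : M // f y = c}) :=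
      SmoothAt.comp (g := Prod.snd) (smoothAt_iff_contDiffAt.2 contDiffAt_snd)
        (smoothAt_of_mem_source hz2)
    have h2 : SmoothAt K K (fun z ↦ ((Φ x') ((ch x).symm z : {y : M // f y = c})).2) z :=
      h1.comp (f := fun z ↦ (((ch x).symm z : {y : M // f y = c}) : M))
        (smoothAt_coe_levelChart_symm hz1)
    exact (smoothAt_iff_contDiffAt.1 h2).contDiffWithinAt
  refine ⟨cs, hman, ⟨?_, IsEmbedding.subtypeVal⟩⟩
  refine Manifold.IsImmersionOfComplement.isImmersion (F := W) fun x ↦ ?_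
  let L : (K × W) ≃L[ℝ] E := (LinearEquiv.ofFinrankEq (K × W) E (by
    rw [Module.finrank_prod, hd x x.2, add_comm])).toContinuousLinearEquiv
  -- The immersion normal form wants the inclusion to read `z ↦ L (z, 0)` with values in `E`. `T`
  -- therefore moves the level `c` to `0`, swaps the two factors and identifies the product with
  -- `E`.
  let T : Diffeomorph 𝓘(ℝ, W × K) 𝓘(ℝ, E) (W × K) E ∞ :=
    { toFun := fun p ↦ L (p.2, p.1 - c)
      invFun := fun v ↦ ((L.symm v).2 + c, (L.symm v).1)
      left_inv := fun p ↦ by simp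
      right_inv := fun v ↦ by simp
      contMDiff_toFun := ContDiff.contMDiff (L.contDiff.comp (by fun_prop))
      contMDiff_invFun := ContDiff.contMDiff (f := fun v ↦ ((L.symm v).2 + c, (L.symm v).1))
        (by fun_prop) }
  refine Manifold.IsImmersionAtOfComplement.mk_of_charts L (ch x)
    ((Φ x).trans T.toPartialDiffeomorph).toOpenPartialHomeomorph
    (mem_chart_source K x) ⟨hxΦ x, trivial⟩ (IsManifold.chart_mem_maximalAtlas x)
    (mem_maximalAtlas_of_partialDiffeomorph _) (fun y hy ↦ ⟨hy, trivial⟩) ?_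
  intro z hz
  have hz' : (c, z) ∈ (Φ x).target := by simpa [mfld_simps] using! hz
  change L (((Φ x) ((ch x).symm z : {y : M // f y = c})).2,
    ((Φ x) ((ch x).symm z : {y : M // f y = c})).1 - c) = L (z, 0)
  rw [coe_levelChart_symm hz', show (Φ x) ((Φ x).symm (c, z)) = (c, z) from (Φ x).right_inv hz',
    sub_self]

/-- With `ker df` as second factor of the adapted chart `Φ`, the parametrization `z ↦ Φ.symm (c, z)`
of the level set is smooth into whichever smooth structure is given. Its derivative sends `P v` to
`dΦ⁻¹ (0, P v)`, which is `v` because `dΦ v = (0, P v)`. -/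
theorem exists_tderiv_subtypeVal_eq [FiniteDimensional ℝ E] [FiniteDimensional ℝ W]
    [IsManifold 𝓘(ℝ, E) ∞ M]
    [ChartedSpace K {y : M // f y = c}] [IsManifold 𝓘(ℝ, K) ∞ {y : M // f y = c}]
    (hi : Manifold.IsSmoothEmbedding 𝓘(ℝ, K) 𝓘(ℝ, E) ∞ (Subtype.val : {y : M // f y = c} → M))
    (hf : ∀ y, SmoothAt E W f y) (x : {y : M // f y = c})
    (hreg : Function.Surjective (tderiv E W f x)) (v : E) (hv : tderiv E W f x v = 0) :
    ∃ w : K, tderiv K E (Subtype.val : {y : M // f y = c} → M) x w = v := by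
  have hrank := LinearMap.finrank_range_add_finrank_ker (tderiv E W f x : E →ₗ[ℝ] W)
  rw [LinearMap.range_eq_top.2 hreg, finrank_top] at hrank
  obtain ⟨P, hP⟩ := exists_bijective_prod (K := LinearMap.ker (tderiv E W f x : E →ₗ[ℝ] W))
    _ hreg hrank.symm
  obtain ⟨Φ, hxΦ, hΦ, -, hdΦ⟩ := exists_partialDiffeomorph_of_surjective
    (Eventually.of_forall hf) P hP
  have hcx : (c, (Φ (x : M)).2) = Φ (x : M) := Prod.ext (by rw [hΦ _ hxΦ, x.2]) rfl
  have hmem : (c, (Φ (x : M)).2) ∈ Φ.target := by rw [hcx]; exact Φ.map_source hxΦ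
  have hs := smoothAt_coe_levelChart_symm (hΦ := hΦ) (x := x) hmem
  have hs' := smoothAt_of_comp_embedding hi (h := (levelChart Φ hΦ x).symm) hs
  have hxx : (levelChart Φ hΦ x).symm (Φ (x : M)).2 = x :=
    (levelChart Φ hΦ x).left_inv (mem_levelChart_source.2 hxΦ)
  have hval : SmoothAt K E (Subtype.val : {y : M // f y = c} → M) x := hi.contMDiff x
  have h1 := tderiv_comp_of_eq hval hs' hxx
  have h2 : (fun z ↦ (((levelChart Φ hΦ x).symm z : {y : M // f y = c}) : M))
      =ᶠ[𝓝 (Φ (x : M)).2] fun z ↦ Φ.symm (c, z) := by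
    filter_upwards [(levelChart Φ hΦ x).open_target.mem_nhds (mem_levelChart_target.2 hmem)]
      with w hw using coe_levelChart_symm hw
  have h3 : HasFDerivAt (fun z : LinearMap.ker (tderiv E W f x : E →ₗ[ℝ] W) ↦ (c, z))
      (ContinuousLinearMap.inr ℝ W _) (Φ (x : M)).2 := hasFDerivAt_prodMk_right c _
  rw [tderiv_congr h2, tderiv_comp_of_eq (g := Φ.symm)
    (f := fun z : LinearMap.ker (tderiv E W f x : E →ₗ[ℝ] W) ↦ (c, z))
    (smoothAt_symm_of_mem_target (Φ.map_source hxΦ))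
    (smoothAt_iff_contDiffAt.2 (by fun_prop)) hcx, tderiv_eq_fderiv, h3.fderiv] at h1
  have h4 := DFunLike.congr_fun (tderiv_symm_comp hxΦ) v
  refine ⟨_, (DFunLike.congr_fun h1 (P v)).symm.trans (Eq.trans ?_ h4)⟩
  change tderiv _ _ Φ.symm (Φ x) (0, P v) = tderiv _ _ Φ.symm (Φ x) (tderiv _ _ Φ (x : M) v)
  rw [hdΦ, ContinuousLinearMap.prod_apply, hv]

end LevelSets

/-! ### Fibres of maps whose rank is maximal at a given point. -/

section ConstantRank

variable {E : Type*} [NormedAddCommGroup E] [NormedSpace ℝ E]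
  {X : Type*} [TopologicalSpace X] [ChartedSpace E X]
  {W : Type*} [NormedAddCommGroup W] [NormedSpace ℝ W]
  {K : Type*} [NormedAddCommGroup K] [NormedSpace ℝ K]
  {S : Type*} [NormedAddCommGroup S] [NormedSpace ℝ S]

theorem exists_bijective_coprod [FiniteDimensional ℝ E] [FiniteDimensional ℝ S]
    [FiniteDimensional ℝ K] (B : E →L[ℝ] K) (hB : Function.Injective B)
    (hd : Module.finrank ℝ K = Module.finrank ℝ E + Module.finrank ℝ S) :
    ∃ C : S →L[ℝ] K, Function.Bijective (B.coprod C) := by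
  obtain ⟨D, hD⟩ := Submodule.exists_isCompl (LinearMap.range (B : E →ₗ[ℝ] K))
  have h1 := Submodule.finrank_add_eq_of_isCompl hD
  rw [LinearMap.finrank_range_of_inj hB] at h1
  let e : S ≃ₗ[ℝ] D := LinearEquiv.ofFinrankEq _ _ (by omega)
  let C : S →ₗ[ℝ] K := D.subtype ∘ₗ e.toLinearMap
  refine ⟨LinearMap.toContinuousLinearMap C, ?_⟩
  have hinj : Function.Injective (B.coprod (LinearMap.toContinuousLinearMap C) :
      E × S →ₗ[ℝ] K) := by
    rw [injective_iff_map_eq_zero]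
    rintro ⟨u, s⟩ hv
    have h2 : B u + (e s : K) = 0 := hv
    have h3 : (e s : K) ∈ LinearMap.range (B : E →ₗ[ℝ] K) ⊓ D :=
      ⟨⟨-u, by simpa using! (eq_neg_of_add_eq_zero_right h2).symm⟩, (e s).2⟩
    rw [hD.inf_eq_bot] at h3
    have h4 : (e s : K) = 0 := h3
    have h5 : s = 0 := by simpa using h4
    have h6 : u = 0 := hB (by rw [map_zero]; rwa [h4, add_zero] at h2)
    rw [h5, h6]; rfl
  exact ⟨hinj, (LinearMap.injective_iff_surjective_of_finrank_eq_finrank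
    (by rw [hd, Module.finrank_prod])).1 hinj⟩

variable (E W) in
/-- The kernel of the derivative. -/
noncomputable abbrev tker (θ : X → W) (x : X) : Submodule ℝ E :=
  LinearMap.ker (tderiv E W θ x : E →ₗ[ℝ] W)

/-- Fibres of maps of constant rank are submanifolds: local parametrization of the fibre. -/
theorem exists_fibre_parametrization [FiniteDimensional ℝ E] [FiniteDimensional ℝ W]
    [IsManifold 𝓘(ℝ, E) ∞ X] {θ : X → W} (hθ : ∀ y, SmoothAt E W θ y) (x : X)
    (hrank : ∀ y, Module.finrank ℝ (LinearMap.range (tderiv E W θ y : E →ₗ[ℝ] W))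
      ≤ Module.finrank ℝ (LinearMap.range (tderiv E W θ x : E →ₗ[ℝ] W))) :
    ∃ (α : tker E W θ x → X) (ε : ℝ), 0 < ε ∧
      (∀ u ∈ Metric.ball 0 ε, SmoothAt (tker E W θ x) E α u ∧ θ (α u) = θ x) ∧ α 0 = x ∧
      tderiv (tker E W θ x) E α 0 = (tker E W θ x).subtypeL ∧
      ∀ δ > 0, ∀ᶠ y in 𝓝 x, θ y = θ x → ∃ u ∈ Metric.ball 0 δ, α u = y := by
  let k₀ := tker E W θ x
  let R := LinearMap.range (tderiv E W θ x : E →ₗ[ℝ] W)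
  obtain ⟨C, hC⟩ := Submodule.exists_isCompl R
  -- Projecting to the range of `dθ` at `x` makes `f = π ∘ θ` a submersion at `x`. The fibre of `f`
  -- is parametrized by `α`, and the rank bound then shows that `θ` itself is constant along `α`.
  let π : W →L[ℝ] R := LinearMap.toContinuousLinearMap (Submodule.projectionOnto R C hC)
  have hπR : ∀ w : R, π w = w := Submodule.projectionOnto_apply_left hC
  have hπs : ∀ w, SmoothAt W R π w := fun w ↦ smoothAt_iff_contDiffAt.2 π.contDiff.contDiffAt
  let f : X → R := fun y ↦ π (θ y)
  have hf : ∀ y, SmoothAt E R f y := fun y ↦ (hπs _).comp (hθ y)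
  have hdf : ∀ y, tderiv E R f y = π.comp (tderiv E W θ y) := fun y ↦ by
    rw [tderiv_comp (hπs _) (hθ y), tderiv_eq_fderiv, π.fderiv]
  have hdfx : ∀ v, tderiv E R f x v = ⟨tderiv E W θ x v, v, rfl⟩ := fun v ↦ by
    rw [hdf]
    exact hπR ⟨tderiv E W θ x v, v, rfl⟩
  have hsurj : Function.Surjective (tderiv E R f x) := by
    rintro ⟨_, v, rfl⟩
    exact ⟨v, hdfx v⟩
  have hker : LinearMap.ker (tderiv E R f x : E →ₗ[ℝ] R) = k₀ := by
    ext v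
    change tderiv E R f x v = 0 ↔ tderiv E W θ x v = 0
    rw [hdfx]
    exact Subtype.ext_iff
  obtain ⟨P, hP, hbij⟩ : ∃ P : E →L[ℝ] k₀, (∀ v : k₀, P v = v) ∧
      Function.Bijective ((tderiv E R f x).prod P) := by
    rw [← hker]
    exact exists_bijective_prod_ker _ hsurj
  obtain ⟨Φ, hxΦ, hΦ, hΦx, hdΦ⟩ :=
    exists_partialDiffeomorph_of_surjective (Eventually.of_forall hf) P hbij
  have hpx : Φ x = (f x, 0) := Prod.ext (hΦ x hxΦ) hΦx
  have hmem : (f x, (0 : k₀)) ∈ Φ.target := hpx ▸ Φ.map_source hxΦ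
  have hcont : Continuous fun u : k₀ ↦ (f x, u) := by fun_prop
  obtain ⟨ε, hε, hεs⟩ := Metric.mem_nhds_iff.1
    (hcont.continuousAt.preimage_mem_nhds (Φ.open_target.mem_nhds hmem))
  let α : k₀ → X := fun u ↦ Φ.symm (f x, u)
  have hpairs : ∀ u : k₀, SmoothAt k₀ (R × k₀) (fun u ↦ (f x, u)) u := fun u ↦
    smoothAt_iff_contDiffAt.2 (by fun_prop)
  have hαs : ∀ u ∈ Metric.ball (0 : k₀) ε, SmoothAt k₀ E α u := fun u hu ↦
    SmoothAt.comp (g := Φ.symm) (smoothAt_symm_of_mem_target (hεs hu)) (hpairs u)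
  have hα0 : α 0 = x := by
    change Φ.symm (f x, 0) = x
    rw [← hpx]
    exact Φ.left_inv hxΦ
  have hfα : ∀ u ∈ Metric.ball (0 : k₀) ε, f (α u) = f x := fun u hu ↦ by
    refine (hΦ _ (Φ.map_target (hεs hu))).symm.trans ?_
    exact congrArg Prod.fst (Φ.right_inv (hεs hu))
  -- Near `x` the projection `π` maps the range of `dθ` onto `R`. By `hrank` that range is no larger
  -- than `R`, so `π` is injective on it, and `π ∘ dθ ∘ dα = 0` forces `dθ ∘ dα = 0`.
  have hdθα : ∀ u ∈ Metric.ball (0 : k₀) ε, fderiv ℝ (fun u ↦ θ (α u)) u = 0 := by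
    intro u hu
    have hαu : α u ∈ Φ.source := Φ.map_target (hεs hu)
    have h1 : (π.comp (tderiv E W θ (α u))).comp (tderiv k₀ E α u) = 0 := by
      rw [← hdf, ← tderiv_comp (hf _) (hαs u hu), ← tderiv_const (c := f x) (x := u)]
      refine tderiv_congr ?_
      filter_upwards [Metric.isOpen_ball.mem_nhds hu] with w hw using hfα w hw
    have h2 : Function.Surjective (tderiv E R f (α u)) := by
      have h3 : tderiv E R f (α u)
          = (ContinuousLinearMap.fst ℝ R k₀).comp (tderiv E (R × k₀) Φ (α u)) := by
        rw [← fderiv_fst (p := Φ (α u)), ← tderiv_eq_fderiv, ← tderiv_comp (g := Prod.fst)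
          (smoothAt_iff_contDiffAt.2 contDiffAt_fst) (smoothAt_of_mem_source hαu)]
        refine tderiv_congr ?_
        filter_upwards [Φ.open_source.mem_nhds hαu] with y hy using (hΦ y hy).symm
      intro w
      have h4 := DFunLike.congr_fun (tderiv_comp_symm (hεs hu)) (w, 0)
      exact ⟨_, (DFunLike.congr_fun h3 _).trans (congrArg Prod.fst h4)⟩
    let Ru := LinearMap.range (tderiv E W θ (α u) : E →ₗ[ℝ] W)
    let πu : Ru →ₗ[ℝ] R := (π : W →ₗ[ℝ] R) ∘ₗ Ru.subtype
    have hπu : Function.Surjective πu := fun w ↦ by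
      obtain ⟨v, hv⟩ := h2 w
      rw [hdf] at hv
      exact ⟨⟨_, v, rfl⟩, hv⟩
    have hinj : Function.Injective πu :=
      (LinearMap.injective_iff_surjective_of_finrank_eq_finrank
        (le_antisymm (hrank (α u)) (LinearMap.finrank_le_finrank_of_surjective hπu))).2 hπu
    rw [← tderiv_eq_fderiv, tderiv_comp (hθ _) (hαs u hu)]
    ext v
    have h5 : πu ⟨tderiv E W θ (α u) (tderiv k₀ E α u v), _, rfl⟩ = πu 0 := by
      rw [map_zero]
      exact DFunLike.congr_fun h1 v
    exact congrArg Subtype.val (hinj h5)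
  have hθα : ∀ u ∈ Metric.ball (0 : k₀) ε, θ (α u) = θ x := by
    intro u hu
    have h0 : (0 : k₀) ∈ Metric.ball (0 : k₀) ε := Metric.mem_ball_self hε
    rw [← hα0]
    refine Metric.isOpen_ball.is_const_of_fderiv_eq_zero (𝕜 := ℝ) (f := fun u ↦ θ (α u))
      (convex_ball (0 : k₀) ε).isPreconnected (fun u hu ↦ ?_) (fun u hu ↦ hdθα u hu) hu h0
    exact ((smoothAt_iff_contDiffAt.1 ((hθ _).comp (hαs u hu))).differentiableAt
      (by simp)).differentiableWithinAt
  refine ⟨α, ε, hε, fun u hu ↦ ⟨hαs u hu, hθα u hu⟩, hα0, ?_, ?_⟩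
  · ext v
    have h1 : HasFDerivAt (fun u : k₀ ↦ (f x, u)) (ContinuousLinearMap.inr ℝ R k₀) 0 :=
      hasFDerivAt_prodMk_right _ _
    have h2 : tderiv k₀ E α 0
        = (tderiv (R × k₀) E Φ.symm (Φ x)).comp (ContinuousLinearMap.inr ℝ R k₀) := by
      rw [← h1.fderiv, ← tderiv_eq_fderiv]
      exact tderiv_comp_of_eq (E := k₀) (g := Φ.symm) (f := fun u : k₀ ↦ (f x, u))
        (smoothAt_symm_of_mem_target (Φ.map_source hxΦ)) (hpairs 0) hpx.symm
    have h3 := DFunLike.congr_fun (tderiv_symm_comp hxΦ) (v : E)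
    rw [h2]
    refine Eq.trans ?_ h3
    change tderiv (R × k₀) E Φ.symm (Φ x) (0, v)
      = tderiv (R × k₀) E Φ.symm (Φ x) (tderiv E (R × k₀) Φ x v)
    rw [hdΦ, ContinuousLinearMap.prod_apply, hP]
    congr 2
    exact (LinearMap.mem_ker.1 (hker ▸ v.2 : (v : E) ∈ LinearMap.ker _)).symm
  · intro δ hδ
    have hc : ContinuousAt (fun y ↦ (Φ y).2) x :=
      continuousAt_snd.comp (smoothAt_of_mem_source hxΦ).continuousAt
    filter_upwards [Φ.open_source.mem_nhds hxΦ,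
      hc.preimage_mem_nhds (Metric.isOpen_ball.mem_nhds
        (by rw [hΦx]; exact Metric.mem_ball_self hδ : (Φ x).2 ∈ Metric.ball (0 : k₀) δ))]
      with y hy1 hy2 hy3
    refine ⟨(Φ y).2, hy2, ?_⟩
    have h1 : (f x, (Φ y).2) = Φ y := Prod.ext (by rw [hΦ y hy1]; simp only [f, hy3]) rfl
    change Φ.symm (f x, (Φ y).2) = y
    rw [h1]
    exact Φ.left_inv hy1

end ConstantRank

/-! ### Pointwise bilinear forms, and infinitesimal properties of the action, the coadjoint orbit
map and the momentum map. -/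

section Form

variable {E : Type*} [NormedAddCommGroup E] [NormedSpace ℝ E]
  {M : Type*} [TopologicalSpace M] [ChartedSpace E M]

/-- The value of a field of bilinear forms at a point, as a form on the model space. -/
def form (σ : BilinField 𝓘(ℝ, E) M) (x : M) : E →L[ℝ] E →L[ℝ] ℝ := σ x

end Form

section GroupAction

variable {F : Type*} [NormedAddCommGroup F] [NormedSpace ℝ F]
  {G : Type*} [TopologicalSpace G] [ChartedSpace F G] [Group G]
  {E₁ : Type*} [NormedAddCommGroup E₁] [NormedSpace ℝ E₁]
  {Y : Type*} [TopologicalSpace Y] [ChartedSpace E₁ Y]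

theorem SmoothAt.mul [LieGroup 𝓘(ℝ, F) ∞ G] {a b : Y → G} {y : Y} (ha : SmoothAt E₁ F a y)
    (hb : SmoothAt E₁ F b y) : SmoothAt E₁ F (fun y ↦ a y * b y) y :=
  ContMDiffAt.mul ha hb

variable {E : Type*} [NormedAddCommGroup E] [NormedSpace ℝ E]
  {M : Type*} [TopologicalSpace M] [ChartedSpace E M]
  [MulAction G M]

theorem infGen_eq_tderiv (ξ : F) (x : M) :
    infGen G E M ξ x = tderiv F E (fun g : G ↦ g • x) 1 ξ := rfl

theorem SmoothAt.smul [ContMDiffSMul 𝓘(ℝ, F) 𝓘(ℝ, E) ∞ G M] {a : Y → G} {b : Y → M} {y : Y}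
    (ha : SmoothAt E₁ F a y) (hb : SmoothAt E₁ E b y) :
    SmoothAt E₁ E (fun y ↦ a y • b y) y :=
  ContMDiffAt.smul ha hb

variable [ContMDiffSMul 𝓘(ℝ, F) 𝓘(ℝ, E) ∞ G M] [LieGroup 𝓘(ℝ, F) ∞ G]
  {σ : BilinField 𝓘(ℝ, E) M} {J : M → DualLieAlg F} {c : DualLieAlg F}

/-- Differentiate `coAd (g * h) c = coAd g (coAd h c)` in `h` at `1`; `coAd g` is linear, namely
precomposition with `Ad g⁻¹`. -/
theorem coAd_comp_tderiv (g : G) (hθ : ∀ g : G, SmoothAt F (DualLieAlg F) (fun g : G ↦ coAd g c) g) :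
    (tderiv F (DualLieAlg F) (fun g : G ↦ coAd g c) g).comp (tderiv F F (fun h : G ↦ g * h) 1)
      = (ContinuousLinearMap.precomp ℝ (Ad F g⁻¹)).comp
        (tderiv F (DualLieAlg F) (fun g : G ↦ coAd g c) 1) := by
  have hL : SmoothAt F F (fun h : G ↦ g * h) 1 := smoothAt_const.mul smoothAt_id
  rw [← tderiv_comp_of_eq (hθ g) hL (mul_one g), ← ContinuousLinearMap.fderiv
    (ContinuousLinearMap.precomp ℝ (Ad F g⁻¹)) (x := coAd (1 : G) c), ← tderiv_eq_fderiv,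
    ← tderiv_comp (smoothAt_iff_contDiffAt.2 (ContinuousLinearMap.contDiff _).contDiffAt) (hθ 1)]
  congr 1
  funext h
  exact coAd_mul g h c

theorem tderiv_mul_left_surjective (g : G) :
    Function.Surjective (tderiv F F (fun h : G ↦ g * h) 1) := by
  have h1 : SmoothAt F F (fun h : G ↦ g * h) 1 := smoothAt_const.mul smoothAt_id
  have h2 : SmoothAt F F (fun h : G ↦ g⁻¹ * h) g := smoothAt_const.mul smoothAt_id
  have h1' : SmoothAt F F (fun h : G ↦ g * h) (g⁻¹ * g) := smoothAt_const.mul smoothAt_id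
  have h3 := tderiv_comp h1' h2
  simp only [mul_inv_cancel_left] at h3
  rw [tderiv_id] at h3
  intro v
  have h4 := DFunLike.congr_fun h3 v
  refine ⟨tderiv F F (fun h : G ↦ g⁻¹ * h) g v, ?_⟩
  have h5 : ∀ k : G, k = 1 → tderiv F F (fun h : G ↦ g * h) k
      = tderiv F F (fun h : G ↦ g * h) 1 := by rintro k rfl; rfl
  rw [← h5 (g⁻¹ * g) (inv_mul_cancel g)]
  exact h4.symm

/-- The coadjoint orbit map has its largest rank at `1`, since left translation expresses its
derivative at `g` through the one at `1`. This allows `exists_fibre_parametrization` to parametrize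
the isotropy group near `1`. -/
theorem finrank_range_tderiv_coAd_le [FiniteDimensional ℝ F] (g : G)
    (hθ : ∀ g : G, SmoothAt F (DualLieAlg F) (fun g : G ↦ coAd g c) g) :
    Module.finrank ℝ (LinearMap.range
      (tderiv F (DualLieAlg F) (fun g : G ↦ coAd g c) g : F →ₗ[ℝ] DualLieAlg F))
    ≤ Module.finrank ℝ (LinearMap.range
      (tderiv F (DualLieAlg F) (fun g : G ↦ coAd g c) 1 : F →ₗ[ℝ] DualLieAlg F)) := by
  have h : LinearMap.range (tderiv F (DualLieAlg F) (fun g : G ↦ coAd g c) g : F →ₗ[ℝ] _)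
      ≤ (LinearMap.range (tderiv F (DualLieAlg F) (fun g : G ↦ coAd g c) 1 : F →ₗ[ℝ] _)).map
        ((ContinuousLinearMap.precomp ℝ (Ad F g⁻¹) : DualLieAlg F →L[ℝ] DualLieAlg F) :
          DualLieAlg F →ₗ[ℝ] DualLieAlg F) := by
    rintro _ ⟨v, rfl⟩
    obtain ⟨w, rfl⟩ := tderiv_mul_left_surjective g v
    exact ⟨_, ⟨w, rfl⟩, (DFunLike.congr_fun (coAd_comp_tderiv g hθ) w).symm⟩
  exact (Submodule.finrank_mono h).trans (Submodule.finrank_map_le _ _)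

variable (F G c) in
/-- The Lie algebra of the isotropy subgroup of `c`. -/
noncomputable abbrev isotropyAlg : Submodule ℝ F :=
  tker F (DualLieAlg F) (fun g : G ↦ coAd g c) 1

theorem smoothAt_orbit (x : M) (g : G) : SmoothAt F E (fun g : G ↦ g • x) g :=
  SmoothAt.smul smoothAt_id smoothAt_const

/-- Equivariance turns `coAd g (J x)` into `J (g • x)`, so smoothness follows from that of `J` and
of the action. -/
theorem smoothAt_coAd (hs : ∀ x, SmoothAt E (DualLieAlg F) J x) (hJ : IsEquivariant G J) {x : M}
    (hx : J x = c) (g : G) : SmoothAt F (DualLieAlg F) (fun g : G ↦ coAd g c) g := by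
  subst hx
  simp_rw [← hJ _ x]
  exact (hs _).comp (smoothAt_orbit x g)

/-- Differentiate `J (g • x) = coAd g c` at `g = 1`. -/
theorem mem_isotropyAlg_iff (hs : ∀ x, SmoothAt E (DualLieAlg F) J x) (hJ : IsEquivariant G J)
    {x : M} (hx : J x = c) (ξ : F) :
    ξ ∈ isotropyAlg F G c ↔ tderiv E (DualLieAlg F) J x (infGen G E M ξ x) = 0 := by
  subst hx
  have h := tderiv_comp_of_eq (hs x) (smoothAt_orbit (F := F) (G := G) x 1) (one_smul G x)
  simp_rw [hJ _ x] at h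
  rw [LinearMap.mem_ker, infGen_eq_tderiv]
  exact iff_of_eq (congrArg (· = 0) (DFunLike.congr_fun h ξ))

theorem tderiv_momentumMap_apply (hs : ∀ x, SmoothAt E (DualLieAlg F) J x)
    (hmom : IsMomentumMap G σ J) (x : M) (v : E) (ξ : F) :
    tderiv E (DualLieAlg F) J x v ξ = -form σ x (infGen G E M ξ x) v := by
  have h1 : SmoothAt (DualLieAlg F) ℝ (fun ℓ : DualLieAlg F ↦ ℓ ξ) (J x) :=
    smoothAt_iff_contDiffAt.2 (ContinuousLinearMap.apply ℝ ℝ ξ).contDiff.contDiffAt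
  have h2 := tderiv_comp h1 (hs x)
  rw [tderiv_eq_fderiv, show (fun ℓ : DualLieAlg F ↦ ℓ ξ) = ContinuousLinearMap.apply ℝ ℝ ξ from rfl,
    ContinuousLinearMap.fderiv] at h2
  have h3 : form σ x (infGen G E M ξ x) v = -_ := hmom.hamiltonian ξ x v
  rw [h3, neg_neg]
  exact (DFunLike.congr_fun h2 v).symm

/-- At a regular point the action is infinitesimally free: if `Y_ξ` vanishes at `x`, then every
covector in the range of `dJ` kills `ξ`. By surjectivity these are all covectors, and a norming
functional gives `ξ = 0`. -/
theorem infGen_injective (hs : ∀ x, SmoothAt E (DualLieAlg F) J x) (hmom : IsMomentumMap G σ J)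
    {x : M} (hreg : Function.Surjective (tderiv E (DualLieAlg F) J x)) :
    Function.Injective (tderiv F E (fun g : G ↦ g • x) 1) := by
  rw [injective_iff_map_eq_zero]
  intro ξ hξ
  by_contra hne
  obtain ⟨ℓ, -, hℓ⟩ := exists_dual_vector ℝ ξ (norm_ne_zero_iff.2 hne)
  obtain ⟨v, rfl⟩ := hreg ℓ
  rw [tderiv_momentumMap_apply hs hmom, infGen_eq_tderiv, hξ, map_zero,
    zero_apply] at hℓ
  have : ‖ξ‖ = 0 := by simpa using hℓ.symm
  exact hne (norm_eq_zero.1 this)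

end GroupAction

/-! ### Slices for the isotropy action on the level set. -/

section Slices

theorem smoothAt_const_smul (F : Type*) [NormedAddCommGroup F] [NormedSpace ℝ F]
    {G : Type*} [TopologicalSpace G] [ChartedSpace F G] [Group G]
    {E : Type*} [NormedAddCommGroup E] [NormedSpace ℝ E]
    {M : Type*} [TopologicalSpace M] [ChartedSpace E M] [MulAction G M]
    [ContMDiffSMul 𝓘(ℝ, F) 𝓘(ℝ, E) ∞ G M] (g : G) (x : M) :
    SmoothAt E E (fun x : M ↦ g • x) x :=
  SmoothAt.smul (F := F) (smoothAt_const (c := g)) smoothAt_id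

variable {F : Type*} [NormedAddCommGroup F] [NormedSpace ℝ F]
  {G : Type*} [TopologicalSpace G] [ChartedSpace F G] [Group G] [LieGroup 𝓘(ℝ, F) ∞ G]
  {E : Type*} [NormedAddCommGroup E] [NormedSpace ℝ E]
  {M : Type*} [TopologicalSpace M] [ChartedSpace E M] [MulAction G M]
  {J : M → DualLieAlg F} {c : DualLieAlg F} {hJ : IsEquivariant G J}

theorem redProj_eq_iff {y z : LevelSet J c} :
    redProj hJ c y = redProj hJ c z ↔ ∃ g : G, coAd g c = c ∧ g • (z : M) = y := by
  let _ := levelAction hJ c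
  change (Quotient.mk _ y = Quotient.mk _ z) ↔ _
  rw [Quotient.eq]
  change MulAction.orbitRel (isotropy G c) (LevelSet J c) y z ↔ _
  rw [MulAction.orbitRel_apply]
  constructor
  · rintro ⟨g, hg⟩
    exact ⟨g, g.2, congrArg Subtype.val hg⟩
  · rintro ⟨g, hg, hgz⟩
    exact ⟨⟨g, hg⟩, Subtype.ext hgz⟩

/-- Properness makes the map `(g, y) ↦ (g • y, y)` closed, so the image of the pairs with `g`
outside the interior of `O` is closed. Freeness keeps `(x, x)` out of that image, and hence a whole
neighbourhood of it. -/
theorem exists_nhds_smul_mem (hfree : ActsFreely hJ c) (hproper : ActsProperly hJ c)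
    (x : LevelSet J c) {O : Set G} (hO : O ∈ 𝓝 (1 : G)) :
    ∃ V ∈ 𝓝 x, ∀ y ∈ V, ∀ z ∈ V, ∀ g : G, coAd g c = c → g • (z : M) = y → g ∈ O := by
  let _ := levelAction hJ c
  have : ProperSMul (isotropy G c) (LevelSet J c) := hproper
  have hcl := (ProperSMul.isProperMap_smul_pair (G := isotropy G c)
    (X := LevelSet J c)).isClosedMap
  let C : Set (isotropy G c × LevelSet J c) := (fun p ↦ (p.1 : G)) ⁻¹' (interior O)ᶜ
  have hC : IsClosed C := isOpen_interior.isClosed_compl.preimage (by fun_prop)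
  have hx : (x, x) ∉ (fun gx : isotropy G c × LevelSet J c ↦ (gx.1 • gx.2, gx.2)) '' C := by
    rintro ⟨⟨g, y⟩, hg, hgy⟩
    have h1 : y = x := congrArg Prod.snd hgy
    subst h1
    have h2 : g = 1 := hfree g y (congrArg Prod.fst hgy)
    subst h2
    exact hg (mem_interior_iff_mem_nhds.2 hO)
  obtain ⟨V, hV, V', hV', hVV⟩ := mem_nhds_prod_iff.1 ((hcl C hC).isOpen_compl.mem_nhds hx)
  refine ⟨V ∩ V', inter_mem hV hV', fun y hy z hz g hg hgz ↦ ?_⟩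
  by_contra hgO
  refine hVV (mk_mem_prod hy.1 hz.2) ⟨(⟨g, hg⟩, z), fun h ↦ hgO (interior_subset h), ?_⟩
  exact Prod.ext (Subtype.ext hgz) rfl

end Slices

section Restriction

variable {E : Type*} [NormedAddCommGroup E] [NormedSpace ℝ E]
  {X : Type*} [TopologicalSpace X] [ChartedSpace E X]
  {E₁ : Type*} [NormedAddCommGroup E₁] [NormedSpace ℝ E₁]
  {Y : Type*} [TopologicalSpace Y] [ChartedSpace E₁ Y]

/-- The restriction of a partial diffeomorphism to an open subset of its source. -/
noncomputable def restrDiffeo (Φ : PartialDiffeomorph 𝓘(ℝ, E) 𝓘(ℝ, E₁) X Y ∞) (s : Set X)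
    (hs : IsOpen s) (hsub : s ⊆ Φ.source) : PartialDiffeomorph 𝓘(ℝ, E) 𝓘(ℝ, E₁) X Y ∞ where
  toFun := Φ
  invFun := Φ.symm
  source := s
  target := Φ.target ∩ Φ.symm ⁻¹' s
  map_source' := fun x hx ↦ ⟨Φ.map_source (hsub hx), by
    change Φ.symm (Φ x) ∈ s
    rwa [show Φ.symm (Φ x) = x from Φ.left_inv (hsub hx)]⟩
  map_target' := fun y hy ↦ hy.2
  left_inv' := fun x hx ↦ Φ.left_inv (hsub hx)
  right_inv' := fun y hy ↦ Φ.right_inv hy.1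
  open_source := hs
  open_target := Φ.contMDiffOn_invFun.continuousOn.isOpen_inter_preimage Φ.open_target hs
  contMDiffOn_toFun := Φ.contMDiffOn_toFun.mono hsub
  contMDiffOn_invFun := Φ.contMDiffOn_invFun.mono inter_subset_left

end Restriction

section SliceTheorem

variable {F : Type*} [NormedAddCommGroup F] [NormedSpace ℝ F] [FiniteDimensional ℝ F]
  {G : Type*} [TopologicalSpace G] [ChartedSpace F G] [Group G] [LieGroup 𝓘(ℝ, F) ∞ G]
  {E : Type*} [NormedAddCommGroup E] [NormedSpace ℝ E] [FiniteDimensional ℝ E]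
  {M : Type*} [TopologicalSpace M] [ChartedSpace E M] [IsManifold 𝓘(ℝ, E) ∞ M]
  [MulAction G M] [ContMDiffSMul 𝓘(ℝ, F) 𝓘(ℝ, E) ∞ G M]
  {σ : BilinField 𝓘(ℝ, E) M} {J : M → DualLieAlg F} {c : DualLieAlg F}
  {hJ : IsEquivariant G J}
  {K : Type*} [NormedAddCommGroup K] [NormedSpace ℝ K] [FiniteDimensional ℝ K]
  [ChartedSpace K (LevelSet J c)] [IsManifold 𝓘(ℝ, K) ∞ (LevelSet J c)]
  {S : Type*} [NormedAddCommGroup S] [NormedSpace ℝ S] [FiniteDimensional ℝ S]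

/-- `B` is the infinitesimal action of the isotropy algebra on the level set. Its generators lie in
`ker dJ` and so are tangent to the level set; lifting them by one fixed left inverse of the
injective derivative of the inclusion keeps `B` linear. -/
theorem exists_tderiv_levelIncl_eq_infGen
    (hi : Manifold.IsSmoothEmbedding 𝓘(ℝ, K) 𝓘(ℝ, E) ∞ (levelIncl J c))
    (hmom : IsMomentumMap G σ J) (hJ : IsEquivariant G J) (hreg : IsRegularValue E J c)
    (x : LevelSet J c) :
    ∃ B : isotropyAlg F G c →L[ℝ] K, Function.Injective B ∧
      ∀ ξ, tderiv K E (levelIncl J c) x (B ξ) = infGen G E M (ξ : F) (x : M) := by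
  have hs : ∀ x, SmoothAt E (DualLieAlg F) J x := hmom.smooth
  have hinj := tderiv_injective_of_isImmersionAt (hi.isImmersion.isImmersionAt x)
  obtain ⟨L, hL⟩ := LinearMap.exists_leftInverse_of_injective
    (tderiv K E (levelIncl J c) x : K →ₗ[ℝ] E) (LinearMap.ker_eq_bot.2 hinj)
  have hL' : ∀ w, L (tderiv K E (levelIncl J c) x w) = w := fun w ↦ LinearMap.congr_fun hL w
  let B : isotropyAlg F G c →L[ℝ] K := LinearMap.toContinuousLinearMap
    (L ∘ₗ (tderiv F E (fun g : G ↦ g • (x : M)) 1 : F →ₗ[ℝ] E) ∘ₗ (isotropyAlg F G c).subtype)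
  have hB : ∀ ξ, tderiv K E (levelIncl J c) x (B ξ) = infGen G E M (ξ : F) (x : M) := fun ξ ↦ by
    obtain ⟨w, hw⟩ := exists_tderiv_subtypeVal_eq hi hs x (hreg x x.2) _
      ((mem_isotropyAlg_iff hs hJ x.2 (ξ : F)).1 ξ.2)
    have h1 : B ξ = w := by
      refine Eq.trans ?_ (hL' w)
      exact congrArg L hw.symm
    rw [h1]
    exact hw
  refine ⟨B, ?_, hB⟩
  rw [injective_iff_map_eq_zero]
  intro ξ hξ
  have h1 := hB ξ
  rw [hξ, map_zero] at h1
  exact Subtype.ext (infGen_injective hs hmom (hreg x x.2) (h1.symm.trans (map_zero _).symm))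

theorem finrank_isotropyAlg_le
    (hi : Manifold.IsSmoothEmbedding 𝓘(ℝ, K) 𝓘(ℝ, E) ∞ (levelIncl J c))
    (hmom : IsMomentumMap G σ J) (hJ : IsEquivariant G J) (hreg : IsRegularValue E J c)
    (x : LevelSet J c) :
    Module.finrank ℝ (isotropyAlg F G c) ≤ Module.finrank ℝ K := by
  obtain ⟨B, hB, -⟩ := exists_tderiv_levelIncl_eq_infGen hi hmom hJ hreg x
  exact LinearMap.finrank_le_finrank_of_injective (f := (B : isotropyAlg F G c →ₗ[ℝ] K)) hB

/-- A slice for the action of the isotropy group on the level set. -/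
theorem exists_slice
    (hi : Manifold.IsSmoothEmbedding 𝓘(ℝ, K) 𝓘(ℝ, E) ∞ (levelIncl J c))
    (hmom : IsMomentumMap G σ J) (hreg : IsRegularValue E J c)
    (hfree : ActsFreely hJ c) (hproper : ActsProperly hJ c)
    (hdim : Module.finrank ℝ K = Module.finrank ℝ (isotropyAlg F G c) + Module.finrank ℝ S)
    (x : LevelSet J c) :
    ∃ (Θ : PartialDiffeomorph 𝓘(ℝ, isotropyAlg F G c × S) 𝓘(ℝ, K)
        (isotropyAlg F G c × S) (LevelSet J c) ∞) (ε : ℝ), 0 < ε ∧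
      Θ.source = Metric.ball 0 ε ∧ Θ 0 = x ∧
      (∀ p ∈ Θ.source, ∀ q ∈ Θ.source,
        redProj hJ c (Θ p) = redProj hJ c (Θ q) ↔ p.2 = q.2) ∧
      ∀ ξ : isotropyAlg F G c,
        tderiv K E (levelIncl J c) x (tderiv (isotropyAlg F G c × S) K Θ 0 (ξ, 0))
          = infGen G E M (ξ : F) (x : M) := by
  classical
  let A₀ := isotropyAlg F G c
  have hs : ∀ x, SmoothAt E (DualLieAlg F) J x := hmom.smooth
  have hθ : ∀ g : G, SmoothAt F (DualLieAlg F) (fun g : G ↦ coAd g c) g :=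
    smoothAt_coAd hs hJ x.2
  have his : ∀ y, SmoothAt K E (levelIncl J c) y := hi.contMDiff
  obtain ⟨B, hBinj, hB⟩ := exists_tderiv_levelIncl_eq_infGen hi hmom hJ hreg x
  obtain ⟨C, hC⟩ := exists_bijective_coprod (S := S) B hBinj hdim
  obtain ⟨α, ε, hε, hα, hα1, hdα, hcover⟩ := exists_fibre_parametrization hθ 1
    fun g ↦ finrank_range_tderiv_coAd_le g hθ
  have hαc : ∀ u ∈ Metric.ball (0 : A₀) ε, coAd (α u) c = c := fun u hu ↦
    ((hα u hu).2).trans (coAd_one c)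
  -- the transversal
  let φ := chartAt K x
  have hx0 : φ x + C 0 = φ x := by rw [map_zero, add_zero]
  let β : S → LevelSet J c := fun s ↦ φ.symm (φ x + C s)
  have hβ0 : β 0 = x := by
    change φ.symm (φ x + C 0) = x
    rw [hx0]
    exact φ.left_inv (mem_chart_source K x)
  have hlin : ∀ s, SmoothAt S K (fun s ↦ φ x + C s) s := fun s ↦
    smoothAt_iff_contDiffAt.2 (by fun_prop)
  have hβs : ∀ᶠ s in 𝓝 (0 : S), SmoothAt S K β s := by
    have h1 : ContinuousAt (fun s ↦ φ x + C s) 0 := by fun_prop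
    filter_upwards [h1.preimage_mem_nhds (φ.open_target.mem_nhds
      (by rw [hx0]; exact mem_chart_target K x))] with s hs
    exact SmoothAt.comp (g := φ.symm) (smoothAt_chartAt_symm hs) (hlin s)
  have hdβ : tderiv S K β 0 = C := by
    have h1 := tderiv_comp_of_eq (smoothAt_chartAt_symm (mem_chart_target K x)) (hlin 0) hx0
    rw [tderiv_chartAt_symm_self, ContinuousLinearMap.id_comp, tderiv_eq_fderiv (E := S)] at h1
    refine h1.trans ?_
    rw [fderiv_const_add]
    exact C.fderiv
  -- the map `(u, s) ↦ α u • β s`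
  let A : A₀ × S → LevelSet J c := fun p ↦
    if h : coAd (α p.1) c = c then ⟨α p.1 • (β p.2 : M), by rw [hJ, (β p.2).2]; exact h⟩ else x
  have hA : ∀ p : A₀ × S, p.1 ∈ Metric.ball (0 : A₀) ε →
      ((A p : LevelSet J c) : M) = α p.1 • (β p.2 : M) := fun p hp ↦ by
    simp [A, hαc p.1 hp]
  have hA0s : ∀ s, A (0, s) = β s := fun s ↦ Subtype.ext (by
    rw [hA _ (Metric.mem_ball_self hε), hα1, one_smul])
  have hA0 : A 0 = x := (hA0s 0).trans hβ0
  have hAs : ∀ᶠ p in 𝓝 (0 : A₀ × S), SmoothAt (A₀ × S) K A p := by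
    have h1 : ∀ᶠ p in 𝓝 (0 : A₀ × S), p.1 ∈ Metric.ball (0 : A₀) ε :=
      continuousAt_fst.eventually_mem (Metric.ball_mem_nhds _ hε)
    have h2 : ∀ᶠ p in 𝓝 (0 : A₀ × S), SmoothAt S K β p.2 :=
      (continuousAt_snd (p := (0 : A₀ × S))).eventually hβs
    filter_upwards [h1, h2, h1.eventually_nhds] with p hp1 hp2 hp3
    refine smoothAt_of_comp_embedding hi ?_
    have h4 : SmoothAt (A₀ × S) F (fun p : A₀ × S ↦ α p.1) p :=
      (hα p.1 hp1).1.comp (f := Prod.fst) (smoothAt_iff_contDiffAt.2 contDiffAt_fst)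
    have h5 : SmoothAt (A₀ × S) K (fun p : A₀ × S ↦ β p.2) p :=
      hp2.comp (f := Prod.snd) (smoothAt_iff_contDiffAt.2 contDiffAt_snd)
    have h6 : SmoothAt (A₀ × S) E (fun p : A₀ × S ↦ levelIncl J c (β p.2)) p :=
      (his (β p.2)).comp (f := fun p : A₀ × S ↦ β p.2) h5
    refine (h4.smul h6).congr ?_
    filter_upwards [hp3] with q hq using hA q hq
  have hinl : ∀ u : A₀, SmoothAt A₀ (A₀ × S) (fun u : A₀ ↦ (u, (0 : S))) u := fun u ↦
    smoothAt_iff_contDiffAt.2 (by fun_prop)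
  have hinr : ∀ s : S, SmoothAt S (A₀ × S) (fun s : S ↦ ((0 : A₀), s)) s := fun s ↦
    smoothAt_iff_contDiffAt.2 (by fun_prop)
  have hdinl : tderiv A₀ (A₀ × S) (fun u : A₀ ↦ (u, (0 : S))) (0 : A₀) = ContinuousLinearMap.inl ℝ A₀ S := by
    rw [tderiv_eq_fderiv]
    exact (hasFDerivAt_prodMk_left (0 : A₀) (0 : S)).fderiv
  have hdinr : tderiv S (A₀ × S) (fun s : S ↦ ((0 : A₀), s)) (0 : S) = ContinuousLinearMap.inr ℝ A₀ S := by
    rw [tderiv_eq_fderiv]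
    exact (hasFDerivAt_prodMk_right (0 : A₀) (0 : S)).fderiv
  have hinj := tderiv_injective_of_isImmersionAt (hi.isImmersion.isImmersionAt x)
  -- After inclusion in `M`, the curve directions `A (u, 0) = α u • x` differentiate to
  -- infinitesimal generators, which is how `B` was characterized.
  have hdAu : ∀ u : A₀, tderiv (A₀ × S) K A 0 (u, 0) = B u := by
    intro u
    apply hinj
    have h1 := tderiv_comp_of_eq (hAs.self_of_nhds) (hinl 0) rfl
    rw [hdinl] at h1
    have h2 := tderiv_comp_of_eq (his x) ((hAs.self_of_nhds).comp_of_eq (hinl 0) rfl) hA0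
    rw [h1] at h2
    have h3 : (fun u : A₀ ↦ levelIncl J c (A (u, 0))) =ᶠ[𝓝 0] fun u : A₀ ↦ α u • (x : M) := by
      filter_upwards [Metric.ball_mem_nhds _ hε] with u hu
      refine (hA (u, 0) hu).trans ?_
      rw [hβ0]
    rw [tderiv_congr h3, tderiv_comp_of_eq (smoothAt_orbit (x : M) (1 : G))
      (hα 0 (Metric.mem_ball_self hε)).1 hα1, hdα] at h2
    rw [hB]
    exact (DFunLike.congr_fun h2 u).symm
  have hdAs : ∀ s : S, tderiv (A₀ × S) K A 0 (0, s) = C s := by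
    intro s
    have h1 := tderiv_comp_of_eq (hAs.self_of_nhds) (hinr 0) rfl
    rw [hdinr, show (fun s ↦ A (0, s)) = β from funext hA0s, hdβ] at h1
    exact (DFunLike.congr_fun h1 s).symm
  have hdA : tderiv (A₀ × S) K A 0 = B.coprod C := by
    refine ContinuousLinearMap.ext fun p ↦ ?_
    rw [ContinuousLinearMap.coprod_apply, ← hdAu, ← hdAs, ← map_add, Prod.mk_add_mk, add_zero,
      zero_add]
  obtain ⟨Φ, h0Φ, hΦ⟩ := isLocalDiffeomorphAt_of_bijective hAs (by rw [hdA]; exact hC)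
  obtain ⟨δ, hδ, hδΦ⟩ := Metric.mem_nhds_iff.1 (Φ.open_source.mem_nhds h0Φ)
  let ε₁ := min δ ε
  have hε₁ : 0 < ε₁ := lt_min hδ hε
  -- The neighbourhood of `1` used here is the one on which isotropy elements are of the form `α u`
  -- with `u` in the `ε₁`-ball, where `A` is injective.
  obtain ⟨V, hV, hVg⟩ := exists_nhds_smul_mem hfree hproper x (hcover ε₁ hε₁)
  have hβc : ContinuousAt β 0 := hβs.self_of_nhds.continuousAt
  obtain ⟨δ₂, hδ₂, hδ₂V⟩ := Metric.mem_nhds_iff.1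
    (hβc.preimage_mem_nhds (by rw [hβ0]; exact hV))
  let ε₂ := min ε₁ δ₂
  have hε₂ : 0 < ε₂ := lt_min hε₁ hδ₂
  have hball : ∀ (r : ℝ) (p : A₀ × S), p ∈ Metric.ball (0 : A₀ × S) r ↔
      p.1 ∈ Metric.ball (0 : A₀) r ∧ p.2 ∈ Metric.ball (0 : S) r := fun r p ↦ by
    rw [← mem_prod, ball_prod_same]; rfl
  have hsub₁ : Metric.ball (0 : A₀ × S) ε₁ ⊆ Φ.source :=
    (Metric.ball_subset_ball (min_le_left _ _)).trans hδΦ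
  have hsub : Metric.ball (0 : A₀ × S) ε₂ ⊆ Φ.source :=
    (Metric.ball_subset_ball (min_le_left _ _)).trans hsub₁
  have hΦinj : ∀ p ∈ Metric.ball (0 : A₀ × S) ε₁, ∀ q ∈ Metric.ball (0 : A₀ × S) ε₁,
      A p = A q → p = q := fun p hp q hq hpq ↦ by
    rw [hΦ (hsub₁ hp), hΦ (hsub₁ hq)] at hpq
    exact Φ.injOn (hsub₁ hp) (hsub₁ hq) hpq
  have hAβ : ∀ p ∈ Metric.ball (0 : A₀ × S) ε₂,
      redProj hJ c (A p) = redProj hJ c (β p.2) := fun p hp ↦ by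
    have hp1 : p.1 ∈ Metric.ball (0 : A₀) ε := Metric.ball_subset_ball
      ((min_le_left _ _).trans (min_le_right _ _)) ((hball _ p).1 hp).1
    exact redProj_eq_iff.2 ⟨α p.1, hαc _ hp1, (hA p hp1).symm⟩
  refine ⟨restrDiffeo Φ (Metric.ball 0 ε₂) Metric.isOpen_ball hsub, ε₂, hε₂, rfl, ?_, ?_, ?_⟩
  · change Φ 0 = x
    rw [← hΦ h0Φ, hA0]
  · intro p hp q hq
    change redProj hJ c (Φ p) = redProj hJ c (Φ q) ↔ p.2 = q.2
    rw [← hΦ (hsub hp), ← hΦ (hsub hq), hAβ p hp, hAβ q hq]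
    refine ⟨fun h ↦ ?_, fun h ↦ by rw [h]⟩
    have hp2 := ((hball _ p).1 hp).2
    have hq2 := ((hball _ q).1 hq).2
    -- If `g` carries `β q.2` to `β p.2`, then `g = α u` with `u` small, so `A (0, p.2) = A (u,
    -- q.2)` and injectivity of `A` gives `p.2 = q.2`.
    obtain ⟨g, hg, hgz⟩ := redProj_eq_iff.1 h
    obtain ⟨u, hu, hug⟩ := hVg _ (hδ₂V (Metric.ball_subset_ball (min_le_right _ _) hp2)) _
      (hδ₂V (Metric.ball_subset_ball (min_le_right _ _) hq2)) g hg hgz (hg.trans (coAd_one c).symm)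
    have h1 : A (0, p.2) = A (u, q.2) := by
      rw [hA0s]
      refine Subtype.ext ?_
      rw [hA (u, q.2) (Metric.ball_subset_ball (min_le_right _ _) hu), ← hgz]
      change g • _ = α u • _
      rw [hug]
    have h2 := hΦinj (0, p.2) ((hball _ _).2 ⟨Metric.mem_ball_self hε₁,
      Metric.ball_subset_ball (min_le_left _ _) hp2⟩) (u, q.2) ((hball _ _).2 ⟨hu,
      Metric.ball_subset_ball (min_le_left _ _) hq2⟩) h1
    exact (Prod.ext_iff.1 h2).2
  · intro ξ
    have h1 : tderiv (A₀ × S) K (restrDiffeo Φ (Metric.ball 0 ε₂) Metric.isOpen_ball hsub) 0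
        = tderiv (A₀ × S) K A 0 := by
      refine tderiv_congr ?_
      filter_upwards [Φ.open_source.mem_nhds h0Φ] with q hq using (hΦ hq).symm
    rw [h1, hdAu, hB]

end SliceTheorem

/-! ### The smooth structure of a quotient with slices. -/

section QuotientManifold

variable {K : Type*} [NormedAddCommGroup K] [NormedSpace ℝ K]
  {N : Type*} [TopologicalSpace N] [ChartedSpace K N]
  {A : Type*} [NormedAddCommGroup A] [NormedSpace ℝ A]
  {S : Type*} [NormedAddCommGroup S] [NormedSpace ℝ S]
  {Q : Type*} [TopologicalSpace Q] {p : N → Q}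

/-- The chart of a quotient induced by a slice. -/
theorem exists_chart_of_slice (hp : Continuous p) (ho : IsOpenMap p)
    (Θ : PartialDiffeomorph 𝓘(ℝ, A × S) 𝓘(ℝ, K) (A × S) N ∞) {ε : ℝ} (hε : 0 < ε)
    (hsrc : Θ.source = Metric.ball 0 ε)
    (hΘ : ∀ a ∈ Θ.source, ∀ b ∈ Θ.source, p (Θ a) = p (Θ b) ↔ a.2 = b.2) :
    ∃ κ : OpenPartialHomeomorph Q S, κ.target = Metric.ball 0 ε ∧
      (∀ s ∈ κ.target, ((0 : A), s) ∈ Θ.source ∧ κ.symm s = p (Θ (0, s))) ∧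
      ∀ a ∈ Θ.source, p (Θ a) ∈ κ.source ∧ κ (p (Θ a)) = a.2 := by
  let j : S → Q := fun s ↦ p (Θ (0, s))
  have hmem : ∀ a : A × S, a ∈ Θ.source ↔ a.1 ∈ Metric.ball (0 : A) ε ∧
      a.2 ∈ Metric.ball (0 : S) ε := fun a ↦ by
    rw [hsrc, ← mem_prod, ball_prod_same]; rfl
  have h0 : ∀ s ∈ Metric.ball (0 : S) ε, ((0 : A), s) ∈ Θ.source := fun s hs ↦
    (hmem _).2 ⟨Metric.mem_ball_self hε, hs⟩
  have hinj : InjOn j (Metric.ball 0 ε) := fun s hs t ht h ↦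
    (hΘ _ (h0 s hs) _ (h0 t ht)).1 h
  have hj : ∀ a ∈ Θ.source, p (Θ a) = j a.2 := fun a ha ↦
    (hΘ a ha _ (h0 _ ((hmem a).1 ha).2)).2 rfl
  let e := BijOn.toPartialEquiv j (Metric.ball 0 ε) _ hinj.bijOn_image
  have hc : ContinuousOn e e.source := by
    change ContinuousOn j (Metric.ball 0 ε)
    exact hp.comp_continuousOn (Θ.contMDiffOn_toFun.continuousOn.comp (by fun_prop) h0)
  -- The image of `U` under `j` equals the image under `p ∘ Θ` of the open tube `Θ.source ∩ Prod.snd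
  -- ⁻¹' U`, because `p ∘ Θ` depends only on the second coordinate. Openness of `p` concludes.
  have hopen : IsOpenMap (e.source.domRestrict e) := by
    intro V hV
    obtain ⟨U, hU, rfl⟩ := isOpen_induced_iff.1 hV
    have hW : IsOpen (Θ.source ∩ Prod.snd ⁻¹' U) :=
      Θ.open_source.inter (hU.preimage continuous_snd)
    convert ho _ (Θ.toOpenPartialHomeomorph.isOpen_image_of_subset_source hW inter_subset_left)
      using 1
    ext y
    constructor
    · rintro ⟨⟨s, hs⟩, hsU, rfl⟩
      exact ⟨_, ⟨(0, s), ⟨h0 s hs, hsU⟩, rfl⟩, rfl⟩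
    · rintro ⟨_, ⟨a, ⟨ha, haU⟩, rfl⟩, rfl⟩
      exact ⟨⟨a.2, ((hmem a).1 ha).2⟩, haU, (hj a ha).symm⟩
  let κ := (OpenPartialHomeomorph.ofContinuousOpenRestrict e hc hopen Metric.isOpen_ball).symm
  refine ⟨κ, rfl, fun s hs ↦ ⟨h0 s hs, rfl⟩, fun a ha ↦ ?_⟩
  have ha2 : a.2 ∈ κ.target := ((hmem a).1 ha).2
  rw [hj a ha]
  exact ⟨κ.map_target ha2, κ.right_inv ha2⟩

/-- A quotient with slices is a manifold, and the projection is a submersion. -/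
theorem exists_isSubmersion_of_slices [IsManifold 𝓘(ℝ, K) ∞ N] [FiniteDimensional ℝ K]
    [FiniteDimensional ℝ A] [FiniteDimensional ℝ S]
    (hp : Continuous p) (ho : IsOpenMap p) (hsurj : Function.Surjective p)
    (hdim : ∀ _ : N, Module.finrank ℝ K = Module.finrank ℝ A + Module.finrank ℝ S)
    (hslice : ∀ x : N, ∃ (Θ : PartialDiffeomorph 𝓘(ℝ, A × S) 𝓘(ℝ, K) (A × S) N ∞) (ε : ℝ),
      0 < ε ∧ Θ.source = Metric.ball 0 ε ∧ Θ 0 = x ∧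
      ∀ a ∈ Θ.source, ∀ b ∈ Θ.source, p (Θ a) = p (Θ b) ↔ a.2 = b.2)
    (htrans : ∀ y z : N, p y = p z →
      ∃ h : N → N, SmoothAt K K h y ∧ h y = z ∧ ∀ w, p (h w) = p w) :
    ∃ (_ : ChartedSpace S Q) (_ : IsManifold 𝓘(ℝ, S) ∞ Q),
      Manifold.IsSubmersion 𝓘(ℝ, K) 𝓘(ℝ, S) ∞ p := by
  choose Θ ε hε hsrc hΘ0 hΘ using hslice
  choose κ hκt hκs hκ using fun x ↦ exists_chart_of_slice hp ho (Θ x) (hε x) (hsrc x) (hΘ x)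
  have h0 : ∀ x, (0 : A × S) ∈ (Θ x).source := fun x ↦ by
    rw [hsrc]; exact Metric.mem_ball_self (hε x)
  have hpx : ∀ x, p x ∈ (κ x).source := fun x ↦ by
    have := (hκ x 0 (h0 x)).1
    rwa [hΘ0] at this
  let cs : ChartedSpace S Q :=
    { atlas := range κ
      chartAt := fun y ↦ κ (Function.surjInv hsurj y)
      mem_chart_source := fun y ↦ by
        have := hpx (Function.surjInv hsurj y)
        rwa [Function.surjInv_eq hsurj y] at this
      chart_mem_atlas := fun y ↦ ⟨_, rfl⟩ }
  have hman : IsManifold 𝓘(ℝ, S) ∞ Q := by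
    refine isManifold_of_contDiffOn _ _ _ ?_
    rintro _ _ ⟨x, rfl⟩ ⟨x', rfl⟩ z ⟨hz, -⟩
    have hz1 : z ∈ (κ x).target := hz.1
    have hz2 : (κ x).symm z ∈ (κ x').source := hz.2
    obtain ⟨hzΘ, hzp⟩ := hκs x z hz1
    obtain ⟨hzΘ', hzp'⟩ := hκs x' _ ((κ x').map_source hz2)
    rw [(κ x').left_inv hz2] at hzp'
    -- The two slices may meet the fibre over this point at different places. The map `h` moves one
    -- to the other without changing `p`, so the transition map is locally the `S`-component of
    -- `Θ'⁻¹ ∘ h ∘ Θ (0, ·)`.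
    obtain ⟨h, hh, hhy, hph⟩ := htrans _ _ (hzp.symm.trans hzp')
    have h1 : SmoothAt S (A × S) (fun s : S ↦ ((0 : A), s)) z :=
      smoothAt_iff_contDiffAt.2 (by fun_prop)
    have h2 : SmoothAt S K (fun s : S ↦ Θ x (0, s)) z :=
      (smoothAt_of_mem_source hzΘ).comp (f := fun s : S ↦ ((0 : A), s)) h1
    have h3 : SmoothAt S K (fun s : S ↦ h (Θ x (0, s))) z :=
      hh.comp (f := fun s : S ↦ Θ x (0, s)) h2
    have hT : h (Θ x (0, z)) ∈ (Θ x').target := by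
      rw [hhy]; exact (Θ x').map_source hzΘ'
    have h4 : SmoothAt S (A × S) (fun s : S ↦ (Θ x').symm (h (Θ x (0, s)))) z :=
      (smoothAt_symm_of_mem_target hT).comp (f := fun s : S ↦ h (Θ x (0, s))) h3
    have h5 : SmoothAt S S (fun s : S ↦ ((Θ x').symm (h (Θ x (0, s)))).2) z :=
      SmoothAt.comp (g := Prod.snd) (smoothAt_iff_contDiffAt.2 contDiffAt_snd) h4
    have h6 : SmoothAt S S (fun s : S ↦ κ x' ((κ x).symm s)) z := by
      refine h5.congr ?_
      filter_upwards [(κ x).open_target.mem_nhds hz1, h3.continuousAt.eventually_mem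
        ((Θ x').open_target.mem_nhds hT)] with s hs hsT
      have hinv : Θ x' ((Θ x').symm (h (Θ x (0, s)))) = h (Θ x (0, s)) := (Θ x').right_inv hsT
      have h7 := (hκ x' _ ((Θ x').map_target hsT)).2
      refine Eq.trans (congrArg (κ x') ?_) h7
      rw [(hκs x s hs).2, ← hph]
      exact congrArg p hinv.symm
    exact (smoothAt_iff_contDiffAt.1 h6).contDiffWithinAt
  refine ⟨cs, hman, ?_⟩
  refine Manifold.IsSubmersionOfComplement.isSubmersion (F := A) fun x ↦ ?_
  let L : (A × S) ≃L[ℝ] K := (LinearEquiv.ofFinrankEq (A × S) K (by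
    rw [Module.finrank_prod, hdim x])).toContinuousLinearEquiv
  -- In the slice coordinates upstairs and the induced chart downstairs, `p` is the projection `A ×
  -- S → S`.
  refine Manifold.IsSubmersionAtOfComplement.mk_of_charts
    (L.symm.trans (ContinuousLinearEquiv.prodComm ℝ A S))
    ((Θ x).symm.trans L.toDiffeomorph.toPartialDiffeomorph).toOpenPartialHomeomorph (κ x)
    ⟨?_, trivial⟩ (hpx x) (mem_maximalAtlas_of_partialDiffeomorph _)
    (IsManifold.subset_maximalAtlas ⟨x, rfl⟩) ?_ ?_
  · have := (Θ x).map_source (h0 x)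
    rwa [show (Θ x).toPartialEquiv 0 = x from hΘ0 x] at this
  · rintro y ⟨hy, -⟩
    have h1 := (hκ x _ ((Θ x).map_target hy)).1
    have h2 : Θ x ((Θ x).symm y) = y := (Θ x).right_inv hy
    exact (congrArg (fun y ↦ p y ∈ (κ x).source) h2).mp h1
  · intro z hz
    have hz' : L.symm z ∈ (Θ x).source := by
      have h1 : z ∈ L.toDiffeomorph.toPartialDiffeomorph.target ∧
        L.toDiffeomorph.toPartialDiffeomorph.symm z ∈ (Θ x).source := by
        simpa [mfld_simps] using! hz
      exact h1.2
    exact (hκ x _ hz').2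

end QuotientManifold

/-! ### Topology and smooth structure of the reduced space. -/

section ReducedManifold

variable {F : Type*} [NormedAddCommGroup F] [NormedSpace ℝ F]
  {G : Type*} [TopologicalSpace G] [ChartedSpace F G] [Group G] [LieGroup 𝓘(ℝ, F) ∞ G]
  {E : Type*} [NormedAddCommGroup E] [NormedSpace ℝ E]
  {M : Type*} [TopologicalSpace M] [ChartedSpace E M]
  [MulAction G M] [ContMDiffSMul 𝓘(ℝ, F) 𝓘(ℝ, E) ∞ G M]
  {σ : BilinField 𝓘(ℝ, E) M} {J : M → DualLieAlg F} {c : DualLieAlg F}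

theorem continuousConstSMul (F : Type*) [NormedAddCommGroup F] [NormedSpace ℝ F]
    (G : Type*) [TopologicalSpace G] [ChartedSpace F G] [Group G]
    (E : Type*) [NormedAddCommGroup E] [NormedSpace ℝ E]
    (M : Type*) [TopologicalSpace M] [ChartedSpace E M] [MulAction G M]
    [ContMDiffSMul 𝓘(ℝ, F) 𝓘(ℝ, E) ∞ G M] : ContinuousConstSMul G M :=
  ⟨fun g ↦ continuous_iff_continuousAt.2 fun x ↦
    (smoothAt_const_smul (E := E) F (g : G) x).continuousAt⟩

theorem continuousConstSMul_levelAction [ContinuousConstSMul G M] (hJ : IsEquivariant G J) (c : DualLieAlg F) :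
    letI := levelAction hJ c
    ContinuousConstSMul (isotropy G c) (LevelSet J c) := by
  let _ := levelAction hJ c
  refine ⟨fun g ↦ continuous_induced_rng.2 ?_⟩
  exact (continuous_const_smul (g : G)).comp continuous_subtype_val

theorem continuous_redProj (hJ : IsEquivariant G J) (c : DualLieAlg F) :
    Continuous (redProj hJ c) := continuous_quot_mk

theorem surjective_redProj (hJ : IsEquivariant G J) (c : DualLieAlg F) :
    Function.Surjective (redProj hJ c) := Quot.mk_surjective

theorem isOpenMap_redProj [ContinuousConstSMul G M] (hJ : IsEquivariant G J) (c : DualLieAlg F) :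
    IsOpenMap (redProj hJ c) := by
  let _ := levelAction hJ c
  have := continuousConstSMul_levelAction hJ c
  exact isOpenMap_quotient_mk'_mul

theorem t2Space_reducedSpace {hJ : IsEquivariant G J} (hproper : ActsProperly hJ c) :
    T2Space (ReducedSpace hJ c) := by
  let _ := levelAction hJ c
  have : ProperSMul (isotropy G c) (LevelSet J c) := hproper
  exact t2Space_quotient_mulAction_of_properSMul

theorem secondCountableTopology_reducedSpace [SecondCountableTopology M] [ContinuousConstSMul G M]
    (hJ : IsEquivariant G J) (c : DualLieAlg F) :
    SecondCountableTopology (ReducedSpace hJ c) := by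
  let _ := levelAction hJ c
  have := continuousConstSMul_levelAction hJ c
  have : SecondCountableTopology (LevelSet J c) :=
    TopologicalSpace.Subtype.secondCountableTopology {x : M | J x = c}
  exact ContinuousConstSMul.secondCountableTopology

/-- The diffeomorphism of the level set given by an element of the isotropy group. -/
def levelSmul (hJ : IsEquivariant G J) {g : G} (hg : coAd g c = c) (x : LevelSet J c) :
    LevelSet J c := ⟨g • (x : M), by rw [hJ, x.2, hg]⟩

theorem redProj_levelSmul {hJ : IsEquivariant G J} {g : G} (hg : coAd g c = c)
    (x : LevelSet J c) : redProj hJ c (levelSmul hJ hg x) = redProj hJ c x :=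
  redProj_eq_iff.2 ⟨g, hg, rfl⟩

variable [FiniteDimensional ℝ F] [FiniteDimensional ℝ E] [IsManifold 𝓘(ℝ, E) ∞ M]
  {K : Type*} [NormedAddCommGroup K] [NormedSpace ℝ K] [FiniteDimensional ℝ K]

theorem smoothAt_levelSmul [ChartedSpace K (LevelSet J c)] [IsManifold 𝓘(ℝ, K) ∞ (LevelSet J c)]
    (hi : Manifold.IsSmoothEmbedding 𝓘(ℝ, K) 𝓘(ℝ, E) ∞ (levelIncl J c))
    (hJ : IsEquivariant G J) {g : G} (hg : coAd g c = c) (x : LevelSet J c) :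
    SmoothAt K K (levelSmul hJ hg) x := by
  refine smoothAt_of_comp_embedding hi ?_
  have h1 : SmoothAt K E (levelIncl J c) x := hi.contMDiff x
  exact (smoothAt_const_smul F g _).comp h1

theorem exists_isSubmersion_redProj [ChartedSpace K (LevelSet J c)]
    [IsManifold 𝓘(ℝ, K) ∞ (LevelSet J c)] {hJ : IsEquivariant G J}
    (hi : Manifold.IsSmoothEmbedding 𝓘(ℝ, K) 𝓘(ℝ, E) ∞ (levelIncl J c))
    (hmom : IsMomentumMap G σ J) (hreg : IsRegularValue E J c)
    (hfree : ActsFreely hJ c) (hproper : ActsProperly hJ c)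
    {S : Type*} [NormedAddCommGroup S] [NormedSpace ℝ S] [FiniteDimensional ℝ S]
    (hdim : ∀ _ : LevelSet J c,
      Module.finrank ℝ K = Module.finrank ℝ (isotropyAlg F G c) + Module.finrank ℝ S) :
    ∃ (_ : ChartedSpace S (ReducedSpace hJ c)) (_ : IsManifold 𝓘(ℝ, S) ∞ (ReducedSpace hJ c)),
      Manifold.IsSubmersion 𝓘(ℝ, K) 𝓘(ℝ, S) ∞ (redProj hJ c) := by
  have := continuousConstSMul F G E M
  refine exists_isSubmersion_of_slices (A := isotropyAlg F G c) (continuous_redProj hJ c)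
    (isOpenMap_redProj hJ c) (surjective_redProj hJ c) hdim (fun x ↦ ?_) fun y z hyz ↦ ?_
  · obtain ⟨Θ, ε, h1, h2, h3, h4, -⟩ := exists_slice hi hmom hreg hfree hproper (hdim x) x
    exact ⟨Θ, ε, h1, h2, h3, h4⟩
  · obtain ⟨g, hg, hgy⟩ := redProj_eq_iff.1 hyz.symm
    exact ⟨levelSmul hJ hg, smoothAt_levelSmul hi hJ hg y, Subtype.ext hgy, redProj_levelSmul hg⟩

theorem exists_reduced_manifold {hJ : IsEquivariant G J}
    (hmom : IsMomentumMap G σ J) (hreg : IsRegularValue E J c)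
    (hfree : ActsFreely hJ c) (hproper : ActsProperly hJ c) :
    ∃ (k r : ℕ) (_ : ChartedSpace (EuclideanSpace ℝ (Fin k)) (LevelSet J c))
      (_ : IsManifold (𝓡 k) ∞ (LevelSet J c))
      (_ : ChartedSpace (EuclideanSpace ℝ (Fin r)) (ReducedSpace hJ c))
      (_ : IsManifold (𝓡 r) ∞ (ReducedSpace hJ c)),
      Manifold.IsSmoothEmbedding (𝓡 k) 𝓘(ℝ, E) ∞ (levelIncl J c) ∧
      Manifold.IsSubmersion (𝓡 k) (𝓡 r) ∞ (redProj hJ c) := by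
  have hs : ∀ x, SmoothAt E (DualLieAlg F) J x := hmom.smooth
  -- The truncated subtractions defining `k` and `r` are exact as soon as the level set has a point.
  -- The dimension hypotheses are only required at points, so an empty level set causes no trouble.
  let k := Module.finrank ℝ E - Module.finrank ℝ (DualLieAlg F)
  obtain ⟨csN, manN, hi⟩ := exists_isSmoothEmbedding_levelSet (K := EuclideanSpace ℝ (Fin k))
    (c := c) hs hreg fun y hy ↦ by
      have h1 := LinearMap.finrank_le_finrank_of_surjective
        (f := (tderiv E (DualLieAlg F) J y : E →ₗ[ℝ] DualLieAlg F)) (hreg y hy)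
      rw [finrank_euclideanSpace_fin]
      omega
  let r := k - Module.finrank ℝ (isotropyAlg F G c)
  obtain ⟨csQ, manQ, hp⟩ := exists_isSubmersion_redProj (S := EuclideanSpace ℝ (Fin r)) hi hmom
    hreg hfree hproper fun x ↦ by
      have h1 := finrank_isotropyAlg_le hi hmom hJ hreg x
      rw [finrank_euclideanSpace_fin] at h1 ⊢
      rw [finrank_euclideanSpace_fin]
      omega
  exact ⟨k, r, csN, manN, csQ, manQ, hi, hp⟩

end ReducedManifold

/-! ### Local sections of submersions. -/

section Submersions

variable {K : Type*} [NormedAddCommGroup K] [NormedSpace ℝ K]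
  {N : Type*} [TopologicalSpace N] [ChartedSpace K N] [IsManifold 𝓘(ℝ, K) ∞ N]
  {S : Type*} [NormedAddCommGroup S] [NormedSpace ℝ S]
  {Q : Type*} [TopologicalSpace Q] [ChartedSpace S Q] [IsManifold 𝓘(ℝ, S) ∞ Q]
  {p : N → Q}

/-- A submersion has local sections through every point. -/
theorem exists_local_section {x : N} (hp : Manifold.IsSubmersionAt 𝓘(ℝ, K) 𝓘(ℝ, S) ∞ p x) :
    ∃ s : Q → N, s (p x) = x ∧ ∀ᶠ y in 𝓝 (p x), SmoothAt S K s y ∧ p (s y) = y := by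
  let d := chartDiffeo hp.domChart hp.domChart_mem_maximalAtlas
  let e := chartDiffeo hp.codChart hp.codChart_mem_maximalAtlas
  let L := hp.equiv
  have hxd : x ∈ d.source := hp.mem_domChart_source
  have hxe : p x ∈ e.source := hp.mem_codChart_source
  have hloc : ∀ z ∈ d.target, e (p (d.symm z)) = (L z).1 := fun z hz ↦
    hp.writtenInCharts (by simpa [mfld_simps] using! hz)
  have hsrc : ∀ y ∈ d.source, p y ∈ e.source := fun y hy ↦ hp.source_subset_preimage_source hy
  have hdx : d.symm (d x) = x := d.left_inv hxd
  -- In the submersion charts `p` is the first projection; the section freezes the second coordinate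
  -- at its value at `x`.
  let t : Q → K := fun y ↦ L.symm (e y, (L (d x)).2)
  have htx : t (p x) = d x := by
    have h1 := hloc (d x) (d.map_source hxd)
    rw [hdx] at h1
    change L.symm (e (p x), (L (d x)).2) = d x
    rw [h1]
    exact L.symm_apply_apply _
  have hts : ∀ y ∈ e.source, SmoothAt S K t y := fun y hy ↦
    SmoothAt.comp (g := fun z : S ↦ L.symm (z, (L (d x)).2))
      (smoothAt_iff_contDiffAt.2 (by fun_prop)) (smoothAt_of_mem_source hy)
  refine ⟨fun y ↦ d.symm (t y), (congrArg d.symm htx).trans hdx, ?_⟩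
  filter_upwards [e.open_source.mem_nhds hxe, (hts _ hxe).continuousAt.eventually_mem
    (d.open_target.mem_nhds (by rw [htx]; exact d.map_source hxd))] with y hy hty
  refine ⟨(smoothAt_symm_of_mem_target hty).comp (hts y hy), ?_⟩
  refine e.injOn (hsrc _ (d.map_target hty)) hy ?_
  have h1 := hloc _ hty
  have h2 : (L (t y)).1 = e y := congrArg Prod.fst (L.apply_symm_apply _)
  exact h1.trans h2

theorem tderiv_surjective_of_isSubmersionAt {x : N}
    (hp : Manifold.IsSubmersionAt 𝓘(ℝ, K) 𝓘(ℝ, S) ∞ p x) :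
    Function.Surjective (tderiv K S p x) := by
  obtain ⟨s, hsx, hs⟩ := exists_local_section hp
  have h1 := tderiv_comp_of_eq (E := S) (E₁ := K) (E₂ := S) (hp.contMDiffAt) hs.self_of_nhds.1 hsx
  rw [tderiv_congr (hs.mono fun y hy ↦ hy.2), tderiv_id] at h1
  exact fun v ↦ ⟨_, (DFunLike.congr_fun h1 v).symm⟩

/-- Locally `h = (h ∘ p) ∘ s` for a smooth section `s`. -/
theorem smoothAt_of_comp_submersion {E : Type*} [NormedAddCommGroup E] [NormedSpace ℝ E]
    {X : Type*} [TopologicalSpace X] [ChartedSpace E X] {x : N}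
    (hp : Manifold.IsSubmersionAt 𝓘(ℝ, K) 𝓘(ℝ, S) ∞ p x) {h : Q → X}
    (hh : SmoothAt K E (fun y ↦ h (p y)) x) : SmoothAt S E h (p x) := by
  obtain ⟨s, hsx, hs⟩ := exists_local_section hp
  refine (hh.comp_of_eq hs.self_of_nhds.1 hsx).congr ?_
  filter_upwards [hs] with y hy
  rw [hy.2]

end Submersions

/-! ### The vertical space of the reduction. -/

section Kernel

variable {F : Type*} [NormedAddCommGroup F] [NormedSpace ℝ F] [FiniteDimensional ℝ F]
  {G : Type*} [TopologicalSpace G] [ChartedSpace F G] [Group G] [LieGroup 𝓘(ℝ, F) ∞ G]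
  {E : Type*} [NormedAddCommGroup E] [NormedSpace ℝ E] [FiniteDimensional ℝ E]
  {M : Type*} [TopologicalSpace M] [ChartedSpace E M] [IsManifold 𝓘(ℝ, E) ∞ M]
  [MulAction G M] [ContMDiffSMul 𝓘(ℝ, F) 𝓘(ℝ, E) ∞ G M]
  {σ : BilinField 𝓘(ℝ, E) M} {J : M → DualLieAlg F} {c : DualLieAlg F}
  {hJ : IsEquivariant G J}
  {K : Type*} [NormedAddCommGroup K] [NormedSpace ℝ K] [FiniteDimensional ℝ K]
  [ChartedSpace K (LevelSet J c)] [IsManifold 𝓘(ℝ, K) ∞ (LevelSet J c)]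
  {S : Type*} [NormedAddCommGroup S] [NormedSpace ℝ S]
  [ChartedSpace S (ReducedSpace hJ c)] [IsManifold 𝓘(ℝ, S) ∞ (ReducedSpace hJ c)]

/-- The kernel of the derivative of the projection is tangent to the orbits of `G_c`. -/
theorem tderiv_redProj_eq_zero_iff
    (hi : Manifold.IsSmoothEmbedding 𝓘(ℝ, K) 𝓘(ℝ, E) ∞ (levelIncl J c))
    (hp : Manifold.IsSubmersion 𝓘(ℝ, K) 𝓘(ℝ, S) ∞ (redProj hJ c))
    (hmom : IsMomentumMap G σ J) (hreg : IsRegularValue E J c)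
    (hfree : ActsFreely hJ c) (hproper : ActsProperly hJ c) (x : LevelSet J c) (v : K) :
    tderiv K S (redProj hJ c) x v = 0 ↔
      ∃ ξ ∈ isotropyAlg F G c,
        tderiv K E (levelIncl J c) x v = infGen G E M (ξ : F) (x : M) := by
  let A := isotropyAlg F G c
  let T := EuclideanSpace ℝ (Fin (Module.finrank ℝ K - Module.finrank ℝ A))
  obtain ⟨Θ, ε, hε, hsrc, hΘ0, hΘ, hdΘ⟩ := exists_slice (S := T) hi hmom hreg hfree hproper (by
    have h1 := finrank_isotropyAlg_le hi hmom hJ hreg x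
    rw [finrank_euclideanSpace_fin]
    exact (Nat.add_sub_of_le h1).symm) x
  have h0 : (0 : A × T) ∈ Θ.source := by rw [hsrc]; exact Metric.mem_ball_self hε
  have hxΘ : x ∈ Θ.target := by rw [← hΘ0]; exact Θ.map_source h0
  have hinj := tderiv_injective_of_isImmersionAt (hi.isImmersion.isImmersionAt x)
  have hps : SmoothAt K S (redProj hJ c) x := (hp.isSubmersionAt x).contMDiffAt
  have hΘs : SmoothAt (A × T) K Θ 0 := smoothAt_of_mem_source h0
  have hΘxs : SmoothAt K (A × T) Θ.symm x := smoothAt_symm_of_mem_target hxΘ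
  have hΘx : Θ.symm x = 0 := by
    rw [← hΘ0]
    exact Θ.left_inv h0
  constructor
  · intro hv
    obtain ⟨s, hsx, hs⟩ := exists_local_section (hp.isSubmersionAt x)
    -- The smooth structure on the quotient is arbitrary, so it is compared with the slice through a
    -- section `s`. The slice coordinate `q` is constant on local fibres, so `q = q ∘ s ∘ p` near
    -- `x`, and `dp v = 0` forces `dq v = 0`. Then `v` points along the orbit.
    let q : LevelSet J c → T := fun y ↦ (Θ.symm y).2
    have hsnd : ∀ z, SmoothAt (A × T) T Prod.snd z := fun z ↦
      smoothAt_iff_contDiffAt.2 contDiffAt_snd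
    have hq : SmoothAt K T q x := (hsnd _).comp hΘxs
    have hsp : SmoothAt K K (fun y ↦ s (redProj hJ c y)) x := hs.self_of_nhds.1.comp hps
    have h1 : (fun y ↦ q (s (redProj hJ c y))) =ᶠ[𝓝 x] q := by
      filter_upwards [Θ.open_target.mem_nhds hxΘ, hps.continuousAt.eventually hs,
        hsp.continuousAt.eventually_mem (Θ.open_target.mem_nhds (by rwa [hsx]))] with y h1 h2 h3
      refine (hΘ _ (Θ.map_target h3) _ (Θ.map_target h1)).1 ?_
      have h4 : Θ (Θ.symm (s (redProj hJ c y))) = s (redProj hJ c y) := Θ.right_inv h3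
      have h5 : Θ (Θ.symm y) = y := Θ.right_inv h1
      exact (congrArg _ h4).trans (h2.2.trans (congrArg _ h5.symm))
    have h2 := tderiv_comp_of_eq hq hsp hsx
    rw [tderiv_congr h1, tderiv_comp hs.self_of_nhds.1 hps] at h2
    have h3 : tderiv K T q x v = 0 := by
      rw [h2]
      simp [hv]
    have h4 : tderiv K T q x = (ContinuousLinearMap.snd ℝ A T).comp
        (tderiv K (A × T) Θ.symm x) := by
      refine (tderiv_comp (hsnd _) hΘxs).trans ?_
      rw [tderiv_eq_fderiv]
      congr 1
      exact fderiv_snd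
    have h5 : (tderiv K (A × T) Θ.symm x v).2 = 0 := by rwa [h4] at h3
    have h6 := tderiv_comp_symm hxΘ
    rw [hΘx] at h6
    refine ⟨_, (tderiv K (A × T) Θ.symm x v).1.2, ?_⟩
    rw [← hdΘ]
    congr 1
    refine (DFunLike.congr_fun h6 v).symm.trans ?_
    change tderiv (A × T) K Θ 0 (tderiv K (A × T) Θ.symm x v) = _
    congr 1
    exact Prod.ext rfl h5
  · rintro ⟨ξ, hξ, hv⟩
    have h1 : v = tderiv (A × T) K Θ 0 (⟨ξ, hξ⟩, 0) := hinj (by rw [hdΘ]; exact hv)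
    have hinl : SmoothAt A (A × T) (fun u : A ↦ (u, (0 : T))) 0 :=
      smoothAt_iff_contDiffAt.2 (by fun_prop)
    have hdinl : tderiv A (A × T) (fun u : A ↦ (u, (0 : T))) (0 : A)
        = ContinuousLinearMap.inl ℝ A T := by
      rw [tderiv_eq_fderiv]
      exact (hasFDerivAt_prodMk_left (0 : A) (0 : T)).fderiv
    have h2 := tderiv_comp_of_eq hps (hΘs.comp_of_eq hinl rfl) hΘ0
    rw [tderiv_comp_of_eq hΘs hinl rfl, hdinl] at h2
    have h3 : (fun u : A ↦ redProj hJ c (Θ (u, 0))) =ᶠ[𝓝 0] fun _ ↦ redProj hJ c x := by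
      filter_upwards [hinl.continuousAt.eventually_mem (Θ.open_source.mem_nhds h0)] with u hu
      rw [← hΘ0]
      exact (hΘ _ hu _ h0).2 rfl
    rw [tderiv_congr h3, tderiv_const] at h2
    rw [h1]
    exact (DFunLike.congr_fun h2 (⟨ξ, hξ⟩ : A)).symm

end Kernel

/-! ### Pull-backs of bilinear forms and their smoothness in charts. -/

section Pullback

variable {E : Type*} [NormedAddCommGroup E] [NormedSpace ℝ E]
  {M : Type*} [TopologicalSpace M] [ChartedSpace E M]
  {E₁ : Type*} [NormedAddCommGroup E₁] [NormedSpace ℝ E₁]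
  {X : Type*} [TopologicalSpace X] [ChartedSpace E₁ X]

variable (E₁) in
/-- The pull-back of a field of bilinear forms. -/
noncomputable def pullForm (σ : BilinField 𝓘(ℝ, E) M) (h : X → M) (z : X) :
    E₁ →L[ℝ] E₁ →L[ℝ] ℝ :=
  (form σ (h z)).bilinearComp (tderiv E₁ E h z) (tderiv E₁ E h z)

theorem pullForm_apply (σ : BilinField 𝓘(ℝ, E) M) (h : X → M) (z : X) (u v : E₁) :
    pullForm E₁ σ h z u v = form σ (h z) (tderiv E₁ E h z u) (tderiv E₁ E h z v) := rfl

theorem pullForm_congr {σ : BilinField 𝓘(ℝ, E) M} {h h' : X → M} {z : X} (hh : h =ᶠ[𝓝 z] h') :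
    pullForm E₁ σ h z = pullForm E₁ σ h' z := by
  unfold pullForm
  rw [tderiv_congr hh, hh.self_of_nhds]

theorem pullForm_comp {E₂ : Type*} [NormedAddCommGroup E₂] [NormedSpace ℝ E₂]
    {Y : Type*} [TopologicalSpace Y] [ChartedSpace E₂ Y] {σ : BilinField 𝓘(ℝ, E) M}
    {h : X → M} {k : Y → X} {z : Y} (hh : SmoothAt E₁ E h (k z)) (hk : SmoothAt E₂ E₁ k z) :
    pullForm E₂ σ (fun y ↦ h (k y)) z
      = (pullForm E₁ σ h (k z)).bilinearComp (tderiv E₂ E₁ k z) (tderiv E₂ E₁ k z) := by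
  unfold pullForm
  rw [tderiv_comp hh hk]
  rfl

theorem contDiffAt_bilinearComp {E₂ : Type*} [NormedAddCommGroup E₂] [NormedSpace ℝ E₂]
    {B : E₂ → E →L[ℝ] E →L[ℝ] ℝ} {A : E₂ → E₁ →L[ℝ] E} {z : E₂} (hB : ContDiffAt ℝ ∞ B z)
    (hA : ContDiffAt ℝ ∞ A z) :
    ContDiffAt ℝ ∞ (fun z ↦ (B z).bilinearComp (A z) (A z)) z := by
  have h1 : ContDiffAt ℝ ∞ (fun z ↦ (B z).comp (A z)) z := hB.clm_comp hA
  have h2 : ∀ z, (B z).bilinearComp (A z) (A z)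
      = ((ContinuousLinearMap.compL ℝ E₁ E ℝ).flip (A z)).comp ((B z).comp (A z)) := fun z ↦ by
    ext u v; rfl
  simp_rw [h2]
  exact ((ContinuousLinearMap.contDiff _).contDiffAt.comp z hA).clm_comp h1

variable [IsManifold 𝓘(ℝ, E) ∞ M]

/-- The trivialization of the bundle of forms precomposes with the inverse tangent trivialization,
which is the derivative of the inverse chart. Bundle smoothness thus becomes smoothness of the
pull-back by the inverse chart. -/
theorem trivializationAt_form_apply (σ : BilinField 𝓘(ℝ, E) M) {x₀ x : M}
    (hx : x ∈ (chartAt E x₀).source) :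
    (trivializationAt (E →L[ℝ] E →L[ℝ] ℝ)
      (fun x : M ↦ TangentSpace 𝓘(ℝ, E) x →L[ℝ] TangentSpace 𝓘(ℝ, E) x →L[ℝ] ℝ) x₀ ⟨x, σ x⟩).2
      = pullForm E σ (chartAt E x₀).symm (chartAt E x₀ x) := by
  have h1 := TangentBundle.symmL_trivializationAt (I := 𝓘(ℝ, E)) hx
  have hx' : x ∈ (trivializationAt E (TangentSpace 𝓘(ℝ, E) : M → Type _) x₀).baseSet := hx
  ext u v
  rw [hom_trivializationAt_apply]
  refine (inCoordinates_apply_eq₂ (F₃ := ℝ) (E₃ := fun _ : M ↦ ℝ) hx' hx' (mem_univ _)).trans ?_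
  have h2 : ∀ u : E, (trivializationAt E (TangentSpace 𝓘(ℝ, E) : M → Type _) x₀).symm x u =
    tderiv E E (chartAt E x₀).symm (chartAt E x₀ x) u := fun u ↦ by
    have h3 := DFunLike.congr_fun h1 u
    rw [Bundle.Trivialization.symmL_apply _ hx'] at h3
    refine h3.trans ?_
    rw [ModelWithCorners.range_eq_univ, mfderivWithin_univ]
    rfl
  rw [h2, h2]
  rw [Bundle.Trivialization.linearMapAt_apply]
  refine (if_pos (mem_univ _)).trans ?_
  have h4 : (chartAt E x₀).symm (chartAt E x₀ x) = x := (chartAt E x₀).left_inv hx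
  change form σ x _ _ = form σ ((chartAt E x₀).symm (chartAt E x₀ x)) _ _
  rw [h4]
  rfl

/-- Smoothness of a field of bilinear forms, read in a chart. -/
theorem contMDiffAt_form_iff (σ : BilinField 𝓘(ℝ, E) M) (x : M) :
    ContMDiffAt 𝓘(ℝ, E) (𝓘(ℝ, E).prod 𝓘(ℝ, E →L[ℝ] E →L[ℝ] ℝ)) ∞
      (fun x ↦ Bundle.TotalSpace.mk' (E →L[ℝ] E →L[ℝ] ℝ)
        (E := fun x : M ↦ TangentSpace 𝓘(ℝ, E) x →L[ℝ] TangentSpace 𝓘(ℝ, E) x →L[ℝ] ℝ)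
        x (σ x)) x
      ↔ ContDiffAt ℝ ∞ (pullForm E σ (chartAt E x).symm) (chartAt E x x) := by
  have hx := mem_chart_source E x
  have hxt := mem_chart_target E x
  have h1 : (fun y ↦ (trivializationAt (E →L[ℝ] E →L[ℝ] ℝ)
      (fun x : M ↦ TangentSpace 𝓘(ℝ, E) x →L[ℝ] TangentSpace 𝓘(ℝ, E) x →L[ℝ] ℝ) x ⟨y, σ y⟩).2)
      =ᶠ[𝓝 x] fun y ↦ pullForm E σ (chartAt E x).symm (chartAt E x y) := by
    filter_upwards [(chartAt E x).open_source.mem_nhds hx] with y hy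
    exact trivializationAt_form_apply σ hy
  rw [Bundle.contMDiffAt_section]
  constructor
  · intro h
    have h2 : SmoothAt E (E →L[ℝ] E →L[ℝ] ℝ)
        (fun y ↦ pullForm E σ (chartAt E x).symm (chartAt E x y)) x :=
      ContMDiffAt.congr_of_eventuallyEq h h1.symm
    have h3 := h2.comp_of_eq (smoothAt_chartAt_symm hxt) ((chartAt E x).left_inv hx)
    refine smoothAt_iff_contDiffAt.1 (h3.congr ?_)
    filter_upwards [(chartAt E x).open_target.mem_nhds hxt] with z hz
    rw [(chartAt E x).right_inv hz]
  · intro h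
    have h2 : SmoothAt E (E →L[ℝ] E →L[ℝ] ℝ)
        (fun y ↦ pullForm E σ (chartAt E x).symm (chartAt E x y)) x :=
      (smoothAt_iff_contDiffAt.2 h).comp (smoothAt_chartAt hx)
    exact ContMDiffAt.congr_of_eventuallyEq h2 h1

/-- The pull-back of a smooth form by a smooth map between a vector space and a manifold. -/
theorem contDiffAt_pullForm {σ : BilinField 𝓘(ℝ, E) M} {h : E₁ → M} {z : E₁}
    (hσ : ContDiffAt ℝ ∞ (pullForm E σ (chartAt E (h z)).symm) (chartAt E (h z) (h z)))
    (hh : ∀ᶠ w in 𝓝 z, SmoothAt E₁ E h w) : ContDiffAt ℝ ∞ (pullForm E₁ σ h) z := by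
  let φ := chartAt E (h z)
  have hsrc : ∀ᶠ w in 𝓝 z, h w ∈ φ.source :=
    hh.self_of_nhds.continuousAt.eventually_mem (φ.open_source.mem_nhds (mem_chart_source E _))
  have hφh : ∀ᶠ w in 𝓝 z, SmoothAt E₁ E (fun w ↦ φ (h w)) w := by
    filter_upwards [hh, hsrc] with w h1 h2 using (smoothAt_chartAt h2).comp h1
  -- Locally `h = φ.symm ∘ (φ ∘ h)`, so the pull-back is the chart expression of the form composed
  -- with the derivative of `φ ∘ h`.
  have h1 : ContDiffAt ℝ ∞ (fun w ↦ φ (h w)) z := smoothAt_iff_contDiffAt.1 hφh.self_of_nhds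
  have h1' : ContDiffAt ℝ ∞ (fun w ↦ pullForm E σ φ.symm (φ (h w))) z :=
    ContDiffAt.comp (g := pullForm E σ φ.symm) (f := fun w ↦ φ (h w)) z hσ h1
  have h1'' : ContDiffAt ℝ ∞ (fun w ↦ tderiv E₁ E (fun w ↦ φ (h w)) w) z := by
    simp_rw [tderiv_eq_fderiv]
    exact h1.fderiv_right (m := ∞) (by simp)
  have h2 := contDiffAt_bilinearComp h1' h1''
  refine h2.congr_of_eventuallyEq ?_
  filter_upwards [hh, hsrc, hφh, hsrc.eventually_nhds] with w hw1 hw2 hw3 hw4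
  have h3 : (fun w ↦ φ.symm (φ (h w))) =ᶠ[𝓝 w] h := by
    filter_upwards [hw4] with w' hw' using φ.left_inv hw'
  rw [← pullForm_congr h3]
  exact pullForm_comp (h := φ.symm) (smoothAt_chartAt_symm (φ.map_source hw2)) hw3

end Pullback

/-! ### The Lie derivative of bilinear forms on vector spaces. -/

section LieForm

variable {V : Type*} [NormedAddCommGroup V] [NormedSpace ℝ V]
  {W : Type*} [NormedAddCommGroup W] [NormedSpace ℝ W]

/-- The Lie derivative of a field of bilinear forms on a vector space. -/
noncomputable def lieForm (B : V → V →L[ℝ] V →L[ℝ] ℝ) (X : V → V) (z u v : V) : ℝ :=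
  fderiv ℝ B z (X z) u v + B z (fderiv ℝ X z u) v + B z u (fderiv ℝ X z v)

theorem lieForm_congr {B B' : V → V →L[ℝ] V →L[ℝ] ℝ} {X : V → V} {z : V} (h : B =ᶠ[𝓝 z] B')
    (u v : V) : lieForm B X z u v = lieForm B' X z u v := by
  unfold lieForm
  rw [h.fderiv_eq, h.self_of_nhds]

theorem fderiv_bilin_apply {B : V → W →L[ℝ] W →L[ℝ] ℝ} {a b : V → W} {z : V}
    (hB : DifferentiableAt ℝ B z) (ha : DifferentiableAt ℝ a z) (hb : DifferentiableAt ℝ b z)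
    (w : V) :
    fderiv ℝ (fun y ↦ B y (a y) (b y)) z w
      = fderiv ℝ B z w (a z) (b z) + B z (fderiv ℝ a z w) (b z) + B z (a z) (fderiv ℝ b z w) := by
  rw [((hB.hasFDerivAt.clm_apply ha.hasFDerivAt).clm_apply hb.hasFDerivAt).fderiv]
  simp only [_root_.add_apply, ContinuousLinearMap.comp_apply, ContinuousLinearMap.flip_apply]
  ring

/-- Naturality of the Lie derivative with respect to related vector fields. -/
theorem lieForm_bilinearComp {B : W → W →L[ℝ] W →L[ℝ] ℝ} {f : V → W} {X : W → W} {X' : V → V}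
    {z : V} (hB : DifferentiableAt ℝ B (f z)) (hf : ContDiffAt ℝ ∞ f z)
    (hX : DifferentiableAt ℝ X (f z)) (hX' : DifferentiableAt ℝ X' z)
    (hrel : ∀ᶠ y in 𝓝 z, fderiv ℝ f y (X' y) = X (f y)) (u v : V) :
    lieForm (fun y ↦ (B (f y)).bilinearComp (fderiv ℝ f y) (fderiv ℝ f y)) X' z u v
      = lieForm B X (f z) (fderiv ℝ f z u) (fderiv ℝ f z v) := by
  have hfd : DifferentiableAt ℝ f z := hf.differentiableAt (by simp)
  have hdf : DifferentiableAt ℝ (fderiv ℝ f) z :=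
    (hf.fderiv_right (m := ∞) (by simp)).differentiableAt (by simp)
  have hBf : DifferentiableAt ℝ (fun y ↦ B (f y)) z := by
    exact DifferentiableAt.comp (g := B) z hB hfd
  have hBcomp : fderiv ℝ (fun y ↦ B (f y)) z = (fderiv ℝ B (f z)).comp (fderiv ℝ f z) :=
    fderiv_comp (g := B) z hB hfd
  have hdfu : ∀ u, DifferentiableAt ℝ (fun y ↦ fderiv ℝ f y u) z := fun u ↦
    hdf.clm_apply (differentiableAt_const u)
  have hddf : ∀ u w, fderiv ℝ (fun y ↦ fderiv ℝ f y u) z w = fderiv ℝ (fderiv ℝ f) z w u :=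
    fun u w ↦ by
      rw [fderiv_clm_apply hdf (differentiableAt_const u)]
      simp
  have hsymm : ∀ u w, fderiv ℝ (fderiv ℝ f) z u w = fderiv ℝ (fderiv ℝ f) z w u := fun u w ↦
    (hf.isSymmSndFDerivAt (by
      rw [minSmoothness_of_isRCLikeNormedField]
      exact WithTop.coe_le_coe.2 (le_top : (2 : ℕ∞) ≤ ⊤))).eq u w
  -- Differentiating the relation `df (X') = X ∘ f` produces a second derivative of `f`. It cancels
  -- the one coming from differentiating `B (df u, df v)`, by symmetry of the second derivative.
  have hX'u : ∀ u, fderiv ℝ f z (fderiv ℝ X' z u)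
      = fderiv ℝ X (f z) (fderiv ℝ f z u) - fderiv ℝ (fderiv ℝ f) z u (X' z) := fun u ↦ by
    have h1 := DFunLike.congr_fun (Filter.EventuallyEq.fderiv_eq (𝕜 := ℝ) hrel) u
    rw [fderiv_clm_apply hdf hX', fderiv_fun_comp z hX hfd] at h1
    simp only [_root_.add_apply, ContinuousLinearMap.comp_apply,
      ContinuousLinearMap.flip_apply] at h1
    rw [← h1]
    abel
  have hB' : DifferentiableAt ℝ
      (fun y ↦ (B (f y)).bilinearComp (fderiv ℝ f y) (fderiv ℝ f y)) z := by
    have h1 : ∀ y, (B (f y)).bilinearComp (fderiv ℝ f y) (fderiv ℝ f y)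
      = ((ContinuousLinearMap.compL ℝ V W ℝ).flip (fderiv ℝ f y)).comp
        ((B (f y)).comp (fderiv ℝ f y)) := fun y ↦ by ext u v; rfl
    simp_rw [h1]
    exact (((ContinuousLinearMap.compL ℝ V W ℝ).flip.differentiableAt).comp z hdf).clm_comp
      (hBf.clm_comp hdf)
  have hdB' : fderiv ℝ (fun y ↦ (B (f y)).bilinearComp (fderiv ℝ f y) (fderiv ℝ f y)) z (X' z) u v
      = fderiv ℝ (fun y ↦ B (f y) (fderiv ℝ f y u) (fderiv ℝ f y v)) z (X' z) := by
    have h1 := fderiv_bilin_apply hB' (differentiableAt_const u) (differentiableAt_const v) (X' z)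
    simp only [ContinuousLinearMap.bilinearComp_apply] at h1
    rw [h1]
    simp
  unfold lieForm
  rw [hdB', fderiv_bilin_apply hBf (hdfu u) (hdfu v), hddf, hddf, hBcomp]
  simp only [ContinuousLinearMap.bilinearComp_apply, ContinuousLinearMap.comp_apply, hX'u,
    hrel.self_of_nhds, map_sub, _root_.sub_apply, hsymm (X' z)]
  ring

end LieForm

/-! ### Vector fields, brackets and Lie derivatives in charts. -/

section VectorFields

variable {E : Type*} [NormedAddCommGroup E] [NormedSpace ℝ E]
  {M : Type*} [TopologicalSpace M] [ChartedSpace E M]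

/-- The value of a vector field at a point, as an element of the model space. -/
def vect (X : VectField 𝓘(ℝ, E) M) (x : M) : E := X x

/-- The representative of a vector field in the chart at `x`. -/
noncomputable def vectRep (X : VectField 𝓘(ℝ, E) M) (x : M) (z : E) : E :=
  tderiv E E (chartAt E x) ((chartAt E x).symm z) (vect X ((chartAt E x).symm z))

variable [IsManifold 𝓘(ℝ, E) ∞ M]

theorem tderiv_chartAt_symm_comp {x : M} {z : E} (hz : z ∈ (chartAt E x).target) :
    (tderiv E E (chartAt E x) ((chartAt E x).symm z)).comp (tderiv E E (chartAt E x).symm z)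
      = ContinuousLinearMap.id ℝ E :=
  tderiv_comp_symm (Φ := chartDiffeo (chartAt E x) (IsManifold.chart_mem_maximalAtlas x)) hz

theorem tderiv_chartAt_comp_symm {x : M} {z : E} (hz : z ∈ (chartAt E x).target) :
    (tderiv E E (chartAt E x).symm z).comp (tderiv E E (chartAt E x) ((chartAt E x).symm z))
      = ContinuousLinearMap.id ℝ E := by
  have h1 := tderiv_symm_comp
    (Φ := chartDiffeo (chartAt E x) (IsManifold.chart_mem_maximalAtlas x))
    ((chartAt E x).map_target hz)
  have h2 : (chartAt E x) ((chartAt E x).symm z) = z := (chartAt E x).right_inv hz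
  change (tderiv E E (chartAt E x).symm ((chartAt E x) ((chartAt E x).symm z))).comp _ = _ at h1
  rwa [h2] at h1

theorem tderiv_symm_vectRep (X : VectField 𝓘(ℝ, E) M) {x : M} {z : E}
    (hz : z ∈ (chartAt E x).target) :
    tderiv E E (chartAt E x).symm z (vectRep X x z) = vect X ((chartAt E x).symm z) :=
  DFunLike.congr_fun (tderiv_chartAt_comp_symm hz) _

theorem vectRep_self (X : VectField 𝓘(ℝ, E) M) (x : M) :
    vectRep X x (chartAt E x x) = vect X x := by
  unfold vectRep
  rw [(chartAt E x).left_inv (mem_chart_source E x), tderiv_chartAt_self]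
  rfl

/-- Smoothness of a vector field, read in a chart. -/
theorem contMDiffAt_vect_iff (X : VectField 𝓘(ℝ, E) M) (x : M) :
    ContMDiffAt 𝓘(ℝ, E) 𝓘(ℝ, E).tangent ∞ (fun y ↦ (⟨y, X y⟩ : TangentBundle 𝓘(ℝ, E) M)) x
      ↔ ContDiffAt ℝ ∞ (vectRep X x) (chartAt E x x) := by
  have hx := mem_chart_source E x
  have hxt := mem_chart_target E x
  have h1 : (fun y ↦ (trivializationAt E (TangentSpace 𝓘(ℝ, E)) x ⟨y, X y⟩).2)
      =ᶠ[𝓝 x] fun y ↦ vectRep X x (chartAt E x y) := by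
    filter_upwards [(chartAt E x).open_source.mem_nhds hx] with y hy
    have h2 := DFunLike.congr_fun
      (TangentBundle.continuousLinearMapAt_trivializationAt (I := 𝓘(ℝ, E)) hy) (X y)
    have h3 : (chartAt E x).symm (chartAt E x y) = y := (chartAt E x).left_inv hy
    have hy' : y ∈ (trivializationAt E (TangentSpace 𝓘(ℝ, E) : M → Type _) x).baseSet := hy
    unfold vectRep
    rw [h3]
    refine Eq.trans ?_ h2
    rw [Bundle.Trivialization.continuousLinearMapAt_apply,
      Bundle.Trivialization.linearMapAt_apply, if_pos hy']
  have h0 := Bundle.contMDiffAt_section (IB := 𝓘(ℝ, E)) (n := ∞) (F := E)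
    (E := (TangentSpace 𝓘(ℝ, E) : M → Type _)) (s := X) x
  refine h0.trans ?_
  constructor
  · intro h
    have h2 : SmoothAt E E (fun y ↦ vectRep X x (chartAt E x y)) x :=
      ContMDiffAt.congr_of_eventuallyEq h h1.symm
    have h3 := h2.comp_of_eq (smoothAt_chartAt_symm hxt) ((chartAt E x).left_inv hx)
    refine smoothAt_iff_contDiffAt.1 (h3.congr ?_)
    filter_upwards [(chartAt E x).open_target.mem_nhds hxt] with z hz
    rw [(chartAt E x).right_inv hz]
  · intro h
    have h2 : SmoothAt E E (fun y ↦ vectRep X x (chartAt E x y)) x :=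
      (smoothAt_iff_contDiffAt.2 h).comp (smoothAt_chartAt hx)
    exact ContMDiffAt.congr_of_eventuallyEq h2 h1

/-- The manifold bracket is the vector-space bracket of the pull-backs by the inverse chart, carried
back by the derivative of the chart, which is the identity at the base point. -/
theorem mlieBracket_eq (X Y : VectField 𝓘(ℝ, E) M) (x : M) :
    (VectorField.mlieBracket 𝓘(ℝ, E) X Y x : E)
      = fderiv ℝ (vectRep Y x) (chartAt E x x) (vect X x)
        - fderiv ℝ (vectRep X x) (chartAt E x x) (vect Y x) := by
  have h1 : ∀ X : VectField 𝓘(ℝ, E) M,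
      (VectorField.mpullbackWithin 𝓘(ℝ, E) 𝓘(ℝ, E) (extChartAt 𝓘(ℝ, E) x).symm X
        (range 𝓘(ℝ, E)) : E → E) =ᶠ[𝓝 (chartAt E x x)] vectRep X x := fun X ↦ by
    filter_upwards [(chartAt E x).open_target.mem_nhds (mem_chart_target E x)] with z hz
    change (mfderivWithin 𝓘(ℝ, E) 𝓘(ℝ, E) (extChartAt 𝓘(ℝ, E) x).symm (range 𝓘(ℝ, E)) z).inverse
      (X ((chartAt E x).symm z)) = _
    rw [ModelWithCorners.range_eq_univ, mfderivWithin_univ]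
    change ContinuousLinearMap.inverse (tderiv E E (chartAt E x).symm z)
      (vect X ((chartAt E x).symm z)) = _
    rw [ContinuousLinearMap.inverse_eq (tderiv_chartAt_comp_symm hz)
      (tderiv_chartAt_symm_comp hz)]
    rfl
  have h2 : tderiv E E (extChartAt 𝓘(ℝ, E) x) x = ContinuousLinearMap.id ℝ E :=
    mfderiv_extChartAt_self
  have h3 : (extChartAt 𝓘(ℝ, E) x).symm ⁻¹' univ ∩ range 𝓘(ℝ, E) = univ := by
    rw [preimage_univ, ModelWithCorners.range_eq_univ, univ_inter]
  have h4 : ∀ (V W V' W' : E → E) (z : E), V =ᶠ[𝓝 z] V' → W =ᶠ[𝓝 z] W' →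
      VectorField.lieBracketWithin ℝ V W univ z
        = fderiv ℝ W' z (V' z) - fderiv ℝ V' z (W' z) := fun V W V' W' z hV hW ↦ by
    rw [VectorField.lieBracketWithin_univ, VectorField.lieBracket, hV.fderiv_eq, hW.fderiv_eq,
      hV.self_of_nhds, hW.self_of_nhds]
  change ContinuousLinearMap.inverse (tderiv E E (extChartAt 𝓘(ℝ, E) x) x)
    (VectorField.lieBracketWithin ℝ _ _ _ (chartAt E x x)) = _
  rw [h2, h3, ContinuousLinearMap.inverse_id]
  refine (h4 _ _ _ _ _ (h1 X) (h1 Y)).trans ?_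
  rw [vectRep_self, vectRep_self]

/-- The representative of a field of bilinear forms in the chart at `x`. -/
noncomputable def formRep (σ : BilinField 𝓘(ℝ, E) M) (x : M) (z : E) : E →L[ℝ] E →L[ℝ] ℝ :=
  pullForm E σ (chartAt E x).symm z

theorem formRep_vectRep (σ : BilinField 𝓘(ℝ, E) M) (Y Z : VectField 𝓘(ℝ, E) M) {x : M} {z : E}
    (hz : z ∈ (chartAt E x).target) :
    formRep σ x z (vectRep Y x z) (vectRep Z x z)
      = form σ ((chartAt E x).symm z) (vect Y ((chartAt E x).symm z))
        (vect Z ((chartAt E x).symm z)) := by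
  unfold formRep
  rw [pullForm_apply, tderiv_symm_vectRep Y hz, tderiv_symm_vectRep Z hz]

theorem formRep_self (σ : BilinField 𝓘(ℝ, E) M) (x : M) :
    formRep σ x (chartAt E x x) = form σ x := by
  have h1 := (chartAt E x).left_inv (mem_chart_source E x)
  ext u v
  unfold formRep
  rw [pullForm_apply, tderiv_chartAt_symm_self, h1]
  rfl

/-- In the Leibniz expansion of `X(σ(Y, Z))`, the derivatives of `Y` and `Z` cancel against those in
the brackets. What remains depends only on the values of `Y` and `Z` at `x`. -/
theorem lieDeriv_eq_lieForm {σ : BilinField 𝓘(ℝ, E) M} {X Y Z : VectField 𝓘(ℝ, E) M} {x : M}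
    (hσ : ContDiffAt ℝ ∞ (formRep σ x) (chartAt E x x))
    (hY : ContDiffAt ℝ ∞ (vectRep Y x) (chartAt E x x))
    (hZ : ContDiffAt ℝ ∞ (vectRep Z x) (chartAt E x x)) :
    lieDeriv 𝓘(ℝ, E) σ X Y Z x
      = lieForm (formRep σ x) (vectRep X x) (chartAt E x x) (vect Y x) (vect Z x) := by
  have hx := mem_chart_source E x
  let g : E → ℝ := fun z ↦ formRep σ x z (vectRep Y x z) (vectRep Z x z)
  have hg : ContDiffAt ℝ ∞ g (chartAt E x x) := (hσ.clm_apply hY).clm_apply hZ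
  have h1 : (fun y ↦ form σ y (vect Y y) (vect Z y)) =ᶠ[𝓝 x] fun y ↦ g (chartAt E x y) := by
    filter_upwards [(chartAt E x).open_source.mem_nhds hx] with y hy
    change _ = formRep σ x _ (vectRep Y x _) (vectRep Z x _)
    rw [formRep_vectRep σ Y Z ((chartAt E x).map_source hy), (chartAt E x).left_inv hy]
  have h2 : tderiv E ℝ (fun y ↦ form σ y (vect Y y) (vect Z y)) x
      = fderiv ℝ g (chartAt E x x) := by
    rw [tderiv_congr h1, tderiv_comp (smoothAt_iff_contDiffAt.2 hg) (smoothAt_chartAt hx),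
      tderiv_chartAt_self, tderiv_eq_fderiv]
    rfl
  have h3 : lieDeriv 𝓘(ℝ, E) σ X Y Z x
      = tderiv E ℝ (fun y ↦ form σ y (vect Y y) (vect Z y)) x (vect X x)
        - form σ x (fderiv ℝ (vectRep Y x) (chartAt E x x) (vect X x)
          - fderiv ℝ (vectRep X x) (chartAt E x x) (vect Y x)) (vect Z x)
        - form σ x (vect Y x) (fderiv ℝ (vectRep Z x) (chartAt E x x) (vect X x)
          - fderiv ℝ (vectRep X x) (chartAt E x x) (vect Z x)) := by
    rw [← mlieBracket_eq, ← mlieBracket_eq]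
    rfl
  rw [h3, h2, fderiv_bilin_apply (hσ.differentiableAt (by simp)) (hY.differentiableAt (by simp))
    (hZ.differentiableAt (by simp))]
  unfold lieForm
  simp only [vectRep_self, formRep_self, map_sub, _root_.sub_apply]
  ring

theorem exists_contMDiffAt_vect (x : M) (u : E) :
    ∃ Y : VectField 𝓘(ℝ, E) M, ContMDiffAt 𝓘(ℝ, E) 𝓘(ℝ, E).tangent ∞
      (fun y ↦ (⟨y, Y y⟩ : TangentBundle 𝓘(ℝ, E) M)) x ∧ vect Y x = u := by
  let w : TangentSpace 𝓘(ℝ, E) x := u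
  exact ⟨FiberBundle.extend E w, FiberBundle.contMDiffAt_extend 𝓘(ℝ, E) E w,
    FiberBundle.extend_apply_self E w⟩

/-- Testing on locally smooth fields amounts to testing on vectors, because `lieForm` sees only the
values at `x` and every tangent vector extends to such a field. -/
theorem isSymmetry_iff {σ : BilinField 𝓘(ℝ, E) M} {X : VectField 𝓘(ℝ, E) M}
    (hσ : ∀ x, ContDiffAt ℝ ∞ (formRep σ x) (chartAt E x x)) :
    IsSymmetry 𝓘(ℝ, E) σ X ↔
      ∀ x u v, lieForm (formRep σ x) (vectRep X x) (chartAt E x x) u v = 0 := by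
  constructor
  · intro h x u v
    obtain ⟨Y, hY, rfl⟩ := exists_contMDiffAt_vect x u
    obtain ⟨Z, hZ, rfl⟩ := exists_contMDiffAt_vect x v
    rw [← lieDeriv_eq_lieForm (hσ x) ((contMDiffAt_vect_iff Y x).1 hY)
      ((contMDiffAt_vect_iff Z x).1 hZ)]
    exact h x Y Z hY hZ
  · intro h x Y Z hY hZ
    rw [lieDeriv_eq_lieForm (hσ x) ((contMDiffAt_vect_iff Y x).1 hY)
      ((contMDiffAt_vect_iff Z x).1 hZ)]
    exact h x _ _

theorem IsAlmostSymplectic.contDiffAt_formRep {σ : BilinField 𝓘(ℝ, E) M}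
    (hσ : IsAlmostSymplectic 𝓘(ℝ, E) σ) (x : M) :
    ContDiffAt ℝ ∞ (formRep σ x) (chartAt E x x) :=
  (contMDiffAt_form_iff σ x).1 (hσ.smooth x)

end VectorFields

/-! ### Smooth dependence of solutions of linear equations. -/

section Inverse

variable {E : Type*} [NormedAddCommGroup E] [NormedSpace ℝ E] [FiniteDimensional ℝ E]
  {V : Type*} [NormedAddCommGroup V] [NormedSpace ℝ V]

theorem exists_equiv_of_nondegenerate {B : E →L[ℝ] E →L[ℝ] ℝ}
    (hB : ∀ u, (∀ w, B u w = 0) → u = 0) : ∃ e : E ≃L[ℝ] (E →L[ℝ] ℝ), (e : E →L[ℝ] _) = B := by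
  have hinj : Function.Injective (B : E →ₗ[ℝ] (E →L[ℝ] ℝ)) := by
    rw [injective_iff_map_eq_zero]
    intro u hu
    refine hB u fun w ↦ ?_
    have hu' : B u = 0 := hu
    simp [hu']
  have hdim : Module.finrank ℝ E = Module.finrank ℝ (E →L[ℝ] ℝ) := by
    rw [← (LinearMap.toContinuousLinearMap (𝕜 := ℝ) (E := E) (F' := ℝ)).finrank_eq]
    exact (Subspace.dual_finrank_eq (K := ℝ) (V := E)).symm
  exact ⟨(LinearEquiv.ofInjectiveOfFinrankEq _ hinj hdim).toContinuousLinearEquiv, by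
    ext u w; rfl⟩

/-- Solutions of smooth families of invertible linear equations are smooth. -/
theorem contDiffAt_of_clm_apply_eq {E₁ : Type*} [NormedAddCommGroup E₁] [NormedSpace ℝ E₁]
    {A : V → E →L[ℝ] E₁} {b : V → E₁} {w : V → E} {z : V} (hA : ContDiffAt ℝ ∞ A z)
    (hb : ContDiffAt ℝ ∞ b z) (e : E ≃L[ℝ] E₁) (he : (e : E →L[ℝ] E₁) = A z)
    (hw : ∀ᶠ y in 𝓝 z, A y (w y) = b y) : ContDiffAt ℝ ∞ w z := by
  have h1 : ContDiffAt ℝ ∞ (fun y ↦ (A y).inverse) z := by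
    have h2 := contDiffAt_map_inverse (n := ∞) e
    rw [he] at h2
    exact ContDiffAt.comp (g := ContinuousLinearMap.inverse) z h2 hA
  refine (h1.clm_apply hb).congr_of_eventuallyEq ?_
  have h3 : ∀ᶠ y in 𝓝 z, A y ∈ range ((↑) : (E ≃L[ℝ] E₁) → E →L[ℝ] E₁) :=
    hA.continuousAt.eventually_mem (by rw [← he]; exact ContinuousLinearEquiv.nhds e)
  filter_upwards [hw, h3] with y hy ⟨e', he'⟩
  rw [← hy, ← he', ContinuousLinearMap.inverse_equiv]
  exact (e'.symm_apply_apply (w y)).symm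

/-- Composing with a fixed left inverse `T` of `A z` gives a square system whose operator is the
identity at `z`. -/
theorem contDiffAt_of_injective_clm_apply_eq {E₁ : Type*} [NormedAddCommGroup E₁]
    [NormedSpace ℝ E₁] [FiniteDimensional ℝ E₁] {A : V → E →L[ℝ] E₁} {b : V → E₁} {w : V → E}
    {z : V} (hA : ContDiffAt ℝ ∞ A z) (hb : ContDiffAt ℝ ∞ b z) (hinj : Function.Injective (A z))
    (hw : ∀ᶠ y in 𝓝 z, A y (w y) = b y) : ContDiffAt ℝ ∞ w z := by
  obtain ⟨L, hL⟩ := LinearMap.exists_leftInverse_of_injective (A z : E →ₗ[ℝ] E₁)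
    (LinearMap.ker_eq_bot.2 hinj)
  let T : E₁ →L[ℝ] E := LinearMap.toContinuousLinearMap L
  refine contDiffAt_of_clm_apply_eq (A := fun y ↦ T.comp (A y)) (b := fun y ↦ T (b y))
    (contDiffAt_const.clm_comp hA) (T.contDiff.contDiffAt.comp z hb)
    (ContinuousLinearEquiv.refl ℝ E) ?_ ?_
  · ext u
    exact (LinearMap.congr_fun hL u).symm
  · filter_upwards [hw] with y hy
    exact congrArg T hy

end Inverse

/-! ### Smoothness of Hamiltonian vector fields. -/

section Hamiltonian

variable {E : Type*} [NormedAddCommGroup E] [NormedSpace ℝ E] [FiniteDimensional ℝ E]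
  {M : Type*} [TopologicalSpace M] [ChartedSpace E M] [IsManifold 𝓘(ℝ, E) ∞ M]
  {σ : BilinField 𝓘(ℝ, E) M}

theorem form_hamVectField (hσ : IsAlmostSymplectic 𝓘(ℝ, E) σ) (f : M → ℝ) (x : M) (v : E) :
    form σ x (vect (hamVectField 𝓘(ℝ, E) σ f) x) v = -tderiv E ℝ f x v :=
  hasHamiltonian_hamVectField 𝓘(ℝ, E) hσ f x v

/-- In a chart, `X_f` solves a linear system with smooth coefficients `formRep σ x`, invertible by
non-degeneracy, and right-hand side `-df`. -/
theorem contDiffAt_vectRep_hamVectField (hσ : IsAlmostSymplectic 𝓘(ℝ, E) σ) {f : M → ℝ}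
    (hf : ∀ x, SmoothAt E ℝ f x) (x : M) :
    ContDiffAt ℝ ∞ (vectRep (hamVectField 𝓘(ℝ, E) σ f) x) (chartAt E x x) := by
  have hxt := mem_chart_target E x
  obtain ⟨e, he⟩ := exists_equiv_of_nondegenerate (B := formRep σ x (chartAt E x x)) (by
    rw [formRep_self]
    exact hσ.nondegenerate x)
  have hfr : ∀ z ∈ (chartAt E x).target, SmoothAt E ℝ (fun z ↦ f ((chartAt E x).symm z)) z :=
    fun z hz ↦ (hf _).comp (smoothAt_chartAt_symm hz)
  refine contDiffAt_of_clm_apply_eq (hσ.contDiffAt_formRep x)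
    (b := fun z ↦ -fderiv ℝ (fun z ↦ f ((chartAt E x).symm z)) z)
    ((smoothAt_iff_contDiffAt.1 (hfr _ hxt)).fderiv_right (m := ∞) (by simp)).neg e he ?_
  filter_upwards [(chartAt E x).open_target.mem_nhds hxt] with z hz
  ext v
  rw [← tderiv_eq_fderiv, tderiv_comp (hf _) (smoothAt_chartAt_symm hz)]
  unfold formRep
  rw [pullForm_apply, tderiv_symm_vectRep _ hz, form_hamVectField hσ]
  rfl

end Hamiltonian

/-! ### Related vector fields and the descent of symmetries. -/

section Related

variable {E : Type*} [NormedAddCommGroup E] [NormedSpace ℝ E]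
  {M : Type*} [TopologicalSpace M] [ChartedSpace E M] [IsManifold 𝓘(ℝ, E) ∞ M]
  {K : Type*} [NormedAddCommGroup K] [NormedSpace ℝ K]
  {N : Type*} [TopologicalSpace N] [ChartedSpace K N] [IsManifold 𝓘(ℝ, K) ∞ N]

/-- The representative of a map in the charts at `x` and `i x`. -/
noncomputable def mapRep (K E : Type*) [NormedAddCommGroup K] [NormedAddCommGroup E]
    {N : Type*} [TopologicalSpace N] [ChartedSpace K N]
    {M : Type*} [TopologicalSpace M] [ChartedSpace E M] (i : N → M) (x : N) (z : K) : E :=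
  chartAt E (i x) (i ((chartAt K x).symm z))

variable {i : N → M}

theorem mapRep_self (x : N) : mapRep K E i x (chartAt K x x) = chartAt E (i x) (i x) := by
  unfold mapRep
  rw [(chartAt K x).left_inv (mem_chart_source K x)]

theorem eventually_mem_source (hi : ∀ x, SmoothAt K E i x) (x : N) :
    ∀ᶠ z in 𝓝 (chartAt K x x), z ∈ (chartAt K x).target ∧
      i ((chartAt K x).symm z) ∈ (chartAt E (i x)).source := by
  have h1 : SmoothAt K E (fun z ↦ i ((chartAt K x).symm z)) (chartAt K x x) :=
    (hi _).comp (smoothAt_chartAt_symm (mem_chart_target K x))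
  refine Filter.Eventually.and ((chartAt K x).open_target.mem_nhds (mem_chart_target K x))
    (h1.continuousAt.eventually_mem ((chartAt E (i x)).open_source.mem_nhds ?_))
  rw [(chartAt K x).left_inv (mem_chart_source K x)]
  exact mem_chart_source E (i x)

theorem smoothAt_mapRep (hi : ∀ x, SmoothAt K E i x) {x : N} {z : K}
    (hz : z ∈ (chartAt K x).target) (hz' : i ((chartAt K x).symm z) ∈ (chartAt E (i x)).source) :
    SmoothAt K E (mapRep K E i x) z := by
  have h1 : SmoothAt K E (fun z ↦ i ((chartAt K x).symm z)) z :=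
    (hi _).comp (smoothAt_chartAt_symm hz)
  exact (smoothAt_chartAt hz').comp (f := fun z ↦ i ((chartAt K x).symm z)) h1

theorem contDiffAt_mapRep (hi : ∀ x, SmoothAt K E i x) (x : N) :
    ContDiffAt ℝ ∞ (mapRep K E i x) (chartAt K x x) := by
  obtain ⟨h1, h2⟩ := (eventually_mem_source hi x).self_of_nhds
  exact smoothAt_iff_contDiffAt.1 (smoothAt_mapRep hi h1 h2)

theorem fderiv_mapRep_self (hi : ∀ x, SmoothAt K E i x) (x : N) :
    fderiv ℝ (mapRep K E i x) (chartAt K x x) = tderiv K E i x :=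
  (hasFDerivAt_chart (hi x)).fderiv

theorem eventually_fderiv_mapRep_vectRep (hi : ∀ x, SmoothAt K E i x)
    {w : VectField 𝓘(ℝ, K) N} {X : VectField 𝓘(ℝ, E) M}
    (hw : ∀ n, tderiv K E i n (vect w n) = vect X (i n)) (x : N) :
    ∀ᶠ z in 𝓝 (chartAt K x x),
      fderiv ℝ (mapRep K E i x) z (vectRep w x z) = vectRep X (i x) (mapRep K E i x z) := by
  filter_upwards [eventually_mem_source hi x] with z ⟨hz, hz'⟩
  have h1 : SmoothAt K E (fun z ↦ i ((chartAt K x).symm z)) z :=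
    (hi _).comp (smoothAt_chartAt_symm hz)
  have h2 := tderiv_comp (f := fun z ↦ i ((chartAt K x).symm z)) (smoothAt_chartAt hz') h1
  rw [tderiv_comp (hi _) (smoothAt_chartAt_symm hz)] at h2
  have h3 : (chartAt E (i x)).symm (mapRep K E i x z) = i ((chartAt K x).symm z) :=
    (chartAt E (i x)).left_inv hz'
  rw [← tderiv_eq_fderiv]
  unfold vectRep
  rw [h3, ← hw]
  refine (DFunLike.congr_fun h2 _).trans ?_
  exact congrArg _ (congrArg _ (tderiv_symm_vectRep w hz))

theorem eventually_pullForm_eq (hi : ∀ x, SmoothAt K E i x) (σ : BilinField 𝓘(ℝ, E) M) (x : N) :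
    pullForm K σ (fun z ↦ i ((chartAt K x).symm z)) =ᶠ[𝓝 (chartAt K x x)]
      fun z ↦ (formRep σ (i x) (mapRep K E i x z)).bilinearComp
        (fderiv ℝ (mapRep K E i x) z) (fderiv ℝ (mapRep K E i x) z) := by
  filter_upwards [eventually_mem_source hi x, (eventually_mem_source hi x).eventually_nhds]
    with z ⟨hz, hz'⟩ hzn
  have h1 : (fun z ↦ (chartAt E (i x)).symm (mapRep K E i x z)) =ᶠ[𝓝 z]
      fun z ↦ i ((chartAt K x).symm z) := by
    filter_upwards [hzn] with y hy using (chartAt E (i x)).left_inv hy.2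
  rw [← pullForm_congr h1]
  have h2 : pullForm K σ (fun z ↦ (chartAt E (i x)).symm (mapRep K E i x z)) z
      = (formRep σ (i x) (mapRep K E i x z)).bilinearComp
        (tderiv K E (mapRep K E i x) z) (tderiv K E (mapRep K E i x) z) :=
    pullForm_comp (h := (chartAt E (i x)).symm)
      (smoothAt_chartAt_symm ((chartAt E (i x)).map_source hz')) (smoothAt_mapRep hi hz hz')
  rwa [tderiv_eq_fderiv] at h2

/-- Naturality of the Lie derivative, transported to the charts at `x` and `i x`. In the descent of
symmetries it is applied to both the inclusion and the projection. -/
theorem lieForm_pullForm (hi : ∀ x, SmoothAt K E i x) {σ : BilinField 𝓘(ℝ, E) M} {x : N}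
    (hσ : ContDiffAt ℝ ∞ (formRep σ (i x)) (chartAt E (i x) (i x)))
    {w : VectField 𝓘(ℝ, K) N} {X : VectField 𝓘(ℝ, E) M}
    (hw : ∀ n, tderiv K E i n (vect w n) = vect X (i n))
    (hX : ContDiffAt ℝ ∞ (vectRep X (i x)) (chartAt E (i x) (i x)))
    (hwd : ContDiffAt ℝ ∞ (vectRep w x) (chartAt K x x)) (u v : K) :
    lieForm (pullForm K σ (fun z ↦ i ((chartAt K x).symm z))) (vectRep w x) (chartAt K x x) u v
      = lieForm (formRep σ (i x)) (vectRep X (i x)) (chartAt E (i x) (i x))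
        (tderiv K E i x u) (tderiv K E i x v) := by
  rw [lieForm_congr (eventually_pullForm_eq hi σ x), ← fderiv_mapRep_self hi,
    ← mapRep_self (K := K) (i := i)]
  refine lieForm_bilinearComp ?_ (contDiffAt_mapRep hi x) ?_ (hwd.differentiableAt (by simp))
    (eventually_fderiv_mapRep_vectRep hi hw x) u v
  · rw [mapRep_self]
    exact hσ.differentiableAt (by simp)
  · rw [mapRep_self]
    exact hX.differentiableAt (by simp)

/-- Symmetries descend along submersions and restrict to immersed submanifolds. -/
theorem IsSymmetry.of_related [FiniteDimensional ℝ E] [FiniteDimensional ℝ K]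
    {S : Type*} [NormedAddCommGroup S] [NormedSpace ℝ S]
    {Q : Type*} [TopologicalSpace Q] [ChartedSpace S Q] [IsManifold 𝓘(ℝ, S) ∞ Q]
    {p : N → Q} (hi : ∀ x, SmoothAt K E i x) (hinj : ∀ x, Function.Injective (tderiv K E i x))
    (hp : ∀ x, SmoothAt K S p x) (hsurj : ∀ x, Function.Surjective (tderiv K S p x))
    (hpsurj : Function.Surjective p)
    {σ : BilinField 𝓘(ℝ, E) M} {τ : BilinField 𝓘(ℝ, S) Q}
    (hσ : ∀ x, ContDiffAt ℝ ∞ (formRep σ x) (chartAt E x x))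
    (hτ : ∀ y, ContDiffAt ℝ ∞ (formRep τ y) (chartAt S y y))
    (hστ : ∀ x, pullForm K σ i x = pullForm K τ p x)
    {X : VectField 𝓘(ℝ, E) M} {Y : VectField 𝓘(ℝ, S) Q}
    (hX : ∀ x, ContDiffAt ℝ ∞ (vectRep X x) (chartAt E x x))
    (hY : ∀ y, ContDiffAt ℝ ∞ (vectRep Y y) (chartAt S y y))
    (hXY : ∀ x, ∃ v, tderiv K E i x v = vect X (i x) ∧ tderiv K S p x v = vect Y (p x))
    (h : IsSymmetry 𝓘(ℝ, E) σ X) : IsSymmetry 𝓘(ℝ, S) τ Y := by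
  rw [isSymmetry_iff hσ] at h
  rw [isSymmetry_iff hτ]
  intro y u' v'
  obtain ⟨x, rfl⟩ := hpsurj y
  obtain ⟨u, rfl⟩ := hsurj x u'
  obtain ⟨v, rfl⟩ := hsurj x v'
  choose w₀ hw₁ hw₂ using hXY
  let w : VectField 𝓘(ℝ, K) N := w₀
  -- The lift `w` is chosen pointwise; it is smooth because it solves `di w = X ∘ i` with `di`
  -- injective.
  have hwd : ContDiffAt ℝ ∞ (vectRep w x) (chartAt K x x) := by
    refine contDiffAt_of_injective_clm_apply_eq
      ((contDiffAt_mapRep hi x).fderiv_right (m := ∞) (by simp))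
      (b := fun z ↦ vectRep X (i x) (mapRep K E i x z)) ?_ ?_
      (eventually_fderiv_mapRep_vectRep hi hw₁ x)
    · refine ContDiffAt.comp (g := vectRep X (i x)) _ ?_ (contDiffAt_mapRep hi x)
      rw [mapRep_self]
      exact hX (i x)
    · rw [fderiv_mapRep_self hi]
      exact hinj x
  have hpull : pullForm K σ (fun z ↦ i ((chartAt K x).symm z)) =ᶠ[𝓝 (chartAt K x x)]
      pullForm K τ (fun z ↦ p ((chartAt K x).symm z)) := by
    filter_upwards [(chartAt K x).open_target.mem_nhds (mem_chart_target K x)] with z hz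
    rw [pullForm_comp (hi _) (smoothAt_chartAt_symm hz),
      pullForm_comp (hp _) (smoothAt_chartAt_symm hz), hστ]
  -- The chain is `(L_Y τ)(dp u, dp v) = (L_w p^*τ)(u, v) = (L_w i^*σ)(u, v) = (L_X σ)(di u, di v)`.
  rw [← lieForm_pullForm hp (hτ (p x)) hw₂ (hY (p x)) hwd, ← lieForm_congr hpull,
    lieForm_pullForm hi (hσ (i x)) hw₁ (hX (i x)) hwd]
  exact h _ _ _

end Related

/-! ### The reduced almost-symplectic form. -/

section ReducedForm

variable {F : Type*} [NormedAddCommGroup F] [NormedSpace ℝ F] [FiniteDimensional ℝ F]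
  {G : Type*} [TopologicalSpace G] [ChartedSpace F G] [Group G] [LieGroup 𝓘(ℝ, F) ∞ G]
  {E : Type*} [NormedAddCommGroup E] [NormedSpace ℝ E] [FiniteDimensional ℝ E]
  {M : Type*} [TopologicalSpace M] [ChartedSpace E M] [IsManifold 𝓘(ℝ, E) ∞ M]
  [MulAction G M] [ContMDiffSMul 𝓘(ℝ, F) 𝓘(ℝ, E) ∞ G M]
  {σ : BilinField 𝓘(ℝ, E) M} {J : M → DualLieAlg F} {c : DualLieAlg F}
  {hJ : IsEquivariant G J}
  {K : Type*} [NormedAddCommGroup K] [NormedSpace ℝ K] [FiniteDimensional ℝ K]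
  [ChartedSpace K (LevelSet J c)] [IsManifold 𝓘(ℝ, K) ∞ (LevelSet J c)]
  {S : Type*} [NormedAddCommGroup S] [NormedSpace ℝ S] [FiniteDimensional ℝ S]
  [ChartedSpace S (ReducedSpace hJ c)] [IsManifold 𝓘(ℝ, S) ∞ (ReducedSpace hJ c)]

theorem IsAlmostSymplectic.form_swap (hσ : IsAlmostSymplectic 𝓘(ℝ, E) σ) (x : M) (u v : E) :
    form σ x u v = -form σ x v u := by
  have h : ∀ w : E, form σ x w w = 0 := hσ.alternating x
  have h1 := h (u + v)
  simp only [map_add, _root_.add_apply, h] at h1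
  linarith

theorem tderiv_momentumMap_levelIncl
    (hi : Manifold.IsSmoothEmbedding 𝓘(ℝ, K) 𝓘(ℝ, E) ∞ (levelIncl J c))
    (hs : ∀ x, SmoothAt E (DualLieAlg F) J x) (x : LevelSet J c) (v : K) :
    tderiv E (DualLieAlg F) J (x : M) (tderiv K E (levelIncl J c) x v) = 0 := by
  have h1 := tderiv_comp (hs _) (hi.contMDiff x : SmoothAt K E (levelIncl J c) x)
  have h2 : (fun y ↦ J (levelIncl J c y)) = fun _ ↦ c := funext fun y ↦ y.2
  rw [h2, tderiv_const] at h1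
  exact (DFunLike.congr_fun h1 v).symm

theorem form_infGen_levelIncl
    (hi : Manifold.IsSmoothEmbedding 𝓘(ℝ, K) 𝓘(ℝ, E) ∞ (levelIncl J c))
    (hmom : IsMomentumMap G σ J) (x : LevelSet J c) (ξ : F) (v : K) :
    form σ (x : M) (infGen G E M ξ (x : M)) (tderiv K E (levelIncl J c) x v) = 0 := by
  have h1 := tderiv_momentumMap_apply hmom.smooth hmom (x : M)
    (tderiv K E (levelIncl J c) x v) ξ
  rw [tderiv_momentumMap_levelIncl hi hmom.smooth] at h1
  exact neg_eq_zero.1 h1.symm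

/-- The symplectic orthogonal of the kernel of `dJ` is tangent to the orbit. -/
theorem exists_eq_infGen (hσ : IsAlmostSymplectic 𝓘(ℝ, E) σ) (hmom : IsMomentumMap G σ J) {x : M}
    (hreg : Function.Surjective (tderiv E (DualLieAlg F) J x)) {w : E}
    (hw : ∀ v, tderiv E (DualLieAlg F) J x v = 0 → form σ x w v = 0) :
    ∃ ξ : F, w = infGen G E M ξ x := by
  obtain ⟨s, hs⟩ := LinearMap.exists_rightInverse_of_surjective
    (tderiv E (DualLieAlg F) J x : E →ₗ[ℝ] DualLieAlg F) (LinearMap.range_eq_top.2 hreg)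
  have hs' : ∀ ℓ, tderiv E (DualLieAlg F) J x (s ℓ) = ℓ := fun ℓ ↦ LinearMap.congr_fun hs ℓ
  -- The functional `σ(w, ·)` vanishes on `ker dJ`, so it factors through `dJ` as an element `μ` of
  -- the bidual, and `μ` is evaluation at some `ξ`. The sign in `dJ_ξ = -σ(Y_ξ, ·)` makes `-ξ` the
  -- generator sought.
  let μ : Module.Dual ℝ (Module.Dual ℝ F) :=
    (form σ x w : E →ₗ[ℝ] ℝ) ∘ₗ s ∘ₗ (LinearMap.toContinuousLinearMap (𝕜 := ℝ) (E := F)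
      (F' := ℝ)).toLinearMap
  obtain ⟨ξ, hξ⟩ := (Module.evalEquiv ℝ F).surjective μ
  have hμ : ∀ ℓ : F →L[ℝ] ℝ, form σ x w (s ℓ) = ℓ ξ := fun ℓ ↦ by
    have h1 := LinearMap.congr_fun hξ (ℓ : F →ₗ[ℝ] ℝ)
    exact h1.symm
  let Y : E := infGen G E M (-ξ) x
  have h2 : ∀ v : E, form σ x (w - Y) v = 0 := fun v ↦ by
    have h3 : form σ x w v = tderiv E (DualLieAlg F) J x v ξ := by
      rw [← hμ, ← sub_eq_zero, ← map_sub]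
      exact hw _ (by rw [map_sub, hs', sub_self])
    have h4 : tderiv E (DualLieAlg F) J x v (-ξ) = -form σ x Y v :=
      tderiv_momentumMap_apply hmom.smooth hmom x v (-ξ)
    rw [map_neg] at h4
    rw [map_sub, _root_.sub_apply]
    linarith
  exact ⟨-ξ, sub_eq_zero.1 (hσ.nondegenerate x _ h2)⟩

/-- This is the well-definedness of the reduced form. An isotropy element moves `y` to `x` and
preserves `σ`; two tangent vectors at `x` with the same projection then differ by a generator `Y_ξ`,
which is `σ`-orthogonal to the level set. -/
theorem form_levelIncl_eq_of_redProj_eq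
    (hi : Manifold.IsSmoothEmbedding 𝓘(ℝ, K) 𝓘(ℝ, E) ∞ (levelIncl J c))
    (hp : Manifold.IsSubmersion 𝓘(ℝ, K) 𝓘(ℝ, S) ∞ (redProj hJ c))
    (hσ : IsAlmostSymplectic 𝓘(ℝ, E) σ) (has : IsAlmostSymplecticAction G σ)
    (hmom : IsMomentumMap G σ J) (hreg : IsRegularValue E J c)
    (hfree : ActsFreely hJ c) (hproper : ActsProperly hJ c)
    {x y : LevelSet J c} (hxy : redProj hJ c x = redProj hJ c y) {u v u' v' : K}
    (hu : tderiv K S (redProj hJ c) x u = tderiv K S (redProj hJ c) y u')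
    (hv : tderiv K S (redProj hJ c) x v = tderiv K S (redProj hJ c) y v') :
    pullForm K σ (levelIncl J c) x u v = pullForm K σ (levelIncl J c) y u' v' := by
  have his : ∀ y, SmoothAt K E (levelIncl J c) y := hi.contMDiff
  have hps : ∀ y, SmoothAt K S (redProj hJ c) y := hp.contMDiff
  obtain ⟨g, hg, hgy⟩ := redProj_eq_iff.1 hxy
  have hx : levelSmul hJ hg y = x := Subtype.ext hgy
  subst hx
  let h := levelSmul hJ hg
  have hh : SmoothAt K K h y := smoothAt_levelSmul hi hJ hg y
  have hgs : SmoothAt E E (fun z : M ↦ g • z) (y : M) := smoothAt_const_smul F g _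
  -- the form is invariant
  have h1 : ∀ u v, pullForm K σ (levelIncl J c) (h y) (tderiv K K h y u) (tderiv K K h y v)
      = pullForm K σ (levelIncl J c) y u v := fun u v ↦ by
    have h2 : (tderiv K E (levelIncl J c) (h y)).comp (tderiv K K h y)
        = (tderiv E E (fun z : M ↦ g • z) (y : M)).comp (tderiv K E (levelIncl J c) y) := by
      exact (tderiv_comp (his _) hh).symm.trans (tderiv_comp (f := levelIncl J c) hgs (his y))
    have h3 : ∀ u, tderiv K E (levelIncl J c) (h y) (tderiv K K h y u)
        = tderiv E E (fun z : M ↦ g • z) (y : M) (tderiv K E (levelIncl J c) y u) :=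
      fun u ↦ DFunLike.congr_fun h2 u
    rw [pullForm_apply, h3, h3]
    exact has g (y : M) _ _
  -- the kernel of the projection is in the radical
  have h4 : ∀ k, tderiv K S (redProj hJ c) (h y) k = 0 → ∀ v,
      pullForm K σ (levelIncl J c) (h y) k v = 0 := fun k hk v ↦ by
    obtain ⟨ξ, -, hξ⟩ := (tderiv_redProj_eq_zero_iff hi hp hmom hreg hfree hproper _ k).1 hk
    rw [pullForm_apply, hξ]
    exact form_infGen_levelIncl hi hmom _ ξ v
  have h5 : ∀ u, tderiv K S (redProj hJ c) (h y) (tderiv K K h y u)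
      = tderiv K S (redProj hJ c) y u := fun u ↦ by
    have h6 := tderiv_comp (hps _) hh
    rw [show (fun z ↦ redProj hJ c (h z)) = redProj hJ c from
      funext fun z ↦ redProj_levelSmul hg z] at h6
    exact (DFunLike.congr_fun h6 u).symm
  have h7 : ∀ u u', tderiv K S (redProj hJ c) (h y) u = tderiv K S (redProj hJ c) y u' → ∀ v,
      pullForm K σ (levelIncl J c) (h y) u v
        = pullForm K σ (levelIncl J c) (h y) (tderiv K K h y u') v := fun u u' huu v ↦ by
    rw [← sub_eq_zero, ← _root_.sub_apply, ← map_sub]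
    exact h4 _ (by rw [map_sub, h5, huu, sub_self]) v
  have h8 : ∀ u v, pullForm K σ (levelIncl J c) (h y) u v
      = -pullForm K σ (levelIncl J c) (h y) v u := fun u v ↦ hσ.form_swap _ _ _
  rw [h7 u u' hu, h8, h7 v v' hv, ← h8, h1]

/-- Arbitrary representatives of the orbits and arbitrary linear lifts suffice, as the value does
not depend on them. Smoothness is recovered afterwards from the pull-back identity. -/
theorem exists_reduced_form
    (hi : Manifold.IsSmoothEmbedding 𝓘(ℝ, K) 𝓘(ℝ, E) ∞ (levelIncl J c))
    (hp : Manifold.IsSubmersion 𝓘(ℝ, K) 𝓘(ℝ, S) ∞ (redProj hJ c))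
    (hσ : IsAlmostSymplectic 𝓘(ℝ, E) σ) (has : IsAlmostSymplecticAction G σ)
    (hmom : IsMomentumMap G σ J) (hreg : IsRegularValue E J c)
    (hfree : ActsFreely hJ c) (hproper : ActsProperly hJ c) :
    ∃ τ : BilinField 𝓘(ℝ, S) (ReducedSpace hJ c),
      ∀ x, pullForm K τ (redProj hJ c) x = pullForm K σ (levelIncl J c) x := by
  have hsurj := fun x ↦ tderiv_surjective_of_isSubmersionAt (hp.isSubmersionAt x)
  have hR : ∀ x, ∃ R : S →L[ℝ] K, ∀ w, tderiv K S (redProj hJ c) x (R w) = w := fun x ↦ by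
    obtain ⟨R, hR⟩ := LinearMap.exists_rightInverse_of_surjective
      (tderiv K S (redProj hJ c) x : K →ₗ[ℝ] S) (LinearMap.range_eq_top.2 (hsurj x))
    exact ⟨LinearMap.toContinuousLinearMap R, fun w ↦ LinearMap.congr_fun hR w⟩
  choose R hR using hR
  let r := Function.surjInv (surjective_redProj hJ c)
  have hr : ∀ y, redProj hJ c (r y) = y := Function.surjInv_eq (surjective_redProj hJ c)
  let τ₀ : ReducedSpace hJ c → S →L[ℝ] S →L[ℝ] ℝ := fun y ↦
    (pullForm K σ (levelIncl J c) (r y)).bilinearComp (R (r y)) (R (r y))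
  refine ⟨τ₀, fun x ↦ ?_⟩
  ext u v
  refine form_levelIncl_eq_of_redProj_eq hi hp hσ has hmom hreg hfree hproper
    (hr (redProj hJ c x)) (hR _ _) (hR _ _)

/-- If `dp v` is in the radical of `τ`, the image of `v` in `M` is `σ`-orthogonal to `ker dJ`, hence
equals some `Y_ξ`. It is also tangent to the level set, so `ξ` lies in the isotropy algebra and `dp
v = 0`. Smoothness holds because `τ` is locally the pull-back of `σ` along `ι_c ∘ s` for a smooth
section `s`. -/
theorem isAlmostSymplectic_of_pullForm_eq
    (hi : Manifold.IsSmoothEmbedding 𝓘(ℝ, K) 𝓘(ℝ, E) ∞ (levelIncl J c))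
    (hp : Manifold.IsSubmersion 𝓘(ℝ, K) 𝓘(ℝ, S) ∞ (redProj hJ c))
    (hσ : IsAlmostSymplectic 𝓘(ℝ, E) σ)
    (hmom : IsMomentumMap G σ J) (hreg : IsRegularValue E J c)
    (hfree : ActsFreely hJ c) (hproper : ActsProperly hJ c)
    {τ : BilinField 𝓘(ℝ, S) (ReducedSpace hJ c)}
    (hτ : ∀ x, pullForm K τ (redProj hJ c) x = pullForm K σ (levelIncl J c) x) :
    IsAlmostSymplectic 𝓘(ℝ, S) τ := by
  have hs : ∀ x, SmoothAt E (DualLieAlg F) J x := hmom.smooth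
  have his : ∀ y, SmoothAt K E (levelIncl J c) y := hi.contMDiff
  have hps : ∀ y, SmoothAt K S (redProj hJ c) y := hp.contMDiff
  have hsurj := fun x ↦ tderiv_surjective_of_isSubmersionAt (hp.isSubmersionAt x)
  have hτ' : ∀ x u v, form τ (redProj hJ c x) (tderiv K S (redProj hJ c) x u)
      (tderiv K S (redProj hJ c) x v) = form σ (levelIncl J c x)
        (tderiv K E (levelIncl J c) x u) (tderiv K E (levelIncl J c) x v) := fun x u v ↦
    DFunLike.congr_fun (DFunLike.congr_fun (hτ x) u) v
  constructor
  · intro y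
    obtain ⟨x, rfl⟩ := surjective_redProj hJ c y
    change ∀ v : S, form τ (redProj hJ c x) v v = 0
    intro v
    obtain ⟨v, rfl⟩ := hsurj x v
    rw [hτ']
    exact hσ.alternating _ _
  · intro y
    obtain ⟨x, rfl⟩ := surjective_redProj hJ c y
    change ∀ v : S, (∀ w : S, form τ (redProj hJ c x) v w = 0) → v = 0
    intro v hv
    obtain ⟨v, rfl⟩ := hsurj x v
    obtain ⟨ξ, hξ⟩ := exists_eq_infGen hσ hmom (hreg x x.2) (w := tderiv K E (levelIncl J c) x v)
      fun w hw ↦ by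
        obtain ⟨w, rfl⟩ := exists_tderiv_subtypeVal_eq hi hs x (hreg x x.2) w hw
        exact (hτ' x v w).symm.trans (hv _)
    refine (tderiv_redProj_eq_zero_iff hi hp hmom hreg hfree hproper x v).2 ⟨ξ, ?_, hξ⟩
    rw [mem_isotropyAlg_iff hs hJ x.2, ← hξ]
    exact tderiv_momentumMap_levelIncl hi hs x v
  · intro y
    obtain ⟨x, rfl⟩ := surjective_redProj hJ c y
    refine (contMDiffAt_form_iff τ _).2 ?_
    obtain ⟨s, hsx, hss⟩ := exists_local_section (hp.isSubmersionAt x)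
    let κ := chartAt S (redProj hJ c x)
    have hy := mem_chart_source S (redProj hJ c x)
    have hκ : κ.symm (κ (redProj hJ c x)) = redProj hJ c x := κ.left_inv hy
    have hκs : ∀ z ∈ κ.target, SmoothAt S S κ.symm z := fun z hz ↦ smoothAt_chartAt_symm hz
    have hyt := mem_chart_target S (redProj hJ c x)
    have hev : ∀ᶠ z in 𝓝 (κ (redProj hJ c x)), z ∈ κ.target ∧
        SmoothAt S K s (κ.symm z) ∧ ∀ᶠ y in 𝓝 (κ.symm z), redProj hJ c (s y) = y := by
      have h1 := (hκs _ hyt).continuousAt.tendsto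
      rw [hκ] at h1
      refine Filter.Eventually.and (κ.open_target.mem_nhds hyt) ?_
      filter_upwards [h1.eventually hss, h1.eventually hss.eventually_nhds] with z h2 h3
      exact ⟨h2.1, h3.mono fun y hy ↦ hy.2⟩
    have hk : ∀ᶠ z in 𝓝 (κ (redProj hJ c x)), SmoothAt S K (fun z ↦ s (κ.symm z)) z := by
      filter_upwards [hev] with z hz using hz.2.1.comp (hκs z hz.1)
    have h1 : ContDiffAt ℝ ∞ (pullForm S σ fun z ↦ levelIncl J c (s (κ.symm z)))
        (κ (redProj hJ c x)) := by
      refine contDiffAt_pullForm (hσ.contDiffAt_formRep _) ?_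
      filter_upwards [hk] with z hz using (his _).comp hz
    refine h1.congr_of_eventuallyEq ?_
    filter_upwards [hev, hk] with z hz hz'
    have h2 : (fun z ↦ redProj hJ c (s (κ.symm z))) =ᶠ[𝓝 z] κ.symm :=
      (hκs z hz.1).continuousAt.eventually hz.2.2
    have h3 := pullForm_comp (σ := τ) (hps _) hz'
    rw [hτ, ← pullForm_comp (his _) hz', pullForm_congr h2] at h3
    exact h3

end ReducedForm

/-! ### Reduction of Hamiltonian vector fields. -/

section ReducedHamiltonian

variable {F : Type*} [NormedAddCommGroup F] [NormedSpace ℝ F] [FiniteDimensional ℝ F]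
  {G : Type*} [TopologicalSpace G] [ChartedSpace F G] [Group G] [LieGroup 𝓘(ℝ, F) ∞ G]
  {E : Type*} [NormedAddCommGroup E] [NormedSpace ℝ E] [FiniteDimensional ℝ E]
  {M : Type*} [TopologicalSpace M] [ChartedSpace E M] [IsManifold 𝓘(ℝ, E) ∞ M]
  [MulAction G M] [ContMDiffSMul 𝓘(ℝ, F) 𝓘(ℝ, E) ∞ G M]
  {σ : BilinField 𝓘(ℝ, E) M} {J : M → DualLieAlg F} {c : DualLieAlg F}
  {hJ : IsEquivariant G J}
  {K : Type*} [NormedAddCommGroup K] [NormedSpace ℝ K] [FiniteDimensional ℝ K]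
  [ChartedSpace K (LevelSet J c)] [IsManifold 𝓘(ℝ, K) ∞ (LevelSet J c)]
  {S : Type*} [NormedAddCommGroup S] [NormedSpace ℝ S] [FiniteDimensional ℝ S]
  [ChartedSpace S (ReducedSpace hJ c)] [IsManifold 𝓘(ℝ, S) ∞ (ReducedSpace hJ c)]

theorem smoothAt_redFun (hi : Manifold.IsSmoothEmbedding 𝓘(ℝ, K) 𝓘(ℝ, E) ∞ (levelIncl J c))
    (hp : Manifold.IsSubmersion 𝓘(ℝ, K) 𝓘(ℝ, S) ∞ (redProj hJ c))
    {f : M → ℝ} (hf : IsInvariantFun G f) (hfs : ∀ x, SmoothAt E ℝ f x) (y : ReducedSpace hJ c) :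
    SmoothAt S ℝ (redFun hJ c hf) y := by
  have his : ∀ y, SmoothAt K E (levelIncl J c) y := hi.contMDiff
  obtain ⟨x, rfl⟩ := surjective_redProj hJ c y
  have h1 : SmoothAt K ℝ (fun z ↦ f (levelIncl J c z)) x := (hfs _).comp (his x)
  exact smoothAt_of_comp_submersion (hp.isSubmersionAt x) (h := redFun hJ c hf) h1

theorem tderiv_infGen_of_invariant {f : M → ℝ} (hf : IsInvariantFun G f)
    (hfs : ∀ x, SmoothAt E ℝ f x) (x : M) (ξ : F) :
    tderiv E ℝ f x (infGen G E M ξ x) = 0 := by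
  have h1 := tderiv_comp_of_eq (hfs x) (smoothAt_orbit (F := F) (G := G) x 1) (one_smul G x)
  simp_rw [hf _ x] at h1
  rw [tderiv_const] at h1
  exact (DFunLike.congr_fun h1 ξ).symm

/-- Noether's theorem: `dJ_ξ(X_f) = σ(X_f, Y_ξ) = -df(Y_ξ) = 0` for invariant `f`. -/
theorem tderiv_momentumMap_hamVectField (hσ : IsAlmostSymplectic 𝓘(ℝ, E) σ)
    (hmom : IsMomentumMap G σ J) {f : M → ℝ} (hf : IsInvariantFun G f)
    (hfs : ∀ x, SmoothAt E ℝ f x) (x : M) :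
    tderiv E (DualLieAlg F) J x (vect (hamVectField 𝓘(ℝ, E) σ f) x) = 0 := by
  ext ξ
  have h1 := tderiv_infGen_of_invariant hf hfs x ξ
  have h2 := form_hamVectField hσ f x (infGen G E M ξ x)
  rw [h1, neg_zero] at h2
  exact (tderiv_momentumMap_apply hmom.smooth hmom x _ ξ).trans
    ((hσ.form_swap x _ _).symm.trans h2)

/-- By Noether `X_f` lifts to a vector `v` tangent to the level set. Both `dp v` and `X_{f_c}` pair
with every `dp u` to `-df(dι u)`, so they agree by non-degeneracy of `τ`. -/
theorem exists_tderiv_eq_hamVectField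
    (hi : Manifold.IsSmoothEmbedding 𝓘(ℝ, K) 𝓘(ℝ, E) ∞ (levelIncl J c))
    (hp : Manifold.IsSubmersion 𝓘(ℝ, K) 𝓘(ℝ, S) ∞ (redProj hJ c))
    (hσ : IsAlmostSymplectic 𝓘(ℝ, E) σ) (hmom : IsMomentumMap G σ J) (hreg : IsRegularValue E J c)
    {τ : BilinField 𝓘(ℝ, S) (ReducedSpace hJ c)} (hτs : IsAlmostSymplectic 𝓘(ℝ, S) τ)
    (hτ : ∀ x, pullForm K τ (redProj hJ c) x = pullForm K σ (levelIncl J c) x)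
    {f : M → ℝ} (hf : IsInvariantFun G f) (hfs : ∀ x, SmoothAt E ℝ f x) (x : LevelSet J c) :
    ∃ v : K, tderiv K E (levelIncl J c) x v
        = vect (hamVectField 𝓘(ℝ, E) σ f) (levelIncl J c x) ∧
      tderiv K S (redProj hJ c) x v
        = vect (hamVectField 𝓘(ℝ, S) τ (redFun hJ c hf)) (redProj hJ c x) := by
  have his : ∀ y, SmoothAt K E (levelIncl J c) y := hi.contMDiff
  have hps : ∀ y, SmoothAt K S (redProj hJ c) y := hp.contMDiff
  obtain ⟨v, hv⟩ := exists_tderiv_subtypeVal_eq hi hmom.smooth x (hreg x x.2) _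
    (tderiv_momentumMap_hamVectField hσ hmom hf hfs x)
  have hv' : tderiv K E (levelIncl J c) x v
      = vect (hamVectField 𝓘(ℝ, E) σ f) (levelIncl J c x) := hv
  refine ⟨v, hv', ?_⟩
  let Y : S := vect (hamVectField 𝓘(ℝ, S) τ (redFun hJ c hf)) (redProj hJ c x)
  have hd : (tderiv S ℝ (redFun hJ c hf) (redProj hJ c x)).comp (tderiv K S (redProj hJ c) x)
      = (tderiv E ℝ f (levelIncl J c x)).comp (tderiv K E (levelIncl J c) x) :=
    (tderiv_comp (smoothAt_redFun hi hp hf hfs _) (hps x)).symm.trans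
      (tderiv_comp (f := levelIncl J c) (hfs _) (his x))
  have h1 : ∀ w : S, form τ (redProj hJ c x) (tderiv K S (redProj hJ c) x v - Y) w = 0 := by
    intro w
    obtain ⟨u, rfl⟩ := tderiv_surjective_of_isSubmersionAt (hp.isSubmersionAt x) w
    have h2 : form τ (redProj hJ c x) (tderiv K S (redProj hJ c) x v)
        (tderiv K S (redProj hJ c) x u) = form σ (levelIncl J c x)
          (tderiv K E (levelIncl J c) x v) (tderiv K E (levelIncl J c) x u) :=
      DFunLike.congr_fun (DFunLike.congr_fun (hτ x) v) u
    have h3 : form τ (redProj hJ c x) Y (tderiv K S (redProj hJ c) x u) = _ :=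
      form_hamVectField hτs _ _ _
    have h4 : tderiv S ℝ (redFun hJ c hf) (redProj hJ c x) (tderiv K S (redProj hJ c) x u)
        = tderiv E ℝ f (levelIncl J c x) (tderiv K E (levelIncl J c) x u) :=
      DFunLike.congr_fun hd u
    rw [map_sub, _root_.sub_apply, h2, h3, hv', form_hamVectField hσ, h4, sub_self]
  exact sub_eq_zero.1 (hτs.nondegenerate (redProj hJ c x) _ h1)

theorem isFullyHamiltonianFun_redFun
    (hi : Manifold.IsSmoothEmbedding 𝓘(ℝ, K) 𝓘(ℝ, E) ∞ (levelIncl J c))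
    (hp : Manifold.IsSubmersion 𝓘(ℝ, K) 𝓘(ℝ, S) ∞ (redProj hJ c))
    (hσ : IsAlmostSymplectic 𝓘(ℝ, E) σ) (hmom : IsMomentumMap G σ J) (hreg : IsRegularValue E J c)
    {τ : BilinField 𝓘(ℝ, S) (ReducedSpace hJ c)} (hτs : IsAlmostSymplectic 𝓘(ℝ, S) τ)
    (hτ : ∀ x, pullForm K τ (redProj hJ c) x = pullForm K σ (levelIncl J c) x)
    {f : M → ℝ} (hf : IsInvariantFun G f) (h : IsFullyHamiltonianFun 𝓘(ℝ, E) σ f) :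
    IsFullyHamiltonianFun 𝓘(ℝ, S) τ (redFun hJ c hf) := by
  have hfs : ∀ x, SmoothAt E ℝ f x := h.1
  have hrs := smoothAt_redFun hi hp hf hfs
  refine ⟨hrs, ⟨_, hrs, hasHamiltonian_hamVectField 𝓘(ℝ, S) hτs _⟩, ?_⟩
  exact IsSymmetry.of_related (hi.contMDiff : ∀ y, SmoothAt K E (levelIncl J c) y)
    (fun x ↦ tderiv_injective_of_isImmersionAt (hi.isImmersion.isImmersionAt x))
    (hp.contMDiff : ∀ y, SmoothAt K S (redProj hJ c) y)
    (fun x ↦ tderiv_surjective_of_isSubmersionAt (hp.isSubmersionAt x)) (surjective_redProj hJ c)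
    hσ.contDiffAt_formRep hτs.contDiffAt_formRep (fun x ↦ (hτ x).symm)
    (contDiffAt_vectRep_hamVectField hσ hfs) (contDiffAt_vectRep_hamVectField hτs hrs)
    (exists_tderiv_eq_hamVectField hi hp hσ hmom hreg hτs hτ hf hfs) h.2.2

end ReducedHamiltonian

end AlmostSymplectic

theorem mainTheorem9
    -- a Lie group `G`
    {F : Type*} [NormedAddCommGroup F] [NormedSpace ℝ F] [FiniteDimensional ℝ F]
    {G : Type*} [TopologicalSpace G] [ChartedSpace F G] [Group G] [LieGroup 𝓘(ℝ, F) ∞ G]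
    [T2Space G] [SecondCountableTopology G]
    -- an almost-symplectic manifold `(M, σ)`
    {E : Type*} [NormedAddCommGroup E] [NormedSpace ℝ E] [FiniteDimensional ℝ E]
    {M : Type*} [TopologicalSpace M] [ChartedSpace E M] [IsManifold 𝓘(ℝ, E) ∞ M]
    [T2Space M] [SecondCountableTopology M]
    (σ : BilinField 𝓘(ℝ, E) M) (hσ : IsAlmostSymplectic 𝓘(ℝ, E) σ)
    -- a smooth action of `G` on `M`
    [MulAction G M] [ContMDiffSMul 𝓘(ℝ, F) 𝓘(ℝ, E) ∞ G M]
    (has : IsAlmostSymplecticAction G σ) (hfull : IsFullyHamiltonianAction F G σ)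
    -- an equivariant momentum map, and a regular value
    (J : M → DualLieAlg F) (hmom : IsMomentumMap G σ J) (hJ : IsEquivariant G J)
    (c : DualLieAlg F) (hreg : IsRegularValue E J c)
    (hfree : ActsFreely hJ c) (hproper : ActsProperly hJ c) :
    -- `J⁻¹(c)` is an embedded submanifold and `M_c` is a smooth manifold, with `p_c` a submersion
    (T2Space (ReducedSpace hJ c) ∧ SecondCountableTopology (ReducedSpace hJ c) ∧
      ∃ (k r : ℕ) (_ : ChartedSpace (EuclideanSpace ℝ (Fin k)) (LevelSet J c))
        (_ : IsManifold (𝓡 k) ∞ (LevelSet J c))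
        (_ : ChartedSpace (EuclideanSpace ℝ (Fin r)) (ReducedSpace hJ c))
        (_ : IsManifold (𝓡 r) ∞ (ReducedSpace hJ c)),
        Manifold.IsSmoothEmbedding (𝓡 k) 𝓘(ℝ, E) ∞ (levelIncl J c) ∧
        Manifold.IsSubmersion (𝓡 k) (𝓡 r) ∞ (redProj hJ c)) ∧
    -- and, for these smooth structures:
    (∀ (k r : ℕ) [ChartedSpace (EuclideanSpace ℝ (Fin k)) (LevelSet J c)]
        [IsManifold (𝓡 k) ∞ (LevelSet J c)]
        [ChartedSpace (EuclideanSpace ℝ (Fin r)) (ReducedSpace hJ c)]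
        [IsManifold (𝓡 r) ∞ (ReducedSpace hJ c)],
      Manifold.IsSmoothEmbedding (𝓡 k) 𝓘(ℝ, E) ∞ (levelIncl J c) →
      Manifold.IsSubmersion (𝓡 k) (𝓡 r) ∞ (redProj hJ c) →
      ∃ σc : BilinField (𝓡 r) (ReducedSpace hJ c),
        -- (i) `σ_c` is almost-symplectic, and its pull-back to `J⁻¹(c)` is that of `σ`
        IsAlmostSymplectic (𝓡 r) σc ∧
        (∀ (x : LevelSet J c) (v w : TangentSpace (𝓡 k) x),
          σc (redProj hJ c x) (mfderiv (𝓡 k) (𝓡 r) (redProj hJ c) x v)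
              (mfderiv (𝓡 k) (𝓡 r) (redProj hJ c) x w)
            = σ (levelIncl J c x) (mfderiv (𝓡 k) 𝓘(ℝ, E) (levelIncl J c) x v)
              (mfderiv (𝓡 k) 𝓘(ℝ, E) (levelIncl J c) x w)) ∧
        ∀ (f : M → ℝ) (hf : IsInvariantFun G f), ContMDiff 𝓘(ℝ, E) 𝓘(ℝ, ℝ) ∞ f →
          ContMDiff (𝓡 r) 𝓘(ℝ, ℝ) ∞ (redFun hJ c hf) ∧
          -- (ii) `X_f` is tangent to `J⁻¹(c)`, and there it is `p_c`-related to `X_{f_c}`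
          (∀ x : LevelSet J c, ∃ v : TangentSpace (𝓡 k) x,
            mfderiv (𝓡 k) 𝓘(ℝ, E) (levelIncl J c) x v
              = hamVectField 𝓘(ℝ, E) σ f (levelIncl J c x) ∧
            mfderiv (𝓡 k) (𝓡 r) (redProj hJ c) x v
              = hamVectField (𝓡 r) σc (redFun hJ c hf) (redProj hJ c x)) ∧
          -- (iii) fully-Hamiltonian functions reduce to fully-Hamiltonian functions
          (IsFullyHamiltonianFun 𝓘(ℝ, E) σ f →
            IsFullyHamiltonianFun (𝓡 r) σc (redFun hJ c hf))) := by
  have := continuousConstSMul F G E M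
  refine ⟨⟨t2Space_reducedSpace hproper, secondCountableTopology_reducedSpace hJ c,
    exists_reduced_manifold hmom hreg hfree hproper⟩, ?_⟩
  intro k r _ _ _ _ hi hp
  obtain ⟨τ, hτ⟩ := exists_reduced_form hi hp hσ has hmom hreg hfree hproper
  have hτs := isAlmostSymplectic_of_pullForm_eq hi hp hσ hmom hreg hfree hproper hτ
  exact ⟨τ, hτs, fun x v w ↦ DFunLike.congr_fun (DFunLike.congr_fun (hτ x) v) w,
    fun f hf hfs ↦ ⟨smoothAt_redFun hi hp hf hfs,
      exists_tderiv_eq_hamVectField hi hp hσ hmom hreg hτs hτ hf hfs,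
      isFullyHamiltonianFun_redFun hi hp hσ hmom hreg hτs hτ hf⟩⟩
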